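/- Let $F$ be a free group with normal subgroups $R,S$, and let $\mathfrak r,\mathfrak f,\mathfrak s$ be the two-sided ideals of the integral group ring $\mathbb Z[F]$ generated by $R-1$, $F-1$, $S-1$ respectively. Write $R'=[R,R]$, $S'=[S,S]$. Then the normal subgroup $$N(F,R,S):=[R'\cap S',\,R\cap S]\,[R'\cap S,\,R'\cap S]\,[R\cap S',\,R\cap S']$$ is contained in $D(F,R,S):=F\cap(1+\mathfrak r\mathfrak f\mathfrak s)=\{w\in F: w-1\in\mathfrak r\mathfrak f\mathfrak s\}$, and there is an isomorphism of groups $$\frac{F\cap(1+\mathfrak r\mathfrak f\mathfrak s)}{[R'\cap S',R\cap S]\,[R'\cap S,R'\cap S]\,[R\cap S',R\cap S']}\;\cong\;L_1\mathsf{SP}^2\!\left(\frac{R\cap S}{(R'\cap S)(R\cap S')}\right),$$ natural in $(F,R,S)$ with respect to all group homomorphisms $\varphi:F\to F_1$ of free groups with $\varphi(R)\subseteq R_1$ and $\varphi(S)\subseteq S_1$, where $R_1,S_1$ are normal subgroups of $F_1$. Here $\mathsf{SP}^2(A)=A\otimes A/\langle a\otimes b-b\otimes a\mid a,b\in A\rangle$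 is the symmetric square of an abelian group $A$, and $L_1\mathsf{SP}^2$ is its first derived functor in the sense of Dold and Puppe: $L_1\mathsf{SP}^2(A)=\pi_1(\mathsf{SP}^2(\Gamma P))$, where $P$ is a free resolution of $A$ and $\Gamma P$ is the simplicial abelian group corresponding to $P$ under the Dold–Kan equivalence. -/

import Mathlib

open CategoryTheory
open scoped TensorProduct

universe u

/-! With all of Mathlib loaded, `⟶` is otherwise read through reflexive quivers (a definitionally
equal but inconvenient reading). -/

attribute [-instance] CategoryTheory.catToReflQuiver

noncomputable section

/-! ### The symmetric square

It is defined for modules over a commutative ring `k`; below `k = ℤ`. -/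

section SymmetricSquare

variable (k : Type) [CommRing k]

/-- The submodule of `A ⊗ A` generated by the elements `a ⊗ b - b ⊗ a`. -/
def symSquareRel (A : Type u) [AddCommGroup A] [Module k A] : Submodule k (A ⊗[k] A) :=
  Submodule.span k {t | ∃ a b : A, t = a ⊗ₜ[k] b - b ⊗ₜ[k] a}

variable {k} in
theorem symSquareRel_le_comap {A B : Type u} [AddCommGroup A] [Module k A] [AddCommGroup B]
    [Module k B] (f : A →ₗ[k] B) :
    symSquareRel k A ≤ (symSquareRel k B).comap (TensorProduct.map f f) := by
  unfold symSquareRel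
  rw [Submodule.span_le]
  rintro _ ⟨a, b, rfl⟩
  exact Submodule.subset_span ⟨f a, f b, by simp⟩

/-- The symmetric square `SP²(A) = (A ⊗ A) / ⟨a ⊗ b - b ⊗ a⟩` as a functor on `k`-modules. -/
def symSquare : ModuleCat.{u} k ⥤ ModuleCat.{u} k where
  obj A := ModuleCat.of k ((A ⊗[k] A) ⧸ symSquareRel k A)
  map f := ModuleCat.ofHom
    (Submodule.mapQ _ _ (TensorProduct.map f.hom f.hom) (symSquareRel_le_comap f.hom))
  map_id A := by
    apply ModuleCat.hom_ext
    apply LinearMap.ext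
    intro x
    obtain ⟨x, rfl⟩ := Submodule.Quotient.mk_surjective _ x
    simp
  map_comp f g := by
    apply ModuleCat.hom_ext
    apply LinearMap.ext
    intro x
    obtain ⟨x, rfl⟩ := Submodule.Quotient.mk_surjective _ x
    simp [Submodule.mapQ_apply, TensorProduct.map_comp]

end SymmetricSquare

/-- The symmetric square `SP²` on abelian groups. -/
abbrev SP2 : ModuleCat.{u} ℤ ⥤ ModuleCat.{u} ℤ := symSquare ℤ

/-! ### Derived functors of a (not necessarily additive) functor

They are defined for modules over a principal ideal domain `k`; below `k = ℤ`. -/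

section DerivedFunctors

variable (k : Type) [CommRing k]

/-- The canonical surjection `k[A] → A` from the free module on the set `A`. -/
def freeCover (A : Type u) [AddCommGroup A] [Module k A] : (A →₀ k) →ₗ[k] A :=
  Finsupp.linearCombination k id

variable {k} in
theorem freeCover_natural {A B : Type u} [AddCommGroup A] [Module k A] [AddCommGroup B]
    [Module k B] (f : A →ₗ[k] B) (x : A →₀ k) :
    freeCover k B (Finsupp.lmapDomain k k f x) = f (freeCover k A x) := by
  induction x using Finsupp.induction_linear with
  | zero => simp
  | add x y hx hy => simp only [map_add, hx, hy]
  | single a c => simp [freeCover]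

/-- The terms `k[A]`, `ker (k[A] → A)`, `0`, `0`, … of the canonical free resolution of `A`. -/
def freeResX (A : ModuleCat.{u} k) : ℕ → ModuleCat.{u} k
  | 0 => ModuleCat.of k (A →₀ k)
  | 1 => ModuleCat.of k (LinearMap.ker (freeCover k A))
  | _ + 2 => ModuleCat.of k PUnit

/-- The differential of the canonical free resolution: the inclusion in degree one. -/
def freeResD (A : ModuleCat.{u} k) : (n : ℕ) → (freeResX k A (n + 1) ⟶ freeResX k A n)
  | 0 => ModuleCat.ofHom (LinearMap.ker (freeCover k A)).subtype
  | _ + 1 => 0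

/-- The map induced by `f` on the terms of the canonical free resolutions. -/
def freeResMap {A B : ModuleCat.{u} k} (f : A ⟶ B) : (n : ℕ) → (freeResX k A n ⟶ freeResX k B n)
  | 0 => ModuleCat.ofHom (Finsupp.lmapDomain k k f.hom)
  | 1 => ModuleCat.ofHom
      ((Finsupp.lmapDomain k k f.hom).restrict (p := LinearMap.ker (freeCover k A))
        (q := LinearMap.ker (freeCover k B)) (fun x hx => by
          rw [LinearMap.mem_ker] at hx ⊢
          rw [freeCover_natural, hx, map_zero]))
  | _ + 2 => 0

theorem chainComplexOf_comm {V : Type*} [Category V] [Limits.HasZeroMorphisms V] {X Y : ℕ → V}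
    {dX : ∀ n, X (n + 1) ⟶ X n} {dY : ∀ n, Y (n + 1) ⟶ Y n} (f : ∀ n, X n ⟶ Y n)
    (sX : ∀ n, dX (n + 1) ≫ dX n = 0) (sY : ∀ n, dY (n + 1) ≫ dY n = 0)
    (h : ∀ n, f (n + 1) ≫ dY n = dX n ≫ f n) (n : ℕ) :
    f (n + 1) ≫ (ChainComplex.of Y dY sY).d (n + 1) n =
      (ChainComplex.of X dX sX).d (n + 1) n ≫ f n := by
  have hX : (ChainComplex.of X dX sX).d (n + 1) n = dX n := ChainComplex.of_d X dX n
  have hY : (ChainComplex.of Y dY sY).d (n + 1) n = dY n := ChainComplex.of_d Y dY n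
  rw [hX, hY, h]

theorem freeResMap_comm {A B : ModuleCat.{u} k} (f : A ⟶ B) (n : ℕ) :
    freeResMap k f (n + 1) ≫ freeResD k B n = freeResD k A n ≫ freeResMap k f n :=
  match n with
  | 0 => rfl
  | _ + 1 => by simp [freeResD]

/-- The canonical free resolution `⋯ → 0 → ker (k[A] → A) → k[A]` of a module `A` over the
principal ideal domain `k`, as a functor. (The kernel is free, being a submodule of a free
module over a principal ideal domain.) -/
def freeRes [IsDomain k] [IsPrincipalIdealRing k] : ModuleCat.{u} k ⥤ ChainComplex (ModuleCat.{u} k) ℕ where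
  obj A := ChainComplex.of (freeResX k A) (freeResD k A) (fun n => by simp [freeResD])
  map {A B} f := ChainComplex.ofHom (freeResMap k f) 
    (chainComplexOf_comm (freeResMap k f) _ _ (freeResMap_comm k f))
  map_id A := by
    ext n : 1
    match n with
    | 0 => exact congrArg ModuleCat.ofHom (Finsupp.lmapDomain_id k k)
    | 1 =>
      apply ModuleCat.hom_ext
      apply LinearMap.ext
      intro x
      apply Subtype.ext
      exact LinearMap.congr_fun (Finsupp.lmapDomain_id k k) x.1
    | _ + 2 => rfl
  map_comp f g := by
    ext n : 1
    match n with
    | 0 => exact congrArg ModuleCat.ofHom (Finsupp.lmapDomain_comp k k f.hom g.hom)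
    | 1 =>
      apply ModuleCat.hom_ext
      apply LinearMap.ext
      intro x
      apply Subtype.ext
      exact LinearMap.congr_fun (Finsupp.lmapDomain_comp k k f.hom g.hom) x.1
    | _ + 2 => rfl

/-- The `n`-th derived functor `L_n T` (in the sense of Dold and Puppe) of an arbitrary functor `T`
on `k`-modules: take a free resolution of `A`, turn it into a simplicial module by the inverse of
the Dold-Kan equivalence, apply `T` in each simplicial degree, and take the `n`-th homotopy group,
i.e. the `n`-th homology of the alternating face map complex. -/
def doldPuppe [IsDomain k] [IsPrincipalIdealRing k] (T : ModuleCat.{u} k ⥤ ModuleCat.{u} k) (n : ℕ) :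
    ModuleCat.{u} k ⥤ ModuleCat.{u} k :=
  freeRes k ⋙ Abelian.DoldKan.equivalence.inverse ⋙ (SimplicialObject.whiskering _ _).obj T ⋙
    AlgebraicTopology.alternatingFaceMapComplex (ModuleCat.{u} k) ⋙
    HomologicalComplex.homologyFunctor (ModuleCat.{u} k) (ComplexShape.down ℕ) n

end DerivedFunctors

/-- `L₁SP²`, the first derived functor of the symmetric square on abelian groups. -/
abbrev L1SP2 : ModuleCat.{u} ℤ ⥤ ModuleCat.{u} ℤ := doldPuppe ℤ SP2 1

/-! ### Ideals and subgroups attached to normal subgroups `R`, `S` of a group `F` -/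

section Groups

variable {F : Type u} [Group F]

/-- The two-sided ideal of the integral group ring `ℤ[F]` generated by the elements `g - 1` with
`g ∈ G` (regarded as a left ideal, in order to form products). -/
def groupRingIdeal (G : Subgroup F) : Ideal (MonoidAlgebra ℤ F) :=
  (TwoSidedIdeal.span {x | ∃ g ∈ G, x = MonoidAlgebra.of ℤ F g - 1}).asIdeal

/-- The subgroup `F ∩ (1 + 𝔯𝔣𝔰)` of `F`, where `𝔯`, `𝔣`, `𝔰` are the two-sided ideals
belonging to `R`, `F`, `S`. -/
def dimSubgroup (R S : Subgroup F) : Subgroup F where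
  carrier := {w | MonoidAlgebra.of ℤ F w - 1 ∈
    groupRingIdeal R * groupRingIdeal (⊤ : Subgroup F) * groupRingIdeal S}
  one_mem' := by
    change MonoidAlgebra.of ℤ F 1 - 1 ∈
      groupRingIdeal R * groupRingIdeal (⊤ : Subgroup F) * groupRingIdeal S
    rw [map_one, sub_self]
    exact zero_mem _
  mul_mem' {a b} ha hb := by
    simp only [Set.mem_ofPred_eq] at ha hb ⊢
    have h : MonoidAlgebra.of ℤ F (a * b) - 1 =
        MonoidAlgebra.of ℤ F a * (MonoidAlgebra.of ℤ F b - 1) + (MonoidAlgebra.of ℤ F a - 1) := by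
      rw [map_mul]; noncomm_ring
    rw [h]
    exact add_mem (Ideal.mul_mem_left _ _ hb) ha
  inv_mem' {a} ha := by
    simp only [Set.mem_ofPred_eq] at ha ⊢
    have h1 : MonoidAlgebra.of ℤ F a⁻¹ * MonoidAlgebra.of ℤ F a = 1 := by
      rw [← map_mul, inv_mul_cancel, map_one]
    have h : MonoidAlgebra.of ℤ F a⁻¹ - 1 =
        -(MonoidAlgebra.of ℤ F a⁻¹ * (MonoidAlgebra.of ℤ F a - 1)) := by
      rw [mul_sub, h1]; simp
    rw [h]
    exact neg_mem (Ideal.mul_mem_left _ _ ha)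

/-- The subgroup `[R' ∩ S', R ∩ S] [R' ∩ S, R' ∩ S] [R ∩ S', R ∩ S']` of `F`; for normal
`R` and `S` the three factors are normal, so that their product is the subgroup they generate. -/
def commSubgroup (R S : Subgroup F) : Subgroup F :=
  ⁅⁅R, R⁆ ⊓ ⁅S, S⁆, R ⊓ S⁆ ⊔ ⁅⁅R, R⁆ ⊓ S, ⁅R, R⁆ ⊓ S⁆ ⊔ ⁅R ⊓ ⁅S, S⁆, R ⊓ ⁅S, S⁆⁆

instance commSubgroup_normal (R S : Subgroup F) [R.Normal] [S.Normal] :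
    (commSubgroup R S).Normal := by
  unfold commSubgroup; infer_instance

/-- The subgroup `(R' ∩ S)(R ∩ S')` of `F`. -/
def midSubgroup (R S : Subgroup F) : Subgroup F :=
  (⁅R, R⁆ ⊓ S) ⊔ (R ⊓ ⁅S, S⁆)

instance midSubgroup_normal (R S : Subgroup F) [R.Normal] [S.Normal] :
    (midSubgroup R S).Normal := by
  unfold midSubgroup; infer_instance

/-- The quotient of `F ∩ (1 + 𝔯𝔣𝔰)` by
`[R' ∩ S', R ∩ S] [R' ∩ S, R' ∩ S] [R ∩ S', R ∩ S']`. -/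
abbrev DimQuot (R S : Subgroup F) [R.Normal] [S.Normal] : Type u :=
  dimSubgroup R S ⧸ (commSubgroup R S).subgroupOf (dimSubgroup R S)

/-- The quotient `(R ∩ S) / ((R' ∩ S)(R ∩ S'))`. -/
abbrev MidQuot (R S : Subgroup F) [R.Normal] [S.Normal] : Type u :=
  ↥(R ⊓ S) ⧸ (midSubgroup R S).subgroupOf (R ⊓ S)

/-- The group `(R ∩ S) / ((R' ∩ S)(R ∩ S'))` is commutative. -/
instance midQuotCommGroup (R S : Subgroup F) [R.Normal] [S.Normal] : CommGroup (MidQuot R S) where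
  mul_comm x y := by
    obtain ⟨a, rfl⟩ := QuotientGroup.mk_surjective x
    obtain ⟨b, rfl⟩ := QuotientGroup.mk_surjective y
    rw [← QuotientGroup.mk_mul, ← QuotientGroup.mk_mul, QuotientGroup.eq,
      Subgroup.mem_subgroupOf]
    refine Subgroup.mem_sup_left ?_
    have h : (((a * b)⁻¹ * (b * a) : ↥(R ⊓ S)) : F) =
        (b : F)⁻¹ * (a : F)⁻¹ * ((b : F)⁻¹)⁻¹ * ((a : F)⁻¹)⁻¹ := by
      simp [mul_assoc]
    rw [h, ← commutatorElement_def]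
    exact ⟨Subgroup.commutator_mem_commutator (inv_mem b.2.1) (inv_mem a.2.1),
      Subgroup.commutator_le_right S S
        (Subgroup.commutator_mem_commutator (inv_mem b.2.2) (inv_mem a.2.2))⟩

/-- `(R ∩ S) / ((R' ∩ S)(R ∩ S'))`, written additively, as an object of the category of abelian
groups. -/
abbrev midObj (R S : Subgroup F) [R.Normal] [S.Normal] : ModuleCat.{u} ℤ :=
  ModuleCat.of ℤ (Additive (MidQuot R S))

/-! ### Functoriality in the triple `(F, R, S)` -/

variable {F₁ : Type u} [Group F₁] {R S : Subgroup F} {R₁ S₁ : Subgroup F₁}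

theorem commSubgroup_map_le (φ : F →* F₁) (hR : R ≤ R₁.comap φ) (hS : S ≤ S₁.comap φ) :
    commSubgroup R S ≤ (commSubgroup R₁ S₁).comap φ := by
  rw [← Subgroup.map_le_iff_le_comap] at hR hS ⊢
  have hR' : ⁅R, R⁆.map φ ≤ ⁅R₁, R₁⁆ := by
    rw [Subgroup.map_commutator]; exact Subgroup.commutator_mono hR hR
  have hS' : ⁅S, S⁆.map φ ≤ ⁅S₁, S₁⁆ := by
    rw [Subgroup.map_commutator]; exact Subgroup.commutator_mono hS hS
  have key : ∀ {A B : Subgroup F} {A₁ B₁ : Subgroup F₁}, A.map φ ≤ A₁ → B.map φ ≤ B₁ →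
      (A ⊓ B).map φ ≤ A₁ ⊓ B₁ := fun hA hB =>
    (Subgroup.map_inf_le _ _ _).trans (inf_le_inf hA hB)
  simp only [commSubgroup, Subgroup.map_sup, Subgroup.map_commutator]
  exact sup_le_sup (sup_le_sup (Subgroup.commutator_mono (key hR' hS') (key hR hS))
    (Subgroup.commutator_mono (key hR' hS) (key hR' hS)))
    (Subgroup.commutator_mono (key hR hS') (key hR hS'))

theorem midSubgroup_map_le (φ : F →* F₁) (hR : R ≤ R₁.comap φ) (hS : S ≤ S₁.comap φ) :
    midSubgroup R S ≤ (midSubgroup R₁ S₁).comap φ := by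
  rw [← Subgroup.map_le_iff_le_comap] at hR hS ⊢
  have hR' : ⁅R, R⁆.map φ ≤ ⁅R₁, R₁⁆ := by
    rw [Subgroup.map_commutator]; exact Subgroup.commutator_mono hR hR
  have hS' : ⁅S, S⁆.map φ ≤ ⁅S₁, S₁⁆ := by
    rw [Subgroup.map_commutator]; exact Subgroup.commutator_mono hS hS
  simp only [midSubgroup, Subgroup.map_sup]
  exact sup_le_sup ((Subgroup.map_inf_le _ _ _).trans (inf_le_inf hR' hS))
    ((Subgroup.map_inf_le _ _ _).trans (inf_le_inf hR hS'))

theorem mapDomainRingHom_of (φ : F →* F₁) (g : F) :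
    MonoidAlgebra.mapDomainRingHom ℤ φ (MonoidAlgebra.of ℤ F g) =
      MonoidAlgebra.of ℤ F₁ (φ g) := by
  simp

theorem groupRingIdeal_map_mem {G : Subgroup F} {G₁ : Subgroup F₁} (φ : F →* F₁)
    (h : G ≤ G₁.comap φ) {x : MonoidAlgebra ℤ F} (hx : x ∈ groupRingIdeal G) :
    MonoidAlgebra.mapDomainRingHom ℤ φ x ∈ groupRingIdeal G₁ := by
  have hle : TwoSidedIdeal.span {x | ∃ g ∈ G, x = MonoidAlgebra.of ℤ F g - 1} ≤
      (TwoSidedIdeal.span {x | ∃ g ∈ G₁, x = MonoidAlgebra.of ℤ F₁ g - 1}).comap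
        (MonoidAlgebra.mapDomainRingHom ℤ φ) := by
    rw [TwoSidedIdeal.span_le]
    rintro _ ⟨g, hg, rfl⟩
    refine TwoSidedIdeal.subset_span ⟨φ g, h hg, ?_⟩
    rw [map_sub, map_one, mapDomainRingHom_of]
  exact hle hx

theorem ideal_mul_map_mem {A B : Type u} [Ring A] [Ring B] (f : A →+* B) {I J : Ideal A}
    {I₁ J₁ : Ideal B} (hI : ∀ x ∈ I, f x ∈ I₁) (hJ : ∀ x ∈ J, f x ∈ J₁) :
    ∀ x ∈ I * J, f x ∈ I₁ * J₁ := by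
  intro x hx
  refine Submodule.smul_induction_on hx ?_ ?_
  · intro a ha b hb
    rw [smul_eq_mul, map_mul]
    exact Ideal.mul_mem_mul (hI a ha) (hJ b hb)
  · intro a b ha hb
    rw [map_add]
    exact add_mem ha hb

theorem dimSubgroup_map_le (φ : F →* F₁) (hR : R ≤ R₁.comap φ) (hS : S ≤ S₁.comap φ) :
    dimSubgroup R S ≤ (dimSubgroup R₁ S₁).comap φ := by
  intro w hw
  have h := ideal_mul_map_mem (MonoidAlgebra.mapDomainRingHom ℤ φ)
    (ideal_mul_map_mem (MonoidAlgebra.mapDomainRingHom ℤ φ)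
      (fun x hx => groupRingIdeal_map_mem φ hR hx)
      (fun x hx => groupRingIdeal_map_mem (G₁ := ⊤) φ le_top hx))
    (fun x hx => groupRingIdeal_map_mem φ hS hx) _ hw
  rw [map_sub, map_one, mapDomainRingHom_of] at h
  exact h

/-- The homomorphism of quotients `DimQuot R S → DimQuot R₁ S₁`, `[w] ↦ [φ w]`, induced by a
homomorphism `φ : F → F₁` with `φ(R) ⊆ R₁` and `φ(S) ⊆ S₁`. -/
def dimQuotMap [R.Normal] [S.Normal] [R₁.Normal] [S₁.Normal] (φ : F →* F₁)
    (hR : R ≤ R₁.comap φ) (hS : S ≤ S₁.comap φ) : DimQuot R S →* DimQuot R₁ S₁ :=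
  QuotientGroup.map _ _
    ((φ.comp (dimSubgroup R S).subtype).codRestrict (dimSubgroup R₁ S₁)
      (fun w => dimSubgroup_map_le φ hR hS w.2))
    (fun _ hw => commSubgroup_map_le φ hR hS hw)

/-- The homomorphism `MidQuot R S → MidQuot R₁ S₁`, `[w] ↦ [φ w]`, induced by a homomorphism
`φ : F → F₁` with `φ(R) ⊆ R₁` and `φ(S) ⊆ S₁`. -/
def midQuotMap [R.Normal] [S.Normal] [R₁.Normal] [S₁.Normal] (φ : F →* F₁)
    (hR : R ≤ R₁.comap φ) (hS : S ≤ S₁.comap φ) : MidQuot R S →* MidQuot R₁ S₁ :=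
  QuotientGroup.map _ _
    ((φ.comp (R ⊓ S).subtype).codRestrict (R₁ ⊓ S₁) (fun w => ⟨hR w.2.1, hS w.2.2⟩))
    (fun _ hw => midSubgroup_map_le φ hR hS hw)

/-- `midQuotMap`, as a morphism in the category of abelian groups. -/
def midObjMap [R.Normal] [S.Normal] [R₁.Normal] [S₁.Normal] (φ : F →* F₁)
    (hR : R ≤ R₁.comap φ) (hS : S ≤ S₁.comap φ) : midObj R S ⟶ midObj R₁ S₁ :=
  ModuleCat.ofHom (MonoidHom.toAdditive (midQuotMap φ hR hS)).toIntLinearMap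

end Groups

end

/-! Put `T = R ∩ S` and `M = T_ab`. Subgroups of `F` are free, so `[a, b] ↦ a ⊗ b - b ⊗ a`
identifies `[T, T] / [[T, T], T]` with the alternating tensors `Λ² M` inside `M ⊗ M` (`altClass`,
`mem_of_altClass_eq_zero`). Both the dimension subgroup `D` and the commutator subgroup `N` lie in
`[T, T]`, and `N` contains `[[T, T], T]`; membership in either one can be read off from the class in
`Λ² M`.

For `D`, the inclusion `𝔯𝔣𝔰 ⊆ 𝔯𝔰` and `mem_commutator_of_sub_one_mem_mul` give `D ⊆ [T, T]`. Modulo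
`𝔯𝔣𝔰` the product `(u - 1) g (v - 1)` depends only on `u ⊗ v` in `R_ab ⊗ S_ab`. Conversely, freeness
of `S` yields a crossed homomorphism from which an additive map on `ℤ[F]` recovering `u ⊗ v` is
built (`exists_pairing`). So `D` consists of those `w` in `[T, T]` whose class dies in `R_ab ⊗ S_ab`
(`mem_dimSubgroup_iff`). With `K = ker (M → R_ab)` and `L = ker (M → S_ab)`, the classes of `N` form
`Alt(K ∩ L, M) + Alt(K, K) + Alt(L, L)`, where `Alt` is `altSpan` (`mem_commSubgroup_iff`).

The rest is linear algebra. By flatness the kernel of `M ⊗ M → R_ab ⊗ S_ab` is `K ⊗ M + M ⊗ L`.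
Write an alternating tensor in it as `u + v` and interchange the factors of `v`: the result `u + τ
v` lies in `I ⊗ M` for `I = K + L` and still vanishes in `SP² M`, so it is a one-cycle of the Koszul
complex `Λ² I → I ⊗ M → SP² M`. The induced map `altKernelMap` onto the first Koszul homology is
surjective, and its kernel is exactly the set of classes of `N`. Moreover `I` is the kernel of the
projection from `M` to `(R ∩ S) / ((R' ∩ S)(R ∩ S'))`.

The Koszul homology of a projective presentation depends only on the presented module
(`koszulMap_congr`, `presentationEquiv`). For the presentation coming from the Dold-Kan simplicial
resolution it is `π₁` of `SP²`, by an explicit comparison of Alexander-Whitney type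
(`squareHomologyEquiv`, `doldPuppeEquiv`). Each step is natural, because two lifts of the same map
induce the same map on Koszul homology. -/

noncomputable section

/-! ### First Koszul homology of a submodule and its homotopy invariance -/

section KoszulHomology

variable {k : Type} [CommRing k] {M M' M'' : Type*} [AddCommGroup M] [Module k M]
  [AddCommGroup M'] [Module k M'] [AddCommGroup M''] [Module k M'']

/-- The submodule of `M ⊗ M` generated by the elements `a ⊗ b` with `a ∈ I`, `b ∈ J`. -/
def tensorSpan (I J : Submodule k M) : Submodule k (M ⊗[k] M) :=
  Submodule.map₂ (TensorProduct.mk k M M) I J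

/-- The submodule of `M ⊗ M` generated by the elements `a ⊗ b - b ⊗ a` with `a ∈ I`, `b ∈ J`. -/
def altSpan (I J : Submodule k M) : Submodule k (M ⊗[k] M) :=
  Submodule.span k {t | ∃ a ∈ I, ∃ b ∈ J, t = a ⊗ₜ[k] b - b ⊗ₜ[k] a}

theorem tmul_mem_tensorSpan {I J : Submodule k M} {a b : M} (ha : a ∈ I) (hb : b ∈ J) :
    a ⊗ₜ[k] b ∈ tensorSpan I J :=
  Submodule.apply_mem_map₂ _ ha hb

theorem tensorSpan_le {I J : Submodule k M} {P : Submodule k (M ⊗[k] M)} :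
    tensorSpan I J ≤ P ↔ ∀ a ∈ I, ∀ b ∈ J, a ⊗ₜ[k] b ∈ P :=
  Submodule.map₂_le

theorem tensorSpan_mono {I J I' J' : Submodule k M} (hI : I ≤ I') (hJ : J ≤ J') :
    tensorSpan I J ≤ tensorSpan I' J' :=
  Submodule.map₂_le_map₂ hI hJ

theorem sub_mem_altSpan {I J : Submodule k M} {a b : M} (ha : a ∈ I) (hb : b ∈ J) :
    a ⊗ₜ[k] b - b ⊗ₜ[k] a ∈ altSpan I J :=
  Submodule.subset_span ⟨a, ha, b, hb, rfl⟩

theorem altSpan_le {I J : Submodule k M} {P : Submodule k (M ⊗[k] M)} :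
    altSpan I J ≤ P ↔ ∀ a ∈ I, ∀ b ∈ J, a ⊗ₜ[k] b - b ⊗ₜ[k] a ∈ P := by
  rw [altSpan, Submodule.span_le]
  exact ⟨fun h a ha b hb => h ⟨a, ha, b, hb, rfl⟩,
    fun h => by rintro _ ⟨a, ha, b, hb, rfl⟩; exact h a ha b hb⟩

theorem altSpan_mono {I J I' J' : Submodule k M} (hI : I ≤ I') (hJ : J ≤ J') :
    altSpan I J ≤ altSpan I' J' :=
  altSpan_le.2 fun _ ha _ hb => sub_mem_altSpan (hI ha) (hJ hb)

theorem symSquareRel_eq_altSpan : symSquareRel k M = altSpan ⊤ ⊤ := by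
  simp [symSquareRel, altSpan]

theorem altSpan_le_symSquareRel (I J : Submodule k M) : altSpan I J ≤ symSquareRel k M := by
  rw [symSquareRel_eq_altSpan]
  exact altSpan_mono le_top le_top

theorem altSpan_le_tensorSpan (I : Submodule k M) : altSpan I I ≤ tensorSpan I I :=
  altSpan_le.2 fun _ ha _ hb => sub_mem (tmul_mem_tensorSpan ha hb) (tmul_mem_tensorSpan hb ha)

theorem comm_eq_neg_of_mem_symSquareRel {t : M ⊗[k] M} (ht : t ∈ symSquareRel k M) :
    TensorProduct.comm k M M t = -t := by
  have h : symSquareRel k M ≤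
      LinearMap.ker ((TensorProduct.comm k M M).toLinearMap + LinearMap.id) := by
    rw [symSquareRel_eq_altSpan, altSpan_le]
    intro a _ b _
    simp
  exact eq_neg_of_add_eq_zero_left (h ht)

theorem sub_comm_mem_altSpan {I J : Submodule k M} {z : M ⊗[k] M} (hz : z ∈ tensorSpan I J) :
    z - TensorProduct.comm k M M z ∈ altSpan I J := by
  have h : tensorSpan I J ≤ (altSpan I J).comap
      (LinearMap.id - (TensorProduct.comm k M M).toLinearMap) := by
    rw [tensorSpan_le]
    intro a ha b hb
    simpa using sub_mem_altSpan ha hb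
  exact h hz

theorem comm_mem_tensorSpan {I J : Submodule k M} {z : M ⊗[k] M} (hz : z ∈ tensorSpan I J) :
    TensorProduct.comm k M M z ∈ tensorSpan J I := by
  have h : tensorSpan I J ≤ (tensorSpan J I).comap (TensorProduct.comm k M M).toLinearMap := by
    rw [tensorSpan_le]
    intro a ha b hb
    simpa using tmul_mem_tensorSpan hb ha
  exact h hz

/-- The map `id - τ` sends `a ⊗ b` to `a ⊗ b - b ⊗ a`. The preimage `z` can then be placed in
several tensor spans at once. -/
theorem exists_eq_sub_comm {I J : Submodule k M} {t : M ⊗[k] M} (ht : t ∈ altSpan I J) :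
    ∃ z ∈ tensorSpan I J, t = z - TensorProduct.comm k M M z := by
  have h : altSpan I J ≤ (tensorSpan I J).map
      (LinearMap.id - (TensorProduct.comm k M M).toLinearMap) := by
    rw [altSpan_le]
    intro a ha b hb
    exact ⟨a ⊗ₜ b, tmul_mem_tensorSpan ha hb, by simp⟩
  obtain ⟨z, hz, rfl⟩ := h ht
  exact ⟨z, hz, by simp⟩

theorem map_mem_tensorSpan {I J : Submodule k M} {I' J' : Submodule k M'} {f g : M →ₗ[k] M'}
    (hf : ∀ x ∈ I, f x ∈ I') (hg : ∀ x ∈ J, g x ∈ J') {t : M ⊗[k] M} (ht : t ∈ tensorSpan I J) :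
    TensorProduct.map f g t ∈ tensorSpan I' J' := by
  have h : tensorSpan I J ≤ (tensorSpan I' J').comap (TensorProduct.map f g) := by
    rw [tensorSpan_le]
    intro a ha b hb
    simpa using tmul_mem_tensorSpan (hf a ha) (hg b hb)
  exact h ht

theorem map_mem_altSpan {I J : Submodule k M} {I' J' : Submodule k M'} {f : M →ₗ[k] M'}
    (hI : ∀ x ∈ I, f x ∈ I') (hJ : ∀ x ∈ J, f x ∈ J') {t : M ⊗[k] M} (ht : t ∈ altSpan I J) :
    TensorProduct.map f f t ∈ altSpan I' J' := by
  have h : altSpan I J ≤ (altSpan I' J').comap (TensorProduct.map f f) := by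
    rw [altSpan_le]
    intro a ha b hb
    simpa using sub_mem_altSpan (hI a ha) (hJ b hb)
  exact h ht

theorem map_mem_symSquareRel (f : M →ₗ[k] M') {t : M ⊗[k] M} (ht : t ∈ symSquareRel k M) :
    TensorProduct.map f f t ∈ symSquareRel k M' := by
  rw [symSquareRel_eq_altSpan] at ht ⊢
  exact map_mem_altSpan (fun _ _ => Submodule.mem_top) (fun _ _ => Submodule.mem_top) ht

/-- The cycles of degree one of the Koszul complex `Λ² I → I ⊗ M → SP² M` of a submodule `I`,
as a submodule of `M ⊗ M`. -/
def koszulCycles (I : Submodule k M) : Submodule k (M ⊗[k] M) :=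
  tensorSpan I ⊤ ⊓ symSquareRel k M

/-- The first homology of the Koszul complex `Λ² I → I ⊗ M → SP² M` of a submodule `I ≤ M`
(for flat `M`, where `I ⊗ M` is a submodule of `M ⊗ M`). -/
abbrev KoszulHomology (I : Submodule k M) : Type _ :=
  koszulCycles I ⧸ (altSpan I I).comap (koszulCycles I).subtype

theorem map_mem_koszulCycles {I : Submodule k M} {I' : Submodule k M'} {f : M →ₗ[k] M'}
    (hf : ∀ x ∈ I, f x ∈ I') {t : M ⊗[k] M} (ht : t ∈ koszulCycles I) :
    TensorProduct.map f f t ∈ koszulCycles I' :=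
  ⟨map_mem_tensorSpan hf (fun _ _ => Submodule.mem_top) ht.1, map_mem_symSquareRel f ht.2⟩

/-- The map induced on cycles by `f : M → M'` with `f(I) ⊆ I'`. -/
def koszulCyclesMap {I : Submodule k M} {I' : Submodule k M'} (f : M →ₗ[k] M')
    (hf : ∀ x ∈ I, f x ∈ I') : koszulCycles I →ₗ[k] koszulCycles I' :=
  (TensorProduct.map f f).restrict (fun _ ht => map_mem_koszulCycles hf ht)

/-- The map induced on Koszul homology by `f : M → M'` with `f(I) ⊆ I'`. -/
def koszulMap {I : Submodule k M} {I' : Submodule k M'} (f : M →ₗ[k] M')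
    (hf : ∀ x ∈ I, f x ∈ I') : KoszulHomology I →ₗ[k] KoszulHomology I' :=
  Submodule.mapQ _ _ (koszulCyclesMap f hf) (fun _ ht => map_mem_altSpan hf hf ht)

/-- The class of a cycle in Koszul homology. -/
def koszulClass {I : Submodule k M} (t : M ⊗[k] M) (ht : t ∈ koszulCycles I) : KoszulHomology I :=
  Submodule.Quotient.mk ⟨t, ht⟩

theorem koszulMap_class {I : Submodule k M} {I' : Submodule k M'} (f : M →ₗ[k] M')
    (hf : ∀ x ∈ I, f x ∈ I') (t : M ⊗[k] M) (ht : t ∈ koszulCycles I) :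
    koszulMap f hf (koszulClass t ht) =
      koszulClass (TensorProduct.map f f t) (map_mem_koszulCycles hf ht) :=
  rfl

theorem koszulClass_surjective {I : Submodule k M} (x : KoszulHomology I) :
    ∃ t ht, x = koszulClass t ht := by
  obtain ⟨⟨t, ht⟩, rfl⟩ := Submodule.Quotient.mk_surjective _ x
  exact ⟨t, ht, rfl⟩

theorem koszulClass_eq_iff {I : Submodule k M} {t t' : M ⊗[k] M} {ht : t ∈ koszulCycles I}
    {ht' : t' ∈ koszulCycles I} : koszulClass t ht = koszulClass t' ht' ↔ t - t' ∈ altSpan I I := by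
  rw [koszulClass, koszulClass, Submodule.Quotient.eq]
  rfl

theorem koszulClass_eq_zero_iff {I : Submodule k M} {t : M ⊗[k] M} {ht : t ∈ koszulCycles I} :
    koszulClass t ht = 0 ↔ t ∈ altSpan I I := by
  rw [koszulClass, Submodule.Quotient.mk_eq_zero]
  rfl

theorem koszulMap_comp {I : Submodule k M} {I' : Submodule k M'} {I'' : Submodule k M''}
    (f : M →ₗ[k] M') (hf : ∀ x ∈ I, f x ∈ I') (g : M' →ₗ[k] M'') (hg : ∀ x ∈ I', g x ∈ I'')
    (x : KoszulHomology I) :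
    koszulMap g hg (koszulMap f hf x) = koszulMap (g ∘ₗ f) (fun x hx => hg _ (hf x hx)) x := by
  obtain ⟨t, ht, rfl⟩ := koszulClass_surjective x
  rw [koszulMap_class, koszulMap_class, koszulMap_class, koszulClass_eq_iff,
    TensorProduct.map_comp]
  simp

theorem koszulMap_id {I : Submodule k M} (h : ∀ x ∈ I, (LinearMap.id : M →ₗ[k] M) x ∈ I)
    (x : KoszulHomology I) : koszulMap LinearMap.id h x = x := by
  obtain ⟨t, ht, rfl⟩ := koszulClass_surjective x
  rw [koszulMap_class, koszulClass_eq_iff]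
  simp

/-- Homotopic maps agree on Koszul homology. -/
theorem koszulMap_congr {I : Submodule k M} {I' : Submodule k M'} {f g : M →ₗ[k] M'}
    (hf : ∀ x ∈ I, f x ∈ I') (hg : ∀ x ∈ I, g x ∈ I') (h : ∀ x, f x - g x ∈ I')
    (x : KoszulHomology I) : koszulMap f hf x = koszulMap g hg x := by
  obtain ⟨t, ht, rfl⟩ := koszulClass_surjective x
  rw [koszulMap_class, koszulMap_class, koszulClass_eq_iff]
  -- Write `f = g + d` with `d` taking values in `I'`. The images of `t` differ by `(d ⊗ d) t + (d ⊗
  -- g) t + (g ⊗ d) t`, and `τ t = -t` turns the last term into `-τ ((d ⊗ g) t)`.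
  obtain ⟨d, rfl⟩ : ∃ d, f = g + d := ⟨f - g, by simp⟩
  simp only [LinearMap.add_apply, add_sub_cancel_left] at h
  have h1 : TensorProduct.map d d t ∈ altSpan I' I' := by
    have := ht.2
    rw [symSquareRel_eq_altSpan] at this
    exact map_mem_altSpan (fun x _ => h x) (fun x _ => h x) this
  -- Since `t = -τ t`, the cycle `t` also lies in `M ⊗ I`; here `d` maps all of `M`, and `g` maps
  -- `I`, into `I'`.
  have h2 : TensorProduct.map d g t ∈ tensorSpan I' I' := by
    have h3 := comm_mem_tensorSpan ht.1
    rw [comm_eq_neg_of_mem_symSquareRel ht.2, neg_mem_iff] at h3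
    exact map_mem_tensorSpan (fun x _ => h x) hg h3
  have h3 : TensorProduct.map g d t = - TensorProduct.comm k M' M' (TensorProduct.map d g t) := by
    rw [← TensorProduct.map_comm, comm_eq_neg_of_mem_symSquareRel ht.2, map_neg, neg_neg]
  have h4 : TensorProduct.map (g + d) (g + d) t - TensorProduct.map g g t =
      TensorProduct.map d d t + (TensorProduct.map d g t -
        TensorProduct.comm k M' M' (TensorProduct.map d g t)) := by
    simp only [TensorProduct.map_add_left, TensorProduct.map_add_right, LinearMap.add_apply, h3]
    abel
  rw [h4]
  exact add_mem h1 (sub_comm_mem_altSpan h2)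

end KoszulHomology

/-! ### Independence of the projective presentation -/

section Presentations

variable {k : Type} [CommRing k] {M M' M'' C C' C'' : Type*}
  [AddCommGroup M] [Module k M] [AddCommGroup M'] [Module k M'] [AddCommGroup M''] [Module k M'']
  [AddCommGroup C] [Module k C] [AddCommGroup C'] [Module k C'] [AddCommGroup C''] [Module k C'']

/-- A lift `M → M'` of `f : C → C'` to presentations `p : M → C` and `p' : M' → C'`. -/
def presentationLift [Module.Projective k M] (p : M →ₗ[k] C) (p' : M' →ₗ[k] C')
    (hp' : Function.Surjective p') (f : C →ₗ[k] C') : M →ₗ[k] M' :=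
  (Module.projective_lifting_property p' (f ∘ₗ p) hp').choose

theorem presentationLift_spec [Module.Projective k M] (p : M →ₗ[k] C) (p' : M' →ₗ[k] C')
    (hp' : Function.Surjective p') (f : C →ₗ[k] C') (x : M) :
    p' (presentationLift p p' hp' f x) = f (p x) :=
  LinearMap.congr_fun (Module.projective_lifting_property p' (f ∘ₗ p) hp').choose_spec x

theorem mem_ker_of_lift {p : M →ₗ[k] C} {p' : M' →ₗ[k] C'} {f : C →ₗ[k] C'} {g : M →ₗ[k] M'}
    (hg : ∀ x, p' (g x) = f (p x)) : ∀ x ∈ LinearMap.ker p, g x ∈ LinearMap.ker p' :=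
  fun x hx => by rw [LinearMap.mem_ker] at hx ⊢; rw [hg, hx, map_zero]

/-- The map on Koszul homology of presentations induced by `f : C → C'`. -/
def presentationMap [Module.Projective k M] (p : M →ₗ[k] C) (p' : M' →ₗ[k] C')
    (hp' : Function.Surjective p') (f : C →ₗ[k] C') :
    KoszulHomology (LinearMap.ker p) →ₗ[k] KoszulHomology (LinearMap.ker p') :=
  koszulMap (presentationLift p p' hp' f) (mem_ker_of_lift (presentationLift_spec p p' hp' f))

/-- Two lifts of `f` differ by a map into `ker p'`, so homotopy invariance applies. -/
theorem koszulMap_eq_of_lift {p : M →ₗ[k] C} {p' : M' →ₗ[k] C'} {f : C →ₗ[k] C'}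
    {g g' : M →ₗ[k] M'} (hg : ∀ x, p' (g x) = f (p x)) (hg' : ∀ x, p' (g' x) = f (p x))
    (x : KoszulHomology (LinearMap.ker p)) :
    koszulMap g (mem_ker_of_lift hg) x = koszulMap g' (mem_ker_of_lift hg') x :=
  koszulMap_congr _ _ (fun x => by rw [LinearMap.mem_ker, map_sub, hg, hg', sub_self]) x

theorem presentationMap_comp [Module.Projective k M] [Module.Projective k M']
    (p : M →ₗ[k] C) (p' : M' →ₗ[k] C') (p'' : M'' →ₗ[k] C'')
    (hp' : Function.Surjective p') (hp'' : Function.Surjective p'') (f : C →ₗ[k] C')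
    (f' : C' →ₗ[k] C'') (x : KoszulHomology (LinearMap.ker p)) :
    presentationMap p' p'' hp'' f' (presentationMap p p' hp' f x) =
      presentationMap p p'' hp'' (f' ∘ₗ f) x := by
  rw [presentationMap, presentationMap, koszulMap_comp]
  exact koszulMap_eq_of_lift (f := f' ∘ₗ f) (fun x => by simp [presentationLift_spec])
    (presentationLift_spec _ _ _ _) x

theorem presentationMap_id [Module.Projective k M] (p : M →ₗ[k] C) (hp : Function.Surjective p)
    (x : KoszulHomology (LinearMap.ker p)) : presentationMap p p hp LinearMap.id x = x := by
  have h := koszulMap_congr (I' := LinearMap.ker p) (g := LinearMap.id)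
    (mem_ker_of_lift (presentationLift_spec p p hp LinearMap.id)) (fun x hx => hx)
    (fun x => by simp [presentationLift_spec]) x
  rw [presentationMap, h, koszulMap_id]

/-- The Koszul homology of projective presentations depends only on the presented module. -/
def presentationEquiv [Module.Projective k M] [Module.Projective k M'] (p : M →ₗ[k] C)
    (p' : M' →ₗ[k] C) (hp : Function.Surjective p) (hp' : Function.Surjective p') :
    KoszulHomology (LinearMap.ker p) ≃ₗ[k] KoszulHomology (LinearMap.ker p') :=
  LinearEquiv.ofLinearMap (presentationMap p p' hp' LinearMap.id)
    (presentationMap p' p hp LinearMap.id)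
    (LinearMap.ext fun x => by
      simp only [LinearMap.comp_apply, presentationMap_comp]
      exact presentationMap_id p' hp' x)
    (LinearMap.ext fun x => by
      simp only [LinearMap.comp_apply, presentationMap_comp]
      exact presentationMap_id p hp x)

/-- Both composites are induced by lifts `M → N'` of the same map `f`, so `koszulMap_eq_of_lift`
identifies them. -/
theorem presentationEquiv_naturality {N N' : Type*} [AddCommGroup N] [Module k N]
    [AddCommGroup N'] [Module k N'] [Module.Projective k M] [Module.Projective k M']
    [Module.Projective k N] [Module.Projective k N']
    (p : M →ₗ[k] C) (p' : M' →ₗ[k] C') (q : N →ₗ[k] C) (q' : N' →ₗ[k] C')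
    (hp : Function.Surjective p) (hp' : Function.Surjective p')
    (hq : Function.Surjective q) (hq' : Function.Surjective q')
    (f : C →ₗ[k] C') (g : M →ₗ[k] M') (hg : ∀ x, p' (g x) = f (p x))
    (h : N →ₗ[k] N') (hh : ∀ x, q' (h x) = f (q x)) (x : KoszulHomology (LinearMap.ker p)) :
    presentationEquiv p' q' hp' hq' (koszulMap g (mem_ker_of_lift hg) x) =
      koszulMap h (mem_ker_of_lift hh) (presentationEquiv p q hp hq x) := by
  change presentationMap p' q' hq' LinearMap.id _ = koszulMap h _ (presentationMap p q hq _ x)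
  rw [presentationMap, presentationMap, koszulMap_comp, koszulMap_comp]
  exact koszulMap_eq_of_lift (f := f) (fun x => by simp [presentationLift_spec, hg])
    (fun x => by simp [presentationLift_spec, hh]) x

end Presentations

/-! ### Alternating tensors in the kernel of `f ⊗ g` -/

section AlternatingKernel

variable {k : Type} [CommRing k] {M A B : Type*} [AddCommGroup M] [Module k M]
  [AddCommGroup A] [Module k A] [AddCommGroup B] [Module k B]

theorem tensorSpan_eq_range (I J : Submodule k M) :
    tensorSpan I J = LinearMap.range (TensorProduct.map I.subtype J.subtype) := by
  rw [TensorProduct.range_map, Submodule.range_subtype, Submodule.range_subtype]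
  rfl

theorem tensorSpan_top_right_eq_range (I : Submodule k M) :
    tensorSpan I ⊤ = LinearMap.range (I.subtype.rTensor M) := by
  rw [LinearMap.rTensor, TensorProduct.range_map, Submodule.range_subtype, LinearMap.range_id]
  rfl

theorem tensorSpan_top_left_eq_range (I : Submodule k M) :
    tensorSpan ⊤ I = LinearMap.range (I.subtype.lTensor M) := by
  rw [LinearMap.lTensor, TensorProduct.range_map, Submodule.range_subtype, LinearMap.range_id]
  rfl

/-- Lift `z` to `K ⊗ M`. Its image in `K ⊗ range g` dies in `M ⊗ range g`, hence is zero by flatness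
of `range g`, and exactness of `K ⊗ ker g → K ⊗ M → K ⊗ range g` gives the claim. -/
theorem tensorSpan_top_inf_top_tensorSpan (K : Submodule k M) (g : M →ₗ[k] B)
    [Module.Flat k (LinearMap.range g)] {z : M ⊗[k] M} (hz : z ∈ tensorSpan K ⊤)
    (hz' : z ∈ tensorSpan ⊤ (LinearMap.ker g)) : z ∈ tensorSpan K (LinearMap.ker g) := by
  have hex : Function.Exact (LinearMap.ker g).subtype g.rangeRestrict := by
    intro x
    simp [Subtype.ext_iff]
  rw [tensorSpan_top_right_eq_range] at hz
  obtain ⟨y, rfl⟩ := hz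
  rw [tensorSpan_top_left_eq_range] at hz'
  obtain ⟨y', hy'⟩ := hz'
  have h1 : (g.rangeRestrict.lTensor M) (K.subtype.rTensor M y) = 0 := by
    rw [← hy']
    exact (lTensor_exact M hex g.surjective_rangeRestrict).apply_apply_eq_zero y'
  have h2 : K.subtype.rTensor (LinearMap.range g) (g.rangeRestrict.lTensor K y) = 0 := by
    rw [← h1]
    simp only [← LinearMap.comp_apply, LinearMap.rTensor_comp_lTensor,
      LinearMap.lTensor_comp_rTensor]
  have h3 := Module.Flat.rTensor_preserves_injective_linearMap (M := LinearMap.range g) K.subtype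
    K.subtype_injective (h2.trans (map_zero _).symm)
  obtain ⟨y'', rfl⟩ := (lTensor_exact K hex g.surjective_rangeRestrict y).1 h3
  rw [tensorSpan_eq_range]
  refine ⟨y'', ?_⟩
  simp only [← LinearMap.comp_apply, LinearMap.rTensor_comp_lTensor]

/-- For flat `M` the span of `ker h ⊗ M` is the kernel of `h ⊗ id`. This is applied to `f`, to `g`
and to the pair `(f, g)`, whose kernel is the intersection. -/
theorem tensorSpan_top_inf_tensorSpan_top (f : M →ₗ[k] A) (g : M →ₗ[k] B) [Module.Flat k M]
    {z : M ⊗[k] M} (hz : z ∈ tensorSpan (LinearMap.ker f) ⊤)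
    (hz' : z ∈ tensorSpan (LinearMap.ker g) ⊤) :
    z ∈ tensorSpan (LinearMap.ker f ⊓ LinearMap.ker g) ⊤ := by
  have hex : ∀ {N : Type _} [AddCommGroup N] [Module k N] (h : M →ₗ[k] N) (w : M ⊗[k] M),
      w ∈ tensorSpan (LinearMap.ker h) ⊤ ↔ h.rTensor M w = 0 := by
    intro N _ _ h w
    rw [tensorSpan_top_right_eq_range]
    exact (Module.Flat.rTensor_exact M (LinearMap.exact_subtype_ker_map h) w).symm
  rw [hex] at hz
  have hz' : g.rTensor M z = 0 := by
    rw [tensorSpan_top_right_eq_range] at hz'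
    exact (Module.Flat.rTensor_exact M (LinearMap.exact_subtype_ker_map g) z).2 hz'
  rw [← LinearMap.ker_prod, tensorSpan_top_right_eq_range]
  refine (Module.Flat.rTensor_exact M (LinearMap.exact_subtype_ker_map (f.prod g)) z).1 ?_
  apply (TensorProduct.prodLeft k k A B M).injective
  have h : ∀ w : M ⊗[k] M, TensorProduct.prodLeft k k A B M ((f.prod g).rTensor M w) =
      (f.rTensor M w, g.rTensor M w) := by
    intro w
    induction w with
    | zero => simp only [map_zero]; rfl
    | add x y hx hy => rw [map_add, map_add, hx, hy]; simp
    | tmul x y => simp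
  rw [h, hz, hz', map_zero]
  rfl

/-- Factor `f` and `g` through their ranges. The kernel of the tensor product of the two surjections
is known by right exactness, and the tensor product of the two inclusions stays injective by
flatness. -/
theorem ker_map_le_sup (f : M →ₗ[k] A) (g : M →ₗ[k] B) [Module.Flat k A]
    [Module.Flat k (LinearMap.range g)] :
    LinearMap.ker (TensorProduct.map f g) ≤
      tensorSpan (LinearMap.ker f) ⊤ ⊔ tensorSpan ⊤ (LinearMap.ker g) := by
  intro z hz
  have h1 : TensorProduct.map f g = TensorProduct.map (LinearMap.range f).subtype
      (LinearMap.range g).subtype ∘ₗ TensorProduct.map f.rangeRestrict g.rangeRestrict := by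
    rw [← TensorProduct.map_comp]
    rfl
  rw [LinearMap.mem_ker, h1, LinearMap.comp_apply] at hz
  have hz := TensorProduct.map_injective_of_flat_flat _ _ (Submodule.subtype_injective _)
    (Submodule.subtype_injective _) (hz.trans (map_zero _).symm)
  rw [← LinearMap.mem_ker, TensorProduct.map_ker (f := (LinearMap.ker f).subtype)
    (f' := (LinearMap.ker g).subtype) (fun x => by simp [Subtype.ext_iff])
    f.surjective_rangeRestrict (fun x => by simp [Subtype.ext_iff])
    g.surjective_rangeRestrict, sup_comm] at hz
  rwa [tensorSpan_top_right_eq_range, tensorSpan_top_left_eq_range]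

theorem sup_le_ker_map (f : M →ₗ[k] A) (g : M →ₗ[k] B) :
    tensorSpan (LinearMap.ker f) ⊤ ⊔ tensorSpan ⊤ (LinearMap.ker g) ≤
      LinearMap.ker (TensorProduct.map f g) := by
  refine sup_le (tensorSpan_le.2 ?_) (tensorSpan_le.2 ?_)
  · intro a ha b _
    rw [LinearMap.mem_ker] at ha ⊢
    simp [ha]
  · intro a _ b hb
    rw [LinearMap.mem_ker] at hb ⊢
    simp [hb]

/-- Interchanging the factors moves `v` into `L ⊗ M` and changes the sum by `v - τ v`, which is zero
in the symmetric square. -/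
theorem add_comm_mem_koszulCycles {K L : Submodule k M} {u v : M ⊗[k] M}
    (hu : u ∈ tensorSpan K ⊤) (hv : v ∈ tensorSpan ⊤ L) (h : u + v ∈ symSquareRel k M) :
    u + TensorProduct.comm k M M v ∈ koszulCycles (K ⊔ L) := by
  refine ⟨add_mem (tensorSpan_mono le_sup_left le_rfl hu)
    (tensorSpan_mono le_sup_right le_rfl (comm_mem_tensorSpan hv)), ?_⟩
  have h1 : u + TensorProduct.comm k M M v = (u + v) - (v - TensorProduct.comm k M M v) := by abel
  rw [h1]
  exact sub_mem h (altSpan_le_symSquareRel _ _ (sub_comm_mem_altSpan hv))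

/-- This makes `altKernelMap` well defined: two decompositions differ by `z = u - u' = v' - v`,
which lies in `K ⊗ ker g`, and the corresponding cycles differ by `z - τ z`. -/
theorem sub_mem_altSpan_of_add_eq {K : Submodule k M} (g : M →ₗ[k] B)
    [Module.Flat k (LinearMap.range g)] {u v u' v' : M ⊗[k] M}
    (hu : u ∈ tensorSpan K ⊤) (hv : v ∈ tensorSpan ⊤ (LinearMap.ker g))
    (hu' : u' ∈ tensorSpan K ⊤) (hv' : v' ∈ tensorSpan ⊤ (LinearMap.ker g))
    (h : u + v = u' + v') :
    (u + TensorProduct.comm k M M v) - (u' + TensorProduct.comm k M M v') ∈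
      altSpan (K ⊔ LinearMap.ker g) (K ⊔ LinearMap.ker g) := by
  have h1 : u - u' = v' - v := by
    rw [sub_eq_sub_iff_add_eq_add, h, add_comm]
  have h2 : u - u' ∈ tensorSpan K (LinearMap.ker g) :=
    tensorSpan_top_inf_top_tensorSpan K g (sub_mem hu hu') (h1 ▸ sub_mem hv' hv)
  have h3 := altSpan_mono (I' := K ⊔ LinearMap.ker g) (J' := K ⊔ LinearMap.ker g) le_sup_left
    le_sup_right (sub_comm_mem_altSpan h2)
  convert h3 using 1
  nth_rewrite 2 [h1]
  rw [map_sub]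
  abel

/-- The alternating elements of `M ⊗ M` in the kernel of `f ⊗ g`. -/
def altKernel (f : M →ₗ[k] A) (g : M →ₗ[k] B) : Submodule k (M ⊗[k] M) :=
  symSquareRel k M ⊓ LinearMap.ker (TensorProduct.map f g)

variable (f : M →ₗ[k] A) (g : M →ₗ[k] B) [Module.Flat k A] [Module.Flat k (LinearMap.range g)]

theorem exists_add_of_mem_altKernel {w : M ⊗[k] M} (hw : w ∈ altKernel f g) :
    ∃ u v, u ∈ tensorSpan (LinearMap.ker f) ⊤ ∧ v ∈ tensorSpan ⊤ (LinearMap.ker g) ∧ w = u + v := by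
  obtain ⟨u, hu, v, hv, h⟩ := Submodule.mem_sup.1 (ker_map_le_sup f g hw.2)
  exact ⟨u, v, hu, hv, h.symm⟩

/-- One class serves all decompositions of `w`, so linearity of `altKernelMap` can be checked by
adding decompositions. -/
theorem exists_koszulClass_of_mem_altKernel (w : altKernel f g) :
    ∃ c : KoszulHomology (LinearMap.ker f ⊔ LinearMap.ker g), ∀ u v,
      ∀ (hu : u ∈ tensorSpan (LinearMap.ker f) ⊤) (hv : v ∈ tensorSpan ⊤ (LinearMap.ker g))
        (h : (w : M ⊗[k] M) = u + v), c = koszulClass (u + TensorProduct.comm k M M v)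
          (add_comm_mem_koszulCycles hu hv (h ▸ w.2.1)) := by
  obtain ⟨u, v, hu, hv, h⟩ := exists_add_of_mem_altKernel f g w.2
  refine ⟨koszulClass (u + TensorProduct.comm k M M v)
    (add_comm_mem_koszulCycles hu hv (h ▸ w.2.1)), fun u' v' hu' hv' h' => ?_⟩
  rw [koszulClass_eq_iff]
  exact sub_mem_altSpan_of_add_eq g hu hv hu' hv' (h.symm.trans h')

/-- The map sending an alternating element `u + v`, where `u ∈ ker f ⊗ M` and `v ∈ M ⊗ ker g`, to
the class of `u + τ v`, where `τ` interchanges the factors. -/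
def altKernelMap : altKernel f g →ₗ[k] KoszulHomology (LinearMap.ker f ⊔ LinearMap.ker g) where
  toFun w := (exists_koszulClass_of_mem_altKernel f g w).choose
  map_add' w w' := by
    obtain ⟨u, v, hu, hv, h⟩ := exists_add_of_mem_altKernel f g w.2
    obtain ⟨u', v', hu', hv', h'⟩ := exists_add_of_mem_altKernel f g w'.2
    rw [(exists_koszulClass_of_mem_altKernel f g w).choose_spec u v hu hv h,
      (exists_koszulClass_of_mem_altKernel f g w').choose_spec u' v' hu' hv' h',
      (exists_koszulClass_of_mem_altKernel f g (w + w')).choose_spec (u + u') (v + v')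
        (add_mem hu hu') (add_mem hv hv') (by rw [Submodule.coe_add, h, h']; abel)]
    refine congrArg Submodule.Quotient.mk (Subtype.ext ?_)
    simp only [map_add, Submodule.coe_add]
    abel
  map_smul' c w := by
    obtain ⟨u, v, hu, hv, h⟩ := exists_add_of_mem_altKernel f g w.2
    rw [(exists_koszulClass_of_mem_altKernel f g w).choose_spec u v hu hv h,
      (exists_koszulClass_of_mem_altKernel f g (c • w)).choose_spec (c • u) (c • v)
        (Submodule.smul_mem _ _ hu) (Submodule.smul_mem _ _ hv)
        (by rw [Submodule.coe_smul, h, smul_add])]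
    refine congrArg Submodule.Quotient.mk (Subtype.ext ?_)
    simp

variable {f g}

theorem altKernelMap_apply (w : altKernel f g) {u v : M ⊗[k] M}
    (hu : u ∈ tensorSpan (LinearMap.ker f) ⊤) (hv : v ∈ tensorSpan ⊤ (LinearMap.ker g))
    (h : (w : M ⊗[k] M) = u + v) : altKernelMap f g w =
      koszulClass (u + TensorProduct.comm k M M v)
        (add_comm_mem_koszulCycles hu hv (h ▸ w.2.1)) :=
  (exists_koszulClass_of_mem_altKernel f g w).choose_spec u v hu hv h

variable (f g)

/-- The interchange is reversible: split a cycle as `u + v` with `u` in `ker f ⊗ M` and `v` in `ker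
g ⊗ M`; then `u + τ v` is a preimage. -/
theorem altKernelMap_surjective : Function.Surjective (altKernelMap f g) := by
  intro x
  obtain ⟨t, ht, rfl⟩ := koszulClass_surjective x
  have h1 := ht.1
  rw [tensorSpan, Submodule.map₂_sup_left] at h1
  obtain ⟨u, hu, v, hv, rfl⟩ := Submodule.mem_sup.1 h1
  have hv' : TensorProduct.comm k M M v ∈ tensorSpan ⊤ (LinearMap.ker g) := comm_mem_tensorSpan hv
  have hw : u + TensorProduct.comm k M M v ∈ altKernel f g := by
    refine ⟨?_, sup_le_ker_map f g (Submodule.add_mem_sup hu hv')⟩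
    have h2 : u + TensorProduct.comm k M M v = (u + v) - (v - TensorProduct.comm k M M v) := by abel
    rw [h2]
    exact sub_mem ht.2 (altSpan_le_symSquareRel _ _ (sub_comm_mem_altSpan hv))
  refine ⟨⟨_, hw⟩, ?_⟩
  rw [altKernelMap_apply _ hu hv' rfl, koszulClass_eq_iff]
  simp

theorem altSpan_sup_le (K L : Submodule k M) :
    altSpan (K ⊔ L) (K ⊔ L) ≤ altSpan K K ⊔ altSpan K L ⊔ altSpan L L := by
  rw [altSpan_le]
  intro a ha b hb
  obtain ⟨a, haK, a', haL, rfl⟩ := Submodule.mem_sup.1 ha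
  obtain ⟨b, hbK, b', hbL, rfl⟩ := Submodule.mem_sup.1 hb
  have h : (a + a') ⊗ₜ[k] (b + b') - (b + b') ⊗ₜ[k] (a + a') =
      (a ⊗ₜ b - b ⊗ₜ a) + ((a ⊗ₜ b' - b' ⊗ₜ a) - (b ⊗ₜ a' - a' ⊗ₜ b)) +
        (a' ⊗ₜ b' - b' ⊗ₜ a') := by
    simp only [TensorProduct.add_tmul, TensorProduct.tmul_add]
    abel
  rw [h]
  exact Submodule.add_mem_sup (Submodule.add_mem_sup (sub_mem_altSpan haK hbK)
    (sub_mem (sub_mem_altSpan haK hbL) (sub_mem_altSpan hbK haL))) (sub_mem_altSpan haL hbL)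

/-- Suppose `u + τ v = a + (z - τ z) + c` with `a` alternating over `ker f`, `c` alternating over
`ker g` and `z` in `ker f ⊗ ker g`. Then `y = u - a - z = -τ (v + c + z)` lies in both `ker f ⊗ M`
and `ker g ⊗ M`, hence in `(ker f ∩ ker g) ⊗ M`, and `w = (y - τ y) + a - c`. -/
theorem altKernelMap_eq_zero_iff [Module.Flat k M] (w : altKernel f g) :
    altKernelMap f g w = 0 ↔ (w : M ⊗[k] M) ∈
      altSpan (LinearMap.ker f ⊓ LinearMap.ker g) ⊤ ⊔
        altSpan (LinearMap.ker f) (LinearMap.ker f) ⊔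
          altSpan (LinearMap.ker g) (LinearMap.ker g) := by
  constructor
  · intro hw
    obtain ⟨u, v, hu, hv, h⟩ := exists_add_of_mem_altKernel f g w.2
    rw [altKernelMap_apply w hu hv h, koszulClass_eq_zero_iff] at hw
    obtain ⟨ab, hab, c, hc, hw⟩ := Submodule.mem_sup.1 (altSpan_sup_le _ _ hw)
    obtain ⟨a, ha, b, hb, rfl⟩ := Submodule.mem_sup.1 hab
    obtain ⟨z, hz, rfl⟩ := exists_eq_sub_comm hb
    have hc' := comm_eq_neg_of_mem_symSquareRel (altSpan_le_symSquareRel _ _ hc)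
    have hz1 : z ∈ tensorSpan (LinearMap.ker f) ⊤ := tensorSpan_mono le_rfl le_top hz
    have hz2 : z ∈ tensorSpan ⊤ (LinearMap.ker g) := tensorSpan_mono le_top le_rfl hz
    have ha1 : a ∈ tensorSpan (LinearMap.ker f) ⊤ :=
      tensorSpan_mono le_rfl le_top (altSpan_le_tensorSpan _ ha)
    have hc1 : c ∈ tensorSpan ⊤ (LinearMap.ker g) :=
      tensorSpan_mono le_top le_rfl (altSpan_le_tensorSpan _ hc)
    have h1 : u - a - z ∈ tensorSpan (LinearMap.ker f) ⊤ := sub_mem (sub_mem hu ha1) hz1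
    have h2 : v + c + z ∈ tensorSpan ⊤ (LinearMap.ker g) := add_mem (add_mem hv hc1) hz2
    have h3 : u - a - z = - TensorProduct.comm k M M (v + c + z) := by
      rw [map_add, map_add, hc', eq_neg_iff_add_eq_zero]
      have : u + TensorProduct.comm k M M v -
        (a + (z - TensorProduct.comm k M M z) + c) = 0 := by rw [hw, sub_self]
      rw [← this]
      abel
    have h4 : u - a - z ∈ tensorSpan (LinearMap.ker f ⊓ LinearMap.ker g) ⊤ :=
      tensorSpan_top_inf_tensorSpan_top f g h1 (by rw [h3]; exact neg_mem (comm_mem_tensorSpan h2))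
    have h5 : TensorProduct.comm k M M (u - a - z) = - (v + c + z) := by
      rw [h3, map_neg]
      simp
    have h6 : (w : M ⊗[k] M) =
        ((u - a - z) - TensorProduct.comm k M M (u - a - z)) + a + -c := by
      rw [h5, h]
      abel
    rw [h6]
    exact Submodule.add_mem_sup (Submodule.add_mem_sup (sub_comm_mem_altSpan h4) ha) (neg_mem hc)
  · suffices h : altSpan (LinearMap.ker f ⊓ LinearMap.ker g) ⊤ ⊔
        altSpan (LinearMap.ker f) (LinearMap.ker f) ⊔
          altSpan (LinearMap.ker g) (LinearMap.ker g) ≤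
            (LinearMap.ker (altKernelMap f g)).map (altKernel f g).subtype by
      intro hw
      obtain ⟨w', hw', h'⟩ := h hw
      obtain rfl : w' = w := Subtype.ext h'
      exact hw'
    -- For the converse it is enough to give each element `t` of the three spans a decomposition
    -- with `u + τ v` a boundary: `(z, -τ z)` for `t = z - τ z` with `z` in `(ker f ∩ ker g) ⊗ M`,
    -- then `(t, 0)` and `(0, t)`.
    have key : ∀ u v, u ∈ tensorSpan (LinearMap.ker f) ⊤ → v ∈ tensorSpan ⊤ (LinearMap.ker g) →
        u + v ∈ symSquareRel k M → u + TensorProduct.comm k M M v ∈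
          altSpan (LinearMap.ker f ⊔ LinearMap.ker g) (LinearMap.ker f ⊔ LinearMap.ker g) →
        u + v ∈ (LinearMap.ker (altKernelMap f g)).map (altKernel f g).subtype := by
      intro u v hu hv h h'
      refine ⟨⟨u + v, h, sup_le_ker_map f g (Submodule.add_mem_sup hu hv)⟩, ?_, rfl⟩
      rw [SetLike.mem_coe, LinearMap.mem_ker, altKernelMap_apply _ hu hv rfl,
        koszulClass_eq_zero_iff]
      exact h'
    refine sup_le (sup_le ?_ ?_) ?_
    · intro t ht
      have ht' := altSpan_le_symSquareRel _ _ ht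
      obtain ⟨z, hz, rfl⟩ := exists_eq_sub_comm ht
      rw [sub_eq_add_neg] at ht' ⊢
      refine key _ _ (tensorSpan_mono inf_le_left le_rfl hz)
        (neg_mem (comm_mem_tensorSpan (tensorSpan_mono inf_le_right le_rfl hz))) ht' ?_
      simp
    · intro t ht
      rw [← add_zero t]
      refine key _ _ (tensorSpan_mono le_rfl le_top (altSpan_le_tensorSpan _ ht)) (zero_mem _) ?_ ?_
      · rw [add_zero]; exact altSpan_le_symSquareRel _ _ ht
      · rw [map_zero, add_zero]; exact altSpan_mono le_sup_left le_sup_left ht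
    · intro t ht
      rw [← zero_add t]
      refine key _ _ (zero_mem _) (tensorSpan_mono le_top le_rfl (altSpan_le_tensorSpan _ ht)) ?_ ?_
      · rw [zero_add]; exact altSpan_le_symSquareRel _ _ ht
      · rw [comm_eq_neg_of_mem_symSquareRel (altSpan_le_symSquareRel _ _ ht), zero_add]
        exact neg_mem (altSpan_mono le_sup_right le_sup_right ht)

end AlternatingKernel

section AlternatingKernelNaturality

variable {k : Type} [CommRing k] {M A B M' A' B' : Type*} [AddCommGroup M] [Module k M]
  [AddCommGroup A] [Module k A] [AddCommGroup B] [Module k B] [AddCommGroup M'] [Module k M']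
  [AddCommGroup A'] [Module k A'] [AddCommGroup B'] [Module k B']
  {f : M →ₗ[k] A} {g : M →ₗ[k] B} {f' : M' →ₗ[k] A'} {g' : M' →ₗ[k] B'}

theorem mem_sup_ker_of_mem {h : M →ₗ[k] M'}
    (hf : ∀ x ∈ LinearMap.ker f, h x ∈ LinearMap.ker f')
    (hg : ∀ x ∈ LinearMap.ker g, h x ∈ LinearMap.ker g') :
    ∀ x ∈ LinearMap.ker f ⊔ LinearMap.ker g, h x ∈ LinearMap.ker f' ⊔ LinearMap.ker g' := by
  intro x hx
  obtain ⟨a, ha, b, hb, rfl⟩ := Submodule.mem_sup.1 hx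
  rw [map_add]
  exact Submodule.add_mem_sup (hf a ha) (hg b hb)

theorem altKernelMap_naturality [Module.Flat k A] [Module.Flat k (LinearMap.range g)]
    [Module.Flat k A'] [Module.Flat k (LinearMap.range g')] (h : M →ₗ[k] M')
    (hf : ∀ x ∈ LinearMap.ker f, h x ∈ LinearMap.ker f')
    (hg : ∀ x ∈ LinearMap.ker g, h x ∈ LinearMap.ker g') (w : altKernel f g)
    (w' : altKernel f' g') (hw : (w' : M' ⊗[k] M') = TensorProduct.map h h w) :
    altKernelMap f' g' w' = koszulMap h (mem_sup_ker_of_mem hf hg) (altKernelMap f g w) := by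
  obtain ⟨u, v, hu, hv, e⟩ := exists_add_of_mem_altKernel f g w.2
  rw [altKernelMap_apply w hu hv e, koszulMap_class,
    altKernelMap_apply w' (u := TensorProduct.map h h u) (v := TensorProduct.map h h v)
    (map_mem_tensorSpan hf (fun _ _ => Submodule.mem_top) hu)
    (map_mem_tensorSpan (fun _ _ => Submodule.mem_top) hg hv) (by rw [hw, e, map_add]),
    koszulClass_eq_iff, map_add, TensorProduct.map_comm]
  simp

end AlternatingKernelNaturality

/-! ### Additive maps on the integral group ring and products of ideals -/

section GroupRing

variable {F : Type*} [Group F] {X : Type*} [AddCommGroup X]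

/-- The additive extension of a function `F → X` to the integral group ring. -/
def groupRingLift (φ : F → X) : MonoidAlgebra ℤ F →ₗ[ℤ] X :=
  (Finsupp.liftAddHom (fun x => (smulAddHom ℤ X).flip (φ x))).toIntLinearMap ∘ₗ
    (MonoidAlgebra.coeffAddEquiv (R := ℤ) (M := F)).toAddMonoidHom.toIntLinearMap

theorem groupRingLift_of (φ : F → X) (g : F) :
    groupRingLift φ (MonoidAlgebra.of ℤ F g) = φ g := by
  simp [groupRingLift]

theorem groupRing_closure_of :
    AddSubgroup.closure (Set.range (MonoidAlgebra.of ℤ F)) = ⊤ := by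
  rw [eq_top_iff]
  rintro x -
  induction x using MonoidAlgebra.induction_on with
  | of g => exact AddSubgroup.subset_closure ⟨g, rfl⟩
  | add x y hx hy => exact add_mem hx hy
  | smul r x hx => exact AddSubgroup.zsmul_mem _ hx r

/-- The two-sided ideal generated by `G - 1` is additively generated by the `g (u - 1) h`. -/
theorem groupRingIdeal_le_closure {F : Type u} [Group F] (G : Subgroup F) {x : MonoidAlgebra ℤ F}
    (hx : x ∈ groupRingIdeal G) :
    x ∈ AddSubgroup.closure {y | ∃ g h : F, ∃ u ∈ G, y = MonoidAlgebra.of ℤ F g *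
      (MonoidAlgebra.of ℤ F u - 1) * MonoidAlgebra.of ℤ F h} := by
  rw [groupRingIdeal, TwoSidedIdeal.mem_asIdeal,
    TwoSidedIdeal.mem_span_iff_mem_addSubgroup_closure] at hx
  refine (AddSubgroup.closure_le _).2 ?_ hx
  rintro _ ⟨_, ⟨a, -, _, ⟨u, hu, rfl⟩, rfl⟩, b, -, rfl⟩
  have ha : a ∈ AddSubgroup.closure (Set.range (MonoidAlgebra.of ℤ F)) := by
    rw [groupRing_closure_of]; trivial
  have hb : b ∈ AddSubgroup.closure (Set.range (MonoidAlgebra.of ℤ F)) := by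
    rw [groupRing_closure_of]; trivial
  simp only [SetLike.mem_coe]
  induction ha using AddSubgroup.closure_induction with
  | zero => simp
  | add x y _ _ hx hy => rw [add_mul, add_mul]; exact add_mem hx hy
  | neg x _ hx => rw [neg_mul, neg_mul]; exact neg_mem hx
  | mem a ha =>
    obtain ⟨g, rfl⟩ := ha
    induction hb using AddSubgroup.closure_induction with
    | zero => simp
    | add x y _ _ hx hy => rw [mul_add]; exact add_mem hx hy
    | neg x _ hx => rw [mul_neg]; exact neg_mem hx
    | mem b hb =>
      obtain ⟨h, rfl⟩ := hb
      exact AddSubgroup.subset_closure ⟨g, h, u, hu, rfl⟩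

/-- For a normal subgroup this moves group elements across `u - 1`, so one-sided multiples suffice
to generate the ideal additively. -/
theorem of_conj_sub_one (g u : F) :
    MonoidAlgebra.of ℤ F g * (MonoidAlgebra.of ℤ F u - 1) =
      (MonoidAlgebra.of ℤ F (g * u * g⁻¹) - 1) * MonoidAlgebra.of ℤ F g := by
  rw [mul_sub, sub_mul, ← map_mul, ← map_mul, mul_one, one_mul, inv_mul_cancel_right]

section

variable {F : Type u} [Group F]

theorem groupRingIdeal_le_closure_left (G : Subgroup F) [hG : G.Normal] {x : MonoidAlgebra ℤ F}
    (hx : x ∈ groupRingIdeal G) :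
    x ∈ AddSubgroup.closure {y | ∃ h : F, ∃ u ∈ G, y =
      (MonoidAlgebra.of ℤ F u - 1) * MonoidAlgebra.of ℤ F h} := by
  refine (AddSubgroup.closure_le _).2 ?_ (groupRingIdeal_le_closure G hx)
  rintro _ ⟨g, h, u, hu, rfl⟩
  refine AddSubgroup.subset_closure ⟨g * h, g * u * g⁻¹, hG.conj_mem u hu g, ?_⟩
  rw [of_conj_sub_one, mul_assoc, ← map_mul]

theorem groupRingIdeal_le_closure_right (G : Subgroup F) [hG : G.Normal] {x : MonoidAlgebra ℤ F}
    (hx : x ∈ groupRingIdeal G) :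
    x ∈ AddSubgroup.closure {y | ∃ h : F, ∃ u ∈ G, y =
      MonoidAlgebra.of ℤ F h * (MonoidAlgebra.of ℤ F u - 1)} := by
  refine (AddSubgroup.closure_le _).2 ?_ (groupRingIdeal_le_closure_left G hx)
  rintro _ ⟨h, u, hu, rfl⟩
  refine AddSubgroup.subset_closure ⟨h, h⁻¹ * u * h, ?_, ?_⟩
  · simpa using hG.conj_mem u hu h⁻¹
  · rw [of_conj_sub_one]
    simp [mul_assoc]

theorem sub_one_mem_groupRingIdeal {G : Subgroup F} {u : F} (hu : u ∈ G) :
    MonoidAlgebra.of ℤ F u - 1 ∈ groupRingIdeal G :=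
  TwoSidedIdeal.subset_span ⟨u, hu, rfl⟩

/-- An additive map killing the elements `(u - 1) g (v - 1)` kills `𝔯𝔰`. -/
theorem eq_zero_of_mem_mul {R S : Subgroup F} [R.Normal] [S.Normal]
    (Φ : MonoidAlgebra ℤ F →+ X)
    (h : ∀ u ∈ R, ∀ v ∈ S, ∀ g, Φ ((MonoidAlgebra.of ℤ F u - 1) * MonoidAlgebra.of ℤ F g *
      (MonoidAlgebra.of ℤ F v - 1)) = 0)
    {x : MonoidAlgebra ℤ F} (hx : x ∈ groupRingIdeal R * groupRingIdeal S) : Φ x = 0 := by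
  refine Submodule.smul_induction_on hx ?_ (fun a b ha hb => by rw [map_add, ha, hb, add_zero])
  intro a ha b hb
  replace ha := groupRingIdeal_le_closure_left R ha
  replace hb := groupRingIdeal_le_closure_right S hb
  rw [smul_eq_mul]
  induction ha using AddSubgroup.closure_induction with
  | zero => simp
  | add x y _ _ hx hy => rw [add_mul, map_add, hx, hy, add_zero]
  | neg x _ hx => rw [neg_mul, map_neg, hx, neg_zero]
  | mem a ha =>
    obtain ⟨g, u, hu, rfl⟩ := ha
    induction hb using AddSubgroup.closure_induction with
    | zero => simp
    | add x y _ _ hx hy => rw [mul_add, map_add, hx, hy, add_zero]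
    | neg x _ hx => rw [mul_neg, map_neg, hx, neg_zero]
    | mem b hb =>
      obtain ⟨g', v, hv, rfl⟩ := hb
      have := h u hu v hv (g * g')
      rw [(MonoidAlgebra.of ℤ F).map_mul] at this
      simpa only [mul_assoc] using this

/-- An additive map whose value on the elements `(u - 1) g (v - 1)` does not depend on `g`
kills `𝔯𝔣𝔰`. -/
theorem eq_zero_of_mem_mul_mul {R S : Subgroup F} [R.Normal] [S.Normal]
    (Φ : MonoidAlgebra ℤ F →+ X)
    (h : ∀ u ∈ R, ∀ v ∈ S, ∀ g g', Φ ((MonoidAlgebra.of ℤ F u - 1) * MonoidAlgebra.of ℤ F g *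
      (MonoidAlgebra.of ℤ F v - 1)) = Φ ((MonoidAlgebra.of ℤ F u - 1) * MonoidAlgebra.of ℤ F g' *
      (MonoidAlgebra.of ℤ F v - 1)))
    {x : MonoidAlgebra ℤ F}
    (hx : x ∈ groupRingIdeal R * groupRingIdeal (⊤ : Subgroup F) * groupRingIdeal S) :
    Φ x = 0 := by
  refine Submodule.smul_induction_on hx ?_ (fun a b ha hb => by rw [map_add, ha, hb, add_zero])
  intro a ha b hb
  replace hb := groupRingIdeal_le_closure_right S hb
  rw [smul_eq_mul]
  induction hb using AddSubgroup.closure_induction with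
  | zero => simp
  | add x y _ _ hx hy => rw [mul_add, map_add, hx, hy, add_zero]
  | neg x _ hx => rw [mul_neg, map_neg, hx, neg_zero]
  | mem b hb =>
    obtain ⟨g', v, hv, rfl⟩ := hb
    refine eq_zero_of_mem_mul (R := R) (S := ⊤)
      (Φ.comp (AddMonoidHom.mulRight (MonoidAlgebra.of ℤ F g' * (MonoidAlgebra.of ℤ F v - 1))))
      (fun u hu w _ g => ?_) ha
    -- The factor `w - 1` from `𝔣` contributes a difference of two elements `(u - 1) g (v - 1)` that
    -- differ only in their middle terms.
    have h1 : (MonoidAlgebra.of ℤ F u - 1) * MonoidAlgebra.of ℤ F g *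
        (MonoidAlgebra.of ℤ F w - 1) * (MonoidAlgebra.of ℤ F g' * (MonoidAlgebra.of ℤ F v - 1)) =
        (MonoidAlgebra.of ℤ F u - 1) * MonoidAlgebra.of ℤ F (g * w * g') *
          (MonoidAlgebra.of ℤ F v - 1) -
        (MonoidAlgebra.of ℤ F u - 1) * MonoidAlgebra.of ℤ F (g * g') *
          (MonoidAlgebra.of ℤ F v - 1) := by
      simp only [map_mul]
      noncomm_ring
    change Φ (_ * _) = 0
    rw [h1, map_sub, h u hu v hv, sub_self]

end

/-- The second difference of a function on the group. -/
theorem groupRingLift_sub_one_mul (φ : F → X) (u g v : F) :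
    groupRingLift φ ((MonoidAlgebra.of ℤ F u - 1) * MonoidAlgebra.of ℤ F g *
      (MonoidAlgebra.of ℤ F v - 1)) = φ (u * g * v) - φ (u * g) - φ (g * v) + φ g := by
  have h : (MonoidAlgebra.of ℤ F u - 1) * MonoidAlgebra.of ℤ F g * (MonoidAlgebra.of ℤ F v - 1) =
      MonoidAlgebra.of ℤ F (u * g * v) - MonoidAlgebra.of ℤ F (u * g) -
        MonoidAlgebra.of ℤ F (g * v) + MonoidAlgebra.of ℤ F g := by
    simp only [map_mul]
    noncomm_ring
  rw [h]
  simp only [map_sub, map_add, groupRingLift_of]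

end GroupRing

/-! ### Equivariant retractions onto a subgroup -/

section Transversal

variable {F : Type*} [Group F]

/-- Divide `x` by the chosen representative of the coset `x G`, then normalize by `(σ 1)⁻¹` on the
left, which preserves right equivariance. -/
theorem exists_right_equivariant (G : Subgroup F) :
    ∃ σ : F → G, (∀ x, ∀ v : G, σ (x * v) = σ x * v) ∧ σ 1 = 1 := by
  have hmem : ∀ x : F, (Quotient.out (QuotientGroup.mk x : F ⧸ G))⁻¹ * x ∈ G := fun x =>
    QuotientGroup.eq.1 (QuotientGroup.out_eq' _)
  let σ : F → G := fun x => ⟨_, hmem x⟩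
  have hσ : ∀ x, ∀ v : G, σ (x * v) = σ x * v := by
    intro x v
    apply Subtype.ext
    change (Quotient.out (QuotientGroup.mk (x * v) : F ⧸ G))⁻¹ * (x * v) = _
    rw [QuotientGroup.mk_mul_of_mem x v.2, ← mul_assoc]
    rfl
  refine ⟨fun x => (σ 1)⁻¹ * σ x, fun x v => ?_, inv_mul_cancel _⟩
  simp only [hσ, mul_assoc]

theorem exists_left_equivariant (G : Subgroup F) :
    ∃ τ : F → G, (∀ u : G, ∀ x, τ (u * x) = u * τ x) ∧ τ 1 = 1 := by
  obtain ⟨σ, hσ, h1⟩ := exists_right_equivariant G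
  refine ⟨fun x => (σ x⁻¹)⁻¹, fun u x => ?_, by simp [h1]⟩
  have := hσ x⁻¹ u⁻¹
  change (σ (u * x)⁻¹)⁻¹ = u * (σ x⁻¹)⁻¹
  rw [mul_inv_rev, ← Subgroup.coe_inv, this]
  simp

end Transversal

/-! ### Abelianizations in additive notation -/

section Abelianization

variable {G H : Type*} [Group G] [Group H]

/-- The class of an element in the abelianization, written additively. -/
def abOf (g : G) : Additive (Abelianization G) := Additive.ofMul (Abelianization.of g)

theorem abOf_mul (g h : G) : abOf (g * h) = abOf g + abOf h := by
  simp [abOf]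

theorem abOf_one : abOf (1 : G) = 0 := by
  simp [abOf]

theorem abOf_inv (g : G) : abOf g⁻¹ = -abOf g := by
  simp [abOf]

theorem abOf_surjective : Function.Surjective (abOf : G → _) := by
  intro x
  obtain ⟨g, hg⟩ := QuotientGroup.mk_surjective (Additive.toMul x)
  exact ⟨g, congrArg Additive.ofMul hg⟩

theorem abOf_eq_zero_iff (g : G) : abOf g = 0 ↔ g ∈ commutator G := by
  rw [← Abelianization.ker_of, MonoidHom.mem_ker]
  rfl

theorem abOf_coe_eq_zero_iff (T : Subgroup G) (g : T) : abOf g = 0 ↔ (g : G) ∈ ⁅T, T⁆ := by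
  rw [abOf_eq_zero_iff, ← Subgroup.map_subtype_commutator]
  simp

/-- The linear map on abelianizations induced by a homomorphism. -/
def abMap (f : G →* H) : Additive (Abelianization G) →ₗ[ℤ] Additive (Abelianization H) :=
  (MonoidHom.toAdditive (Abelianization.map f)).toIntLinearMap

theorem abMap_abOf (f : G →* H) (g : G) : abMap f (abOf g) = abOf (f g) := by
  simp [abMap, abOf]

/-- The linear map on the abelianization induced by a homomorphism to an abelian group. -/
def abLift {X : Type*} [AddCommGroup X] (f : G →* Multiplicative X) :
    Additive (Abelianization G) →ₗ[ℤ] X :=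
  (MonoidHom.toAdditiveLeft (Abelianization.lift f)).toIntLinearMap

theorem abLift_abOf {X : Type*} [AddCommGroup X] (f : G →* Multiplicative X) (g : G) :
    abLift f (abOf g) = (f g).toAdd := by
  simp [abLift, abOf]

end Abelianization

/-! ### The intersection of `F` with `1 + 𝔯𝔰` -/

section ProductOfTwoIdeals

variable {F : Type u} [Group F] {R S : Subgroup F} [R.Normal] [S.Normal]

/-- The map `ℤ[F] → ℤ[F/G]`, for `G = R` and for `G = S`, kills every `(u - 1) g (v - 1)`, since one
of the outer factors becomes trivial. Hence `w` and `1` have the same image in `F/G`. -/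
theorem mem_inf_of_sub_one_mem_mul {w : F}
    (hw : MonoidAlgebra.of ℤ F w - 1 ∈ groupRingIdeal R * groupRingIdeal S) : w ∈ R ⊓ S := by
  have key : ∀ G : Subgroup F, (∀ u ∈ R, ∀ v ∈ S, ∀ g, (QuotientGroup.mk (u * g * v) : F ⧸ G) =
      QuotientGroup.mk (u * g) ∧ (QuotientGroup.mk (g * v) : F ⧸ G) = QuotientGroup.mk g ∨
      (QuotientGroup.mk (u * g * v) : F ⧸ G) = QuotientGroup.mk (g * v) ∧
      (QuotientGroup.mk (u * g) : F ⧸ G) = QuotientGroup.mk g) → w ∈ G := by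
    intro G hG
    let Φ := groupRingLift (fun x : F => (Finsupp.single (QuotientGroup.mk x : F ⧸ G) (1 : ℤ)))
    have h := eq_zero_of_mem_mul Φ.toAddMonoidHom (fun u hu v hv g => ?_) hw
    · rw [LinearMap.toAddMonoidHom_coe, map_sub, ← map_one (MonoidAlgebra.of ℤ F),
        groupRingLift_of, groupRingLift_of, sub_eq_zero,
        Finsupp.single_left_inj one_ne_zero] at h
      simpa using QuotientGroup.eq.1 h.symm
    · rw [LinearMap.toAddMonoidHom_coe, groupRingLift_sub_one_mul]
      rcases hG u hu v hv g with ⟨h1, h2⟩ | ⟨h1, h2⟩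
      · rw [h1, h2]; abel
      · rw [h1, h2]; abel
  refine ⟨key R fun u hu v hv g => Or.inr ?_, key S fun u hu v hv g => Or.inl ?_⟩
  · have h : ∀ x : F, (QuotientGroup.mk (u * x) : F ⧸ R) = QuotientGroup.mk x := fun x => by
      rw [eq_comm, QuotientGroup.eq, ← mul_assoc]
      simpa using Subgroup.Normal.conj_mem ‹R.Normal› u hu x⁻¹
    exact ⟨by rw [mul_assoc, h], h g⟩
  · exact ⟨QuotientGroup.mk_mul_of_mem _ hv, QuotientGroup.mk_mul_of_mem _ hv⟩

open Classical in
/-- `F ∩ (1 + 𝔯𝔰) ⊆ [R ∩ S, R ∩ S]`. -/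
theorem mem_commutator_of_sub_one_mem_mul {w : F}
    (hw : MonoidAlgebra.of ℤ F w - 1 ∈ groupRingIdeal R * groupRingIdeal S) :
    w ∈ ⁅R ⊓ S, R ⊓ S⁆ := by
  have hwT := mem_inf_of_sub_one_mem_mul hw
  obtain ⟨σ, hσ, hσ1⟩ := exists_right_equivariant (R ⊓ S)
  obtain ⟨τ, hτ, hτ1⟩ := exists_left_equivariant (R ⊓ S)
  -- The function is `x y ↦ σ x + τ y` on `R S` and zero elsewhere. Being a sum of a term in `x` and
  -- a term in `y`, it has vanishing second differences, and on `R ∩ S` it is the projection to the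
  -- abelianization.
  let φ : F → Additive (Abelianization ↥(R ⊓ S)) := fun g =>
    if h : ∃ x y, x ∈ R ∧ y ∈ S ∧ g = x * y then
      abOf (σ h.choose) + abOf (τ h.choose_spec.choose) else 0
  have hφ : ∀ x ∈ R, ∀ y ∈ S, φ (x * y) = abOf (σ x) + abOf (τ y) := by
    intro x hx y hy
    have h : ∃ x' y', x' ∈ R ∧ y' ∈ S ∧ x * y = x' * y' := ⟨x, y, hx, hy, rfl⟩
    have h1 : φ (x * y) = abOf (σ h.choose) + abOf (τ h.choose_spec.choose) := dif_pos h
    obtain ⟨hx', hy', e⟩ := h.choose_spec.choose_spec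
    rw [h1]
    generalize h.choose = x', h.choose_spec.choose = y' at *
    -- Two factorizations `x y = x' y'` differ by `t = x⁻¹ x' = y y'⁻¹` in `R ∩ S`, and the
    -- equivariance of `σ` and `τ` cancels the effect of `t`.
    have ht : x⁻¹ * x' ∈ R ⊓ S := by
      refine ⟨R.mul_mem (R.inv_mem hx) hx', ?_⟩
      have : x⁻¹ * x' = y * y'⁻¹ := by
        rw [inv_mul_eq_iff_eq_mul, ← mul_assoc, e, mul_inv_cancel_right]
      rw [this]
      exact S.mul_mem hy (S.inv_mem hy')
    have e1 : x' = x * (⟨_, ht⟩ : ↥(R ⊓ S)) := by simp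
    have e2 : y = (⟨_, ht⟩ : ↥(R ⊓ S)) * y' := by
      simp only [mul_assoc, ← e]
      simp
    rw [e1, hσ, e2, hτ, abOf_mul, abOf_mul]
    abel
  have hφ0 : ∀ g, (¬ ∃ x y, x ∈ R ∧ y ∈ S ∧ g = x * y) → φ g = 0 := fun g h => dif_neg h
  have h := eq_zero_of_mem_mul (groupRingLift φ).toAddMonoidHom (fun u hu v hv g => ?_) hw
  · rw [LinearMap.toAddMonoidHom_coe, map_sub, ← map_one (MonoidAlgebra.of ℤ F),
      groupRingLift_of, groupRingLift_of, sub_eq_zero] at h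
    have h1 := hφ 1 R.one_mem 1 S.one_mem
    have h2 := hφ w hwT.1 1 S.one_mem
    have h3 := hσ 1 ⟨w, hwT⟩
    simp only [one_mul, hσ1] at h3
    rw [mul_one] at h1 h2
    rw [h1, h2, hσ1, hτ1, h3, abOf_one] at h
    simp only [add_zero] at h
    exact (abOf_coe_eq_zero_iff _ ⟨w, hwT⟩).1 h
  · rw [LinearMap.toAddMonoidHom_coe, groupRingLift_sub_one_mul]
    by_cases hg : ∃ x y, x ∈ R ∧ y ∈ S ∧ g = x * y
    · obtain ⟨x, y, hx, hy, rfl⟩ := hg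
      rw [← mul_assoc u x y, mul_assoc x y v, mul_assoc (u * x) y v, hφ _ (R.mul_mem hu hx) _
        (S.mul_mem hy hv), hφ _ (R.mul_mem hu hx) _ hy, hφ _ hx _ (S.mul_mem hy hv), hφ _ hx _ hy]
      abel
    -- The complement of `R S` is stable under `R` on the left and `S` on the right, so all four
    -- values are the default value zero.
    · have h1 : ∀ u' ∈ R, ∀ v' ∈ S, φ (u' * g * v') = 0 := by
        intro u' hu' v' hv'
        refine hφ0 _ fun ⟨x, y, hx, hy, e⟩ => hg ⟨u'⁻¹ * x, y * v'⁻¹, R.mul_mem (R.inv_mem hu') hx,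
          S.mul_mem hy (S.inv_mem hv'), ?_⟩
        rw [mul_assoc, ← mul_assoc x, ← e]
        group
      have h2 := h1 u hu 1 S.one_mem
      have h3 := h1 1 R.one_mem v hv
      rw [mul_one] at h2
      rw [one_mul] at h3
      rw [h1 u hu v hv, h2, h3, hφ0 g hg]
      simp

end ProductOfTwoIdeals

/-! ### Crossed homomorphisms on free groups and the pairing on `ℤ[F]` -/

section CrossedHomomorphisms

variable {F : Type*} [Group F]

/-- The inclusion of `H` has a right inverse defined on the generators. -/
theorem IsFreeGroup.eq_top_of_forall_of_mem {G : Type*} [Group G] [IsFreeGroup G]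
    (H : Subgroup G) (h : ∀ j, IsFreeGroup.of j ∈ H) : H = ⊤ := by
  have e : H.subtype.comp (IsFreeGroup.lift fun j => (⟨IsFreeGroup.of j, h j⟩ : H)) =
      MonoidHom.id G := IsFreeGroup.ext_hom fun j => by simp
  rw [eq_top_iff]
  intro v _
  rw [← MonoidHom.id_apply G v, ← e]
  exact Subtype.property _

/-- On a free group there are crossed homomorphisms with arbitrary values on the generators. -/
theorem exists_crossedHom {S P : Type*} [Group S] [IsFreeGroup S] [AddCommGroup P]
    (L : S → P →+ P) (hL1 : ∀ p, L 1 p = p) (hLmul : ∀ v v' p, L (v * v') p = L v (L v' p))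
    (c : IsFreeGroup.Generators S → P) :
    ∃ δ : S → P, (∀ v v', δ (v * v') = δ v + L v (δ v')) ∧ ∀ j, δ (IsFreeGroup.of j) = c j := by
  have hL : ∀ v p, L v (L v⁻¹ p) = p := fun v p => by
    rw [← hLmul, mul_inv_cancel, hL1]
  have hL' : ∀ v p, L v⁻¹ (L v p) = p := fun v p => by
    simpa using hL v⁻¹ p
  -- A crossed homomorphism is the translation part of an affine action. Each generator acts by `p ↦
  -- L p + c`, freeness extends the action to `S`, and `δ v` is the image of zero under `v`.
  let π : IsFreeGroup.Generators S → Equiv.Perm P := fun j =>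
    { toFun := fun p => L (IsFreeGroup.of j) p + c j
      invFun := fun p => L (IsFreeGroup.of j)⁻¹ (p - c j)
      left_inv := fun p => by simp [hL']
      right_inv := fun p => by simp [hL] }
  let f : S →* Equiv.Perm P := IsFreeGroup.lift π
  have hf : ∀ v p q, f v p - f v q = L v (p - q) := by
    let H : Subgroup S :=
      { carrier := {v | ∀ p q, f v p - f v q = L v (p - q)}
        one_mem' := fun p q => by simp [hL1]
        mul_mem' := fun {v v'} hv hv' p q => by
          rw [map_mul, Equiv.Perm.mul_apply, Equiv.Perm.mul_apply, hv, hv', hLmul]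
        inv_mem' := fun {v} hv p q => by
          rw [← hL' v (f v⁻¹ p - f v⁻¹ q), ← hv, map_inv f]
          simp }
    have hH : H = ⊤ := IsFreeGroup.eq_top_of_forall_of_mem H fun j p q => by
      simp [f, π]
    intro v
    have : v ∈ H := hH ▸ Subgroup.mem_top v
    exact this
  refine ⟨fun v => f v 0, fun v v' => ?_, fun j => by simp [f, π]⟩
  have := hf v (f v' 0) 0
  rw [sub_zero] at this
  rw [← this]
  simp

/-- For a free group `S` there is an additive map `ℤ[F] → R_ab ⊗ S_ab` with
`(u - 1) g (v - 1) ↦ u ⊗ v`. -/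
theorem exists_pairing (R S : Subgroup F) [IsFreeGroup S] :
    ∃ Ψ : MonoidAlgebra ℤ F →+ Additive (Abelianization R) ⊗[ℤ] Additive (Abelianization S),
      ∀ (u : R) (v : S) (g : F), Ψ ((MonoidAlgebra.of ℤ F u - 1) * MonoidAlgebra.of ℤ F g *
        (MonoidAlgebra.of ℤ F v - 1)) = abOf u ⊗ₜ[ℤ] abOf v := by
  -- The module `F →₀ S_ab` plays the role of `ℤ[F] ⊗ S_ab`, with `F` acting by left translation.
  -- The crossed homomorphism `δ` takes a generator `s` of `S` to `1 ⊗ s`, like a Fox derivative.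
  let L : F → (F →₀ Additive (Abelianization S)) →+ (F →₀ Additive (Abelianization S)) := fun g =>
    Finsupp.mapDomain.addMonoidHom (g * ·)
  have hLs : ∀ g x b, L g (Finsupp.single x b) = Finsupp.single (g * x) b := fun g x b =>
    Finsupp.mapDomain_single
  have hLmul : ∀ g g' p, L (g * g') p = L g (L g' p) := by
    intro g g' p
    induction p using Finsupp.induction_linear with
    | zero => simp
    | add x y hx hy => simp only [map_add, hx, hy]
    | single x b => simp only [hLs, mul_assoc]
  have hL1 : ∀ p, L 1 p = p := by
    intro p
    induction p using Finsupp.induction_linear with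
    | zero => simp
    | add x y hx hy => simp only [map_add, hx, hy]
    | single x b => simp only [hLs, one_mul]
  obtain ⟨δ, hδ, hδ'⟩ := exists_crossedHom (S := S) (fun v => L v) hL1
    (fun v v' p => hLmul v v' p) (fun j => Finsupp.single 1 (abOf (IsFreeGroup.of j)))
  let E : (F →₀ Additive (Abelianization S)) →+ Additive (Abelianization S) :=
    Finsupp.liftAddHom fun _ => AddMonoidHom.id _
  have hEs : ∀ x b, E (Finsupp.single x b) = b := fun x b => by simp [E]
  have hEL : ∀ g p, E (L g p) = E p := by
    intro g p
    induction p using Finsupp.induction_linear with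
    | zero => simp
    | add x y hx hy => simp only [map_add, hx, hy]
    | single x b => simp only [hLs, hEs]
  -- The sum map `E` forgets the translations, so `E ∘ δ` is a homomorphism; it is compared with the
  -- projection on generators.
  have hEδ : ∀ v, E (δ v) = abOf v := by
    have e : MonoidHom.mk' (fun v : S => Multiplicative.ofAdd (E (δ v)))
        (fun v v' => by rw [hδ, map_add, hEL, ofAdd_add]) =
        MonoidHom.mk' (fun v => Multiplicative.ofAdd (abOf v))
        (fun v v' => by rw [abOf_mul, ofAdd_add]) :=
      IsFreeGroup.ext_hom fun j => by simp [hδ', hEs]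
    intro v
    exact congrArg Multiplicative.toAdd (DFunLike.congr_fun e v)
  obtain ⟨σ, hσ, -⟩ := exists_right_equivariant S
  obtain ⟨τ, hτ, -⟩ := exists_left_equivariant R
  -- This extends `δ` from `S` to `F` along cosets: `g (σ g)⁻¹` is constant on `g S`, which gives `Δ
  -- (g v) = Δ g + g δ v`.
  let Δ : F → (F →₀ Additive (Abelianization S)) := fun g => L (g * (σ g : F)⁻¹) (δ (σ g))
  have hΔ : ∀ g (v : S), Δ (g * v) = Δ g + L g (δ v) := by
    intro g v
    have h1 : g * v * ((σ g * v : S) : F)⁻¹ = g * (σ g : F)⁻¹ := by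
      rw [Subgroup.coe_mul]; group
    have h2 : ∀ p, L g p = L (g * (σ g : F)⁻¹) (L (σ g) p) := by
      intro p
      rw [← hLmul, inv_mul_cancel_right]
    simp only [Δ, hσ, h1, hδ, map_add, h2]
  let Λ : (F →₀ Additive (Abelianization S)) →+
      Additive (Abelianization R) ⊗[ℤ] Additive (Abelianization S) :=
    Finsupp.liftAddHom fun x => (TensorProduct.mk ℤ _ _ (abOf (τ x))).toAddMonoidHom
  have hΛs : ∀ x b, Λ (Finsupp.single x b) = abOf (τ x) ⊗ₜ[ℤ] b := fun x b => by simp [Λ]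
  have hΛ : ∀ (u : R) p, Λ (L u p) = Λ p + abOf u ⊗ₜ[ℤ] E p := by
    intro u p
    induction p using Finsupp.induction_linear with
    | zero => simp
    | add x y hx hy => simp only [map_add, hx, hy, TensorProduct.tmul_add]; abel
    | single x b => rw [hLs, hΛs, hΛs, hEs, hτ, abOf_mul, TensorProduct.add_tmul, add_comm]
  -- The second difference of `Λ ∘ Δ` is `Λ (u g δ v) - Λ (g δ v)`, that is `u ⊗ E (g δ v) = u ⊗ v`,
  -- independently of `g`.
  refine ⟨(groupRingLift fun g => Λ (Δ g)).toAddMonoidHom, fun u v g => ?_⟩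
  rw [LinearMap.toAddMonoidHom_coe, groupRingLift_sub_one_mul, mul_assoc, hΔ, ← mul_assoc, hΔ,
    map_add, map_add, hLmul, hΛ, hEL, hEδ]
  abel

end CrossedHomomorphisms

/-! ### Commutators of a free subgroup as alternating tensors -/

section AlternatingClass

open scoped commutatorElement

variable {F : Type*} [Group F]

theorem Subgroup.commutator_self_le (T : Subgroup F) : ⁅T, T⁆ ≤ T :=
  Subgroup.commutator_le.2 fun a ha b hb => by
    rw [commutatorElement_def]
    exact T.mul_mem (T.mul_mem (T.mul_mem ha hb) (T.inv_mem ha)) (T.inv_mem hb)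

/-- This expands `[a, b] - 1 = ((a - 1)(b - 1) - (b - 1)(a - 1)) c` with `c = a⁻¹ b⁻¹`, where `(b -
1) c` is rewritten as `(b c - 1) - (c - 1)` and likewise for `a`. -/
theorem of_commutator_sub_one (a b : F) :
    MonoidAlgebra.of ℤ F ⁅a, b⁆ - 1 =
      (MonoidAlgebra.of ℤ F a - 1) * MonoidAlgebra.of ℤ F 1 *
        (MonoidAlgebra.of ℤ F (b * (a⁻¹ * b⁻¹)) - 1) -
      (MonoidAlgebra.of ℤ F a - 1) * MonoidAlgebra.of ℤ F 1 *
        (MonoidAlgebra.of ℤ F (a⁻¹ * b⁻¹) - 1) -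
      ((MonoidAlgebra.of ℤ F b - 1) * MonoidAlgebra.of ℤ F 1 *
        (MonoidAlgebra.of ℤ F (a * (a⁻¹ * b⁻¹)) - 1) -
      (MonoidAlgebra.of ℤ F b - 1) * MonoidAlgebra.of ℤ F 1 *
        (MonoidAlgebra.of ℤ F (a⁻¹ * b⁻¹) - 1)) := by
  have h : MonoidAlgebra.of ℤ F b * MonoidAlgebra.of ℤ F (a * (a⁻¹ * b⁻¹)) = 1 := by
    rw [← map_mul, mul_inv_cancel_left, mul_inv_cancel, map_one]
  have h' : MonoidAlgebra.of ℤ F ⁅a, b⁆ =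
      MonoidAlgebra.of ℤ F a * MonoidAlgebra.of ℤ F (b * (a⁻¹ * b⁻¹)) := by
    rw [← map_mul, commutatorElement_def]
    simp only [mul_assoc]
  have ha : MonoidAlgebra.of ℤ F (a * (a⁻¹ * b⁻¹)) =
      MonoidAlgebra.of ℤ F a * MonoidAlgebra.of ℤ F (a⁻¹ * b⁻¹) := map_mul _ _ _
  have hb : MonoidAlgebra.of ℤ F (b * (a⁻¹ * b⁻¹)) =
      MonoidAlgebra.of ℤ F b * MonoidAlgebra.of ℤ F (a⁻¹ * b⁻¹) := map_mul _ _ _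
  rw [map_one, mul_one, mul_one, sub_mul _ _ (_ - 1), mul_sub, mul_sub, sub_mul _ _ (_ - 1),
    mul_sub, mul_sub, sub_mul _ _ (_ - 1), mul_sub, mul_sub, sub_mul _ _ (_ - 1), mul_sub, mul_sub,
    h, h', ← ha, ← hb]
  simp only [one_mul, mul_one]
  abel

theorem of_mul_sub_one (a b : F) :
    MonoidAlgebra.of ℤ F (a * b) - 1 =
      (MonoidAlgebra.of ℤ F a - 1) * MonoidAlgebra.of ℤ F 1 * (MonoidAlgebra.of ℤ F b - 1) +
        (MonoidAlgebra.of ℤ F a - 1) + (MonoidAlgebra.of ℤ F b - 1) := by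
  rw [map_mul, map_one]
  noncomm_ring

/-- Commutators are covered by `of_commutator_sub_one`. Products and inverses add only terms `(x -
1)(y - 1)`, which are themselves generators of the closure. -/
theorem sub_one_mem_closure_of_mem_commutator {T : Subgroup F} {w : F} (hw : w ∈ ⁅T, T⁆) :
    MonoidAlgebra.of ℤ F w - 1 ∈ AddSubgroup.closure {y | ∃ (u v : T) (g : F), y =
      (MonoidAlgebra.of ℤ F u - 1) * MonoidAlgebra.of ℤ F g * (MonoidAlgebra.of ℤ F v - 1)} := by
  have key : ∀ (u v : F) (_ : u ∈ T) (_ : v ∈ T),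
      (MonoidAlgebra.of ℤ F u - 1) * MonoidAlgebra.of ℤ F 1 * (MonoidAlgebra.of ℤ F v - 1) ∈
        AddSubgroup.closure {y | ∃ (u v : T) (g : F), y = (MonoidAlgebra.of ℤ F u - 1) *
          MonoidAlgebra.of ℤ F g * (MonoidAlgebra.of ℤ F v - 1)} := fun u v hu hv =>
    AddSubgroup.subset_closure ⟨⟨u, hu⟩, ⟨v, hv⟩, 1, rfl⟩
  rw [Subgroup.commutator_def] at hw
  have hT : ∀ x ∈ Subgroup.closure {g | ∃ g₁ ∈ T, ∃ g₂ ∈ T, ⁅g₁, g₂⁆ = g}, x ∈ T := fun x hx =>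
    Subgroup.commutator_self_le T hx
  induction hw using Subgroup.closure_induction with
  | mem x hx =>
    obtain ⟨a, ha, b, hb, rfl⟩ := hx
    rw [of_commutator_sub_one]
    have hc := T.mul_mem (T.inv_mem ha) (T.inv_mem hb)
    exact sub_mem (sub_mem (key _ _ ha (T.mul_mem hb hc)) (key _ _ ha hc))
      (sub_mem (key _ _ hb (T.mul_mem ha hc)) (key _ _ hb hc))
  | one => rw [map_one, sub_self]; exact zero_mem _
  | mul x y hx hy hx' hy' =>
    rw [of_mul_sub_one]
    exact add_mem (add_mem (key _ _ (hT x hx) (hT y hy)) hx') hy'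
  | inv x hx hx' =>
    have h := of_mul_sub_one x x⁻¹
    rw [mul_inv_cancel, map_one, sub_self] at h
    have h1 : MonoidAlgebra.of ℤ F x⁻¹ - 1 =
        -((MonoidAlgebra.of ℤ F x - 1) * 1 * (MonoidAlgebra.of ℤ F x⁻¹ - 1) +
          (MonoidAlgebra.of ℤ F x - 1)) := by
      rw [eq_neg_iff_add_eq_zero, add_comm]
      exact h.symm
    rw [h1, ← map_one (MonoidAlgebra.of ℤ F)]
    have h2 := key _ _ (hT x hx) (T.inv_mem (hT x hx))
    rw [map_one] at h2 ⊢
    exact neg_mem (add_mem h2 hx')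

variable (T : Subgroup F) [IsFreeGroup T]

/-- For a free subgroup `T`, the map sending `[a, b] ∈ [T, T]` to `a ⊗ b - b ⊗ a` in
`T_ab ⊗ T_ab`. -/
def altClass (w : F) : Additive (Abelianization T) ⊗[ℤ] Additive (Abelianization T) :=
  (exists_pairing T T).choose (MonoidAlgebra.of ℤ F w - 1)

variable {T}

/-- An additive map is determined on `w - 1` by its values on the `(u - 1) g (v - 1)`. In particular
the pairing chosen in `altClass` does not matter, and other pairings can be compared with it. -/
theorem pairing_eq_altClass {X : Type*} [AddCommGroup X] (Ψ : MonoidAlgebra ℤ F →+ X)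
    (β : Additive (Abelianization T) ⊗[ℤ] Additive (Abelianization T) →+ X)
    (h : ∀ (u v : T) (g : F), Ψ ((MonoidAlgebra.of ℤ F u - 1) * MonoidAlgebra.of ℤ F g *
      (MonoidAlgebra.of ℤ F v - 1)) = β (abOf u ⊗ₜ abOf v)) {w : F} (hw : w ∈ ⁅T, T⁆) :
    Ψ (MonoidAlgebra.of ℤ F w - 1) = β (altClass T w) := by
  have e := sub_one_mem_closure_of_mem_commutator hw
  rw [altClass]
  generalize MonoidAlgebra.of ℤ F w - 1 = x at e
  induction e using AddSubgroup.closure_induction with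
  | zero => simp
  | add x y _ _ hx hy => rw [map_add, map_add, map_add, hx, hy]
  | neg x _ hx => rw [map_neg, map_neg, map_neg, hx]
  | mem x hx =>
    obtain ⟨u, v, g, rfl⟩ := hx
    rw [h, (exists_pairing T T).choose_spec]

theorem altClass_commutator (a b : T) :
    altClass T ⁅(a : F), (b : F)⁆ = abOf a ⊗ₜ[ℤ] abOf b - abOf b ⊗ₜ[ℤ] abOf a := by
  have h := (exists_pairing T T).choose_spec
  have h1 := h a (b * (a⁻¹ * b⁻¹)) 1
  have h2 := h a (a⁻¹ * b⁻¹) 1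
  have h3 := h b (a * (a⁻¹ * b⁻¹)) 1
  have h4 := h b (a⁻¹ * b⁻¹) 1
  simp only [Subgroup.coe_mul, Subgroup.coe_inv] at h1 h2 h3 h4
  rw [altClass, of_commutator_sub_one, map_sub, map_sub, map_sub, h1, h2, h3, h4]
  simp only [abOf_mul, abOf_inv, TensorProduct.tmul_add, TensorProduct.tmul_neg]
  abel

/-- The cross term `(w - 1)(w' - 1)` pairs to `w ⊗ w'`, which is zero because `w` is trivial in the
abelianization. -/
theorem altClass_mul {w w' : F} (hw : w ∈ ⁅T, T⁆) (hw' : w' ∈ ⁅T, T⁆) :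
    altClass T (w * w') = altClass T w + altClass T w' := by
  have hwT := Subgroup.commutator_self_le T hw
  have h := (exists_pairing T T).choose_spec ⟨w, hwT⟩
    ⟨w', Subgroup.commutator_self_le T hw'⟩ 1
  rw [(abOf_coe_eq_zero_iff T ⟨w, hwT⟩).2 hw, TensorProduct.zero_tmul] at h
  rw [altClass, of_mul_sub_one, map_add, map_add, h, zero_add]
  rfl

theorem altClass_one : altClass T 1 = 0 := by
  rw [altClass, map_one, sub_self, map_zero]

theorem altClass_inv {w : F} (hw : w ∈ ⁅T, T⁆) : altClass T w⁻¹ = -altClass T w := by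
  rw [eq_neg_iff_add_eq_zero, ← altClass_mul (inv_mem hw) hw, inv_mul_cancel, altClass_one]

theorem eq_zero_of_bimultiplicative {G X : Type*} [Group G] [IsFreeGroup G] [AddCommGroup X]
    (B : G → G → X) (h₁ : ∀ a a' b, B (a * a') b = B a b + B a' b)
    (h₂ : ∀ a b b', B a (b * b') = B a b + B a b')
    (h : ∀ i j, B (IsFreeGroup.of i) (IsFreeGroup.of j) = 0) (a b : G) : B a b = 0 := by
  have e : MonoidHom.mk' (fun a => Multiplicative.ofAdd (B a))
      (fun a a' => by rw [← ofAdd_add]; exact congrArg _ (funext fun b => h₁ a a' b)) = 1 := by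
    refine IsFreeGroup.ext_hom fun i => ?_
    have e' : MonoidHom.mk' (fun b => Multiplicative.ofAdd (B (IsFreeGroup.of i) b))
        (fun b b' => by rw [← ofAdd_add, h₂]) = 1 := IsFreeGroup.ext_hom fun j => by simp [h]
    refine congrArg Multiplicative.ofAdd (funext fun b => ?_)
    exact congrArg Multiplicative.toAdd (DFunLike.congr_fun e' b)
  exact congrFun (congrArg Multiplicative.toAdd (DFunLike.congr_fun e a)) b

theorem exists_bilinear_of_generators {G X : Type*} [Group G] [IsFreeGroup G] [AddCommGroup X]
    (c : IsFreeGroup.Generators G → IsFreeGroup.Generators G → X) :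
    ∃ β : Additive (Abelianization G) ⊗[ℤ] Additive (Abelianization G) →+ X,
      ∀ i j, β (abOf (IsFreeGroup.of i) ⊗ₜ abOf (IsFreeGroup.of j)) = c i j := by
  refine ⟨(TensorProduct.lift (abLift (IsFreeGroup.lift fun i => Multiplicative.ofAdd
    (abLift (IsFreeGroup.lift fun j => Multiplicative.ofAdd (c i j)))))).toAddMonoidHom,
    fun i j => ?_⟩
  rw [LinearMap.toAddMonoidHom_coe, TensorProduct.lift.tmul, abLift_abOf, IsFreeGroup.lift_of,
    toAdd_ofAdd, abLift_abOf,
    IsFreeGroup.lift_of, toAdd_ofAdd]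

/-- The leading factor is a triple commutator when the entries lie in `T`, so modulo `[[T, T], T]`
the commutator is multiplicative in its left entry. -/
theorem commutator_mul_left_eq (a a' b : F) :
    ⁅a * a', b⁆ = ⁅a, ⁅a', b⁆⁆ * (⁅a', b⁆ * ⁅a, b⁆) := by
  simp only [commutatorElement_def]
  group

open Classical in
/-- An element of `[T, T]` with trivial class is a triple commutator. -/
theorem mem_of_altClass_eq_zero [T.Normal] {w : F} (hw : w ∈ ⁅T, T⁆) (h0 : altClass T w = 0) :
    w ∈ ⁅⁅T, T⁆, T⁆ := by
  let X := ↥⁅T, T⁆ ⧸ (⁅⁅T, T⁆, T⁆).subgroupOf ⁅T, T⁆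
  let _ : CommGroup X :=
    { QuotientGroup.Quotient.group _ with
      mul_comm := by
        intro x y
        obtain ⟨a, rfl⟩ := QuotientGroup.mk_surjective x
        obtain ⟨b, rfl⟩ := QuotientGroup.mk_surjective y
        rw [← QuotientGroup.mk_mul, ← QuotientGroup.mk_mul, QuotientGroup.eq,
          Subgroup.mem_subgroupOf]
        have h : (((a * b)⁻¹ * (b * a) : ↥⁅T, T⁆) : F) = ⁅(b : F)⁻¹, (a : F)⁻¹⁆ := by
          simp [commutatorElement_def, mul_assoc]
        rw [h]
        exact Subgroup.commutator_mem_commutator (inv_mem b.2)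
          (Subgroup.commutator_self_le T (inv_mem a.2)) }
  let mk : ↥⁅T, T⁆ →* X := QuotientGroup.mk' _
  have hmk : ∀ x : ↥⁅T, T⁆, mk x = 1 ↔ (x : F) ∈ ⁅⁅T, T⁆, T⁆ := fun x => by
    rw [← Subgroup.mem_subgroupOf]
    exact QuotientGroup.eq_one_iff x
  let κ : T → T → Additive X := fun a b =>
    Additive.ofMul (mk ⟨⁅(a : F), (b : F)⁆, Subgroup.commutator_mem_commutator a.2 b.2⟩)
  have hκ1 : ∀ a a' b, κ (a * a') b = κ a b + κ a' b := by
    intro a a' b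
    have hab' := Subgroup.commutator_mem_commutator a'.2 b.2
    have hn : ⁅(a : F), ⁅(a' : F), (b : F)⁆⁆ ∈ ⁅⁅T, T⁆, T⁆ := by
      rw [Subgroup.commutator_comm]
      exact Subgroup.commutator_mem_commutator a.2 hab'
    have hn' := Subgroup.commutator_mono (Subgroup.commutator_self_le T) le_rfl hn
    have e : (⟨⁅((a * a' : T) : F), (b : F)⁆,
        Subgroup.commutator_mem_commutator (a * a').2 b.2⟩ : ↥⁅T, T⁆)
        = ⟨_, hn'⟩ * (⟨_, hab'⟩ * ⟨_, Subgroup.commutator_mem_commutator a.2 b.2⟩) :=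
      Subtype.ext (commutator_mul_left_eq _ _ _)
    simp only [κ]
    rw [e, mk.map_mul, mk.map_mul, (hmk ⟨_, hn'⟩).2 hn, one_mul, mul_comm, ofMul_mul]
  have hκ2 : ∀ a b, κ b a = -κ a b := by
    intro a b
    simp only [κ]
    rw [← ofMul_inv, ← map_inv]
    exact congrArg (fun x => Additive.ofMul (mk x)) (Subtype.ext (commutatorElement_inv _ _).symm)
  have hκ3 : ∀ a b b', κ a (b * b') = κ a b + κ a b' := by
    intro a b b'
    rw [hκ2 (b * b') a, hκ1, neg_add, ← hκ2, ← hκ2]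
  -- Only the pairs `i < j` in a well-ordering of the generators are kept. Then exactly one term of
  -- `β (i ⊗ j - j ⊗ i)` survives for `i ≠ j`, and antisymmetry of `κ` gives it the right value. So
  -- `β` recovers an element of `[T, T]` modulo `[[T, T], T]` from its class.
  obtain ⟨β, hβ⟩ := exists_bilinear_of_generators (G := T) (fun i j =>
    if WellOrderingRel i j then κ (IsFreeGroup.of i) (IsFreeGroup.of j) else 0)
  have hβκ : ∀ a b, β (abOf a ⊗ₜ abOf b - abOf b ⊗ₜ abOf a) = κ a b := by
    intro a b
    rw [← sub_eq_zero]
    refine eq_zero_of_bimultiplicative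
      (fun a b : T => β (abOf a ⊗ₜ abOf b - abOf b ⊗ₜ abOf a) - κ a b) ?_ ?_ ?_ a b
    · intro a a' b
      simp only [abOf_mul, hκ1, map_sub, TensorProduct.add_tmul, TensorProduct.tmul_add, map_add]
      abel
    · intro a b b'
      simp only [abOf_mul, hκ3, map_sub, TensorProduct.add_tmul, TensorProduct.tmul_add, map_add]
      abel
    · intro i j
      rw [map_sub, hβ, hβ, sub_eq_zero]
      rcases trichotomous_of WellOrderingRel i j with h | rfl | h
      · rw [if_pos h, if_neg (asymm_of WellOrderingRel h), sub_zero]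
      · rw [sub_self]
        have e : (⟨⁅((IsFreeGroup.of i : T) : F), (IsFreeGroup.of i : T)⁆,
            Subgroup.commutator_mem_commutator (Subtype.prop _) (Subtype.prop _)⟩ : ↥⁅T, T⁆) = 1 :=
          Subtype.ext (commutatorElement_self _)
        simp only [κ]
        rw [e, map_one, ofMul_one]
      · rw [if_pos h, if_neg (asymm_of WellOrderingRel h), zero_sub, ← hκ2]
  have key : ∀ w (hw : w ∈ ⁅T, T⁆), β (altClass T w) = Additive.ofMul (mk ⟨w, hw⟩) := by
    intro w hw
    have hw' := hw
    rw [Subgroup.commutator_def] at hw'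
    induction hw' using Subgroup.closure_induction with
    | mem x hx =>
      obtain ⟨a, ha, b, hb, rfl⟩ := hx
      exact (congrArg β (altClass_commutator ⟨a, ha⟩ ⟨b, hb⟩)).trans (hβκ _ _)
    | one => rw [altClass_one, map_zero]; exact congrArg Additive.ofMul (map_one mk).symm
    | mul x y hx hy hx' hy' =>
      rw [← Subgroup.commutator_def] at hx hy
      rw [altClass_mul hx hy, map_add, hx' hx, hy' hy, ← ofMul_mul, ← map_mul]
      rfl
    | inv x hx hx' =>
      rw [← Subgroup.commutator_def] at hx
      rw [altClass_inv hx, map_neg, hx' hx, ← ofMul_inv, ← map_inv]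
      rfl
  have h := key w hw
  rw [h0, map_zero, eq_comm, ofMul_eq_zero] at h
  exact (hmk _).1 h

end AlternatingClass

section AltSpanInduction

variable {k : Type} [CommRing k] {M : Type*} [AddCommGroup M] [Module k M]

/-- No case for scalars is needed, since they are absorbed into the entry from `I`. -/
theorem altSpan_induction {I J : Submodule k M} {p : M ⊗[k] M → Prop} (zero : p 0)
    (add : ∀ x y, p x → p y → p (x + y))
    (mem : ∀ a ∈ I, ∀ b ∈ J, p (a ⊗ₜ[k] b - b ⊗ₜ[k] a)) {t : M ⊗[k] M} (ht : t ∈ altSpan I J) :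
    p t := by
  refine Submodule.closure_induction zero (fun x y _ _ => add x y) ?_ ht
  rintro r _ ⟨a, ha, b, hb, rfl⟩
  rw [smul_sub, TensorProduct.smul_tmul', ← TensorProduct.tmul_smul]
  exact mem _ (I.smul_mem r ha) _ hb

theorem altSpan_sup_le_altKernel {A B : Type*} [AddCommGroup A] [Module k A] [AddCommGroup B]
    [Module k B] (f : M →ₗ[k] A) (g : M →ₗ[k] B) :
    altSpan (LinearMap.ker f ⊓ LinearMap.ker g) ⊤ ⊔
      altSpan (LinearMap.ker f) (LinearMap.ker f) ⊔
        altSpan (LinearMap.ker g) (LinearMap.ker g) ≤ altKernel f g := by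
  refine le_inf (sup_le (sup_le ?_ ?_) ?_) (sup_le (sup_le ?_ ?_) ?_)
  · exact altSpan_le_symSquareRel _ _
  · exact altSpan_le_symSquareRel _ _
  · exact altSpan_le_symSquareRel _ _
  · refine altSpan_le.2 fun a ha b _ => ?_
    obtain ⟨ha1, ha2⟩ := ha
    rw [SetLike.mem_coe, LinearMap.mem_ker] at ha1 ha2
    simp [ha1, ha2]
  · refine altSpan_le.2 fun a ha b hb => ?_
    rw [LinearMap.mem_ker] at ha hb
    simp [ha, hb]
  · refine altSpan_le.2 fun a ha b hb => ?_
    rw [LinearMap.mem_ker] at ha hb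
    simp [ha, hb]

end AltSpanInduction

/-- This provides the projectivity of `(R ∩ S)_ab` and the flatness of `R_ab` and of submodules of
`S_ab` on which the linear algebra rests. -/
instance free_abelianization {G : Type*} [Group G] [IsFreeGroup G] :
    Module.Free ℤ (Additive (Abelianization G)) := by
  let e : Additive (Abelianization G) ≃+ FreeAbelianGroup (IsFreeGroup.Generators G) :=
    MulEquiv.toAdditive (IsFreeGroup.toFreeGroup G).abelianizationCongr
  exact Module.Free.of_equiv' (Module.Free.finsupp ℤ ℤ (IsFreeGroup.Generators G))
    (e.trans (FreeAbelianGroup.equivFinsupp _)).toIntLinearEquiv.symm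

/-! ### The maps from `(R ∩ S)_ab` and their kernels -/

section AbelianizationMaps

open scoped commutatorElement

variable {F : Type u} [Group F] (R S : Subgroup F)

/-- The map `(R ∩ S)_ab → R_ab`. -/
abbrev infToLeft : Additive (Abelianization ↥(R ⊓ S)) →ₗ[ℤ] Additive (Abelianization R) :=
  abMap (Subgroup.inclusion (inf_le_left : R ⊓ S ≤ R))

/-- The map `(R ∩ S)_ab → S_ab`. -/
abbrev infToRight : Additive (Abelianization ↥(R ⊓ S)) →ₗ[ℤ] Additive (Abelianization S) :=
  abMap (Subgroup.inclusion (inf_le_right : R ⊓ S ≤ S))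

variable {R S}

theorem commutator_inf_le_inf :
    ⁅R, R⁆ ⊓ ⁅S, S⁆ ≤ R ⊓ S ∧ ⁅R, R⁆ ⊓ S ≤ R ⊓ S ∧ R ⊓ ⁅S, S⁆ ≤ R ⊓ S :=
  ⟨inf_le_inf (Subgroup.commutator_self_le R) (Subgroup.commutator_self_le S),
    inf_le_inf_right _ (Subgroup.commutator_self_le R),
    inf_le_inf_left _ (Subgroup.commutator_self_le S)⟩

theorem abOf_mem_ker_infToLeft (t : ↥(R ⊓ S)) :
    abOf t ∈ LinearMap.ker (infToLeft R S) ↔ (t : F) ∈ ⁅R, R⁆ := by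
  rw [LinearMap.mem_ker, abMap_abOf, abOf_coe_eq_zero_iff]
  rfl

theorem abOf_mem_ker_infToRight (t : ↥(R ⊓ S)) :
    abOf t ∈ LinearMap.ker (infToRight R S) ↔ (t : F) ∈ ⁅S, S⁆ := by
  rw [LinearMap.mem_ker, abMap_abOf, abOf_coe_eq_zero_iff]
  rfl

variable (R S) [R.Normal] [S.Normal]

/-- The projection `(R ∩ S)_ab → (R ∩ S) / ((R' ∩ S)(R ∩ S'))`. -/
def midProj : Additive (Abelianization ↥(R ⊓ S)) →ₗ[ℤ] Additive (MidQuot R S) :=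
  abLift (QuotientGroup.mk' ((midSubgroup R S).subgroupOf (R ⊓ S)))

theorem midProj_abOf (t : ↥(R ⊓ S)) :
    midProj R S (abOf t) = Additive.ofMul (QuotientGroup.mk t : MidQuot R S) :=
  abLift_abOf _ _

theorem midProj_surjective : Function.Surjective (midProj R S) := by
  intro x
  obtain ⟨t, ht⟩ := QuotientGroup.mk_surjective x.toMul
  exact ⟨abOf t, (midProj_abOf R S t).trans (congrArg Additive.ofMul ht)⟩

/-- The two kernels consist of the classes of elements of `R' ∩ S` and of `R ∩ S'`. Every element of
the product of these normal subgroups factors accordingly. -/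
theorem ker_midProj :
    LinearMap.ker (midProj R S) =
      LinearMap.ker (infToLeft R S) ⊔ LinearMap.ker (infToRight R S) := by
  apply le_antisymm
  · intro x hx
    obtain ⟨t, rfl⟩ := abOf_surjective x
    rw [LinearMap.mem_ker, midProj_abOf, ofMul_eq_zero, QuotientGroup.eq_one_iff,
      Subgroup.mem_subgroupOf, midSubgroup] at hx
    obtain ⟨a, ha, b, hb, e⟩ := Subgroup.mem_sup_of_normal_left.1 hx
    have ha' : a ∈ R ⊓ S := ⟨Subgroup.commutator_self_le R ha.1, ha.2⟩
    have hb' : b ∈ R ⊓ S := ⟨hb.1, Subgroup.commutator_self_le S hb.2⟩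
    obtain rfl : (⟨a, ha'⟩ : ↥(R ⊓ S)) * ⟨b, hb'⟩ = t := Subtype.ext e
    rw [abOf_mul]
    exact Submodule.add_mem_sup ((abOf_mem_ker_infToLeft _).2 ha.1)
      ((abOf_mem_ker_infToRight _).2 hb.2)
  · have key : ∀ t : ↥(R ⊓ S), (t : F) ∈ midSubgroup R S →
        abOf t ∈ LinearMap.ker (midProj R S) := by
      intro t ht
      rw [LinearMap.mem_ker, midProj_abOf, ofMul_eq_zero]
      exact (QuotientGroup.eq_one_iff t).2 ht
    refine sup_le ?_ ?_
    · intro x hx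
      obtain ⟨t, rfl⟩ := abOf_surjective x
      exact key t (Subgroup.mem_sup_left ⟨(abOf_mem_ker_infToLeft t).1 hx, t.2.2⟩)
    · intro x hx
      obtain ⟨t, rfl⟩ := abOf_surjective x
      exact key t (Subgroup.mem_sup_right ⟨t.2.1, (abOf_mem_ker_infToRight t).1 hx⟩)

/-- This and the next lemma transport Koszul homology along the equality `ker_midProj` by maps
induced by the identity. -/
theorem ker_sup_ker_le_ker_midProj : ∀ x ∈ LinearMap.ker (infToLeft R S) ⊔
    LinearMap.ker (infToRight R S), (LinearMap.id : _ →ₗ[ℤ] _) x ∈ LinearMap.ker (midProj R S) :=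
  fun _ hx => (ker_midProj R S).ge hx

theorem ker_midProj_le_ker_sup_ker : ∀ x ∈ LinearMap.ker (midProj R S),
    (LinearMap.id : _ →ₗ[ℤ] _) x ∈ LinearMap.ker (infToLeft R S) ⊔
      LinearMap.ker (infToRight R S) :=
  fun _ hx => (ker_midProj R S).le hx

end AbelianizationMaps

/-! ### The dimension subgroup in terms of alternating classes -/

section DimensionSubgroup

open scoped commutatorElement

variable {F : Type u} [Group F] [IsFreeGroup F] {R S : Subgroup F} [R.Normal] [S.Normal]

/-- The pairing `(u, v) ↦ (u - 1)(v - 1)` from `R_ab ⊗ S_ab` to `ℤ[F] / 𝔯𝔣𝔰`. -/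
theorem exists_product_pairing {F : Type u} [Group F] (R S : Subgroup F) [R.Normal] [S.Normal] :
    ∃ θ : Additive (Abelianization R) ⊗[ℤ] Additive (Abelianization S) →+
      MonoidAlgebra ℤ F ⧸
        (groupRingIdeal R * groupRingIdeal (⊤ : Subgroup F) * groupRingIdeal S).toAddSubgroup,
      ∀ (u : R) (v : S), θ (abOf u ⊗ₜ abOf v) = QuotientAddGroup.mk
        ((MonoidAlgebra.of ℤ F u - 1) * (MonoidAlgebra.of ℤ F v - 1)) := by
  -- These triple products are the error terms in the multiplicativity of `(u - 1)(v - 1)` in `u`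
  -- and in `v`.
  have key : ∀ (u : R) (g : F) (v : S), (QuotientAddGroup.mk ((MonoidAlgebra.of ℤ F u - 1) *
      (MonoidAlgebra.of ℤ F g - 1) * (MonoidAlgebra.of ℤ F v - 1)) : MonoidAlgebra ℤ F ⧸
        (groupRingIdeal R * groupRingIdeal (⊤ : Subgroup F) * groupRingIdeal S).toAddSubgroup)
          = 0 := fun u g v =>
    (QuotientAddGroup.eq_zero_iff _).2 (Ideal.mul_mem_mul (Ideal.mul_mem_mul
      (sub_one_mem_groupRingIdeal u.2) (sub_one_mem_groupRingIdeal (Subgroup.mem_top g)))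
      (sub_one_mem_groupRingIdeal v.2))
  have e : ∀ a b : F, MonoidAlgebra.of ℤ F (a * b) - 1 = (MonoidAlgebra.of ℤ F a - 1) *
      (MonoidAlgebra.of ℤ F b - 1) + (MonoidAlgebra.of ℤ F a - 1) +
        (MonoidAlgebra.of ℤ F b - 1) := fun a b => by
    rw [map_mul]; noncomm_ring
  let B : R → S → MonoidAlgebra ℤ F ⧸
      (groupRingIdeal R * groupRingIdeal (⊤ : Subgroup F) * groupRingIdeal S).toAddSubgroup :=
    fun u v => QuotientAddGroup.mk ((MonoidAlgebra.of ℤ F u - 1) * (MonoidAlgebra.of ℤ F v - 1))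
  have hB1 : ∀ u u' v, B (u * u') v = B u v + B u' v := by
    intro u u' v
    simp only [B]
    rw [Subgroup.coe_mul, e, add_mul, add_mul, QuotientAddGroup.mk_add, QuotientAddGroup.mk_add,
      key, zero_add]
  have hB2 : ∀ u v v', B u (v * v') = B u v + B u v' := by
    intro u v v'
    simp only [B]
    rw [Subgroup.coe_mul, e, mul_add, mul_add, ← mul_assoc, QuotientAddGroup.mk_add,
      QuotientAddGroup.mk_add, key, zero_add]
  refine ⟨(TensorProduct.lift (abLift (MonoidHom.mk' (fun u => Multiplicative.ofAdd
    (abLift (MonoidHom.mk' (fun v => Multiplicative.ofAdd (B u v)) fun v v' => by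
      rw [hB2, ofAdd_add]))) fun u u' => ?_))).toAddMonoidHom, fun u v => ?_⟩
  · rw [← ofAdd_add]
    refine congrArg Multiplicative.ofAdd (LinearMap.ext fun x => ?_)
    obtain ⟨v, rfl⟩ := abOf_surjective x
    rw [LinearMap.add_apply, abLift_abOf, abLift_abOf, abLift_abOf]
    exact hB1 u u' v
  · rw [LinearMap.toAddMonoidHom_coe, TensorProduct.lift.tmul, abLift_abOf]
    exact abLift_abOf _ _

theorem mul_mul_le_mul {F : Type u} [Group F] (R S : Subgroup F) :
    groupRingIdeal R * groupRingIdeal (⊤ : Subgroup F) * groupRingIdeal S ≤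
      groupRingIdeal R * groupRingIdeal S := by
  refine Ideal.mul_mono_left (Ideal.mul_le.2 fun a ha b _ => ?_)
  exact TwoSidedIdeal.mul_mem_right _ _ _ ha

/-- The pairing `Ψ` kills `𝔯𝔣𝔰`, because its value on `(u - 1) g (v - 1)` does not depend on `g`,
and on `w - 1` it is the image of the class of `w` in `R_ab ⊗ S_ab`. Conversely the pairing `θ`
carries that image back to `w - 1` modulo `𝔯𝔣𝔰`. -/
theorem mem_dimSubgroup_iff {w : F} :
    w ∈ dimSubgroup R S ↔ w ∈ ⁅R ⊓ S, R ⊓ S⁆ ∧ altClass (R ⊓ S) w ∈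
      LinearMap.ker (TensorProduct.map (infToLeft R S) (infToRight R S)) := by
  constructor
  · intro hw
    have hw' : MonoidAlgebra.of ℤ F w - 1 ∈
      groupRingIdeal R * groupRingIdeal (⊤ : Subgroup F) * groupRingIdeal S := hw
    have hwT := mem_commutator_of_sub_one_mem_mul (mul_mul_le_mul R S hw')
    refine ⟨hwT, ?_⟩
    obtain ⟨Ψ, hΨ⟩ := exists_pairing R S
    have h := pairing_eq_altClass Ψ
      (TensorProduct.map (infToLeft R S) (infToRight R S)).toAddMonoidHom (fun u v g => by
        rw [LinearMap.toAddMonoidHom_coe, TensorProduct.map_tmul, abMap_abOf, abMap_abOf]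
        exact hΨ (Subgroup.inclusion inf_le_left u) (Subgroup.inclusion inf_le_right v) g) hwT
    rw [LinearMap.mem_ker]
    refine h.symm.trans (eq_zero_of_mem_mul_mul Ψ (fun u hu v hv g g' => ?_) hw')
    exact (hΨ ⟨u, hu⟩ ⟨v, hv⟩ g).trans (hΨ ⟨u, hu⟩ ⟨v, hv⟩ g').symm
  · rintro ⟨hwT, hw⟩
    obtain ⟨θ, hθ⟩ := exists_product_pairing R S
    have h := pairing_eq_altClass (QuotientAddGroup.mk' _) (θ.comp
      (TensorProduct.map (infToLeft R S) (infToRight R S)).toAddMonoidHom) (fun u v g => by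
        rw [AddMonoidHom.comp_apply, LinearMap.toAddMonoidHom_coe, TensorProduct.map_tmul,
          abMap_abOf, abMap_abOf, hθ, QuotientAddGroup.mk'_apply, ← sub_eq_zero,
          ← QuotientAddGroup.mk_sub, QuotientAddGroup.eq_zero_iff]
        have e : (MonoidAlgebra.of ℤ F u - 1) * MonoidAlgebra.of ℤ F g *
            (MonoidAlgebra.of ℤ F v - 1) - (MonoidAlgebra.of ℤ F u - 1) *
              (MonoidAlgebra.of ℤ F v - 1) = (MonoidAlgebra.of ℤ F u - 1) *
                (MonoidAlgebra.of ℤ F g - 1) * (MonoidAlgebra.of ℤ F v - 1) := by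
          noncomm_ring
        refine (congrArg (· ∈ _) e).mpr (Ideal.mul_mem_mul (Ideal.mul_mem_mul
          (sub_one_mem_groupRingIdeal u.2.1) (sub_one_mem_groupRingIdeal (Subgroup.mem_top g)))
          (sub_one_mem_groupRingIdeal v.2.2))) hwT
    rw [LinearMap.mem_ker] at hw
    rw [AddMonoidHom.comp_apply, LinearMap.toAddMonoidHom_coe, hw, map_zero,
      QuotientAddGroup.mk'_apply, QuotientAddGroup.eq_zero_iff] at h
    exact h

end DimensionSubgroup

/-! ### The dimension quotient as Koszul homology -/

section DimensionQuotient

open scoped commutatorElement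

variable {F : Type u} [Group F] [IsFreeGroup F]

theorem altClass_mem_symSquareRel {T : Subgroup F} {w : F} (hw : w ∈ ⁅T, T⁆) :
    altClass T w ∈ symSquareRel ℤ (Additive (Abelianization T)) := by
  have hw' := hw
  rw [Subgroup.commutator_def] at hw'
  induction hw' using Subgroup.closure_induction with
  | mem x hx =>
    obtain ⟨a, ha, b, hb, rfl⟩ := hx
    rw [altClass_commutator (⟨a, ha⟩ : T) ⟨b, hb⟩, symSquareRel_eq_altSpan]
    exact sub_mem_altSpan Submodule.mem_top Submodule.mem_top
  | one => rw [altClass_one]; exact zero_mem _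
  | mul x y hx hy hx' hy' =>
    rw [← Subgroup.commutator_def] at hx hy
    rw [altClass_mul hx hy]
    exact add_mem (hx' hx) (hy' hy)
  | inv x hx hx' =>
    rw [← Subgroup.commutator_def] at hx
    rw [altClass_inv hx]
    exact neg_mem (hx' hx)

/-- Together with `altClass_mem_of_mem_commutator` this matches commutator subgroups `[H, H']` with
spans of alternating tensors. -/
theorem exists_altClass_eq {T H H' : Subgroup F} (hH : H ≤ T) (hH' : H' ≤ T)
    {I J : Submodule ℤ (Additive (Abelianization T))}
    (hI : ∀ a : T, abOf a ∈ I → (a : F) ∈ H) (hJ : ∀ a : T, abOf a ∈ J → (a : F) ∈ H')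
    {t : Additive (Abelianization T) ⊗[ℤ] Additive (Abelianization T)} (ht : t ∈ altSpan I J) :
    ∃ w ∈ ⁅H, H'⁆, altClass T w = t := by
  have hle : ⁅H, H'⁆ ≤ ⁅T, T⁆ := Subgroup.commutator_mono hH hH'
  refine altSpan_induction (p := fun t => ∃ w ∈ ⁅H, H'⁆, altClass T w = t)
    ⟨1, one_mem _, altClass_one⟩ ?_ ?_ ht
  · rintro _ _ ⟨w, hw, rfl⟩ ⟨w', hw', rfl⟩
    exact ⟨w * w', mul_mem hw hw', altClass_mul (hle hw) (hle hw')⟩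
  · intro a ha b hb
    obtain ⟨a, rfl⟩ := abOf_surjective a
    obtain ⟨b, rfl⟩ := abOf_surjective b
    exact ⟨⁅(a : F), (b : F)⁆, Subgroup.commutator_mem_commutator (hI a ha) (hJ b hb),
      altClass_commutator a b⟩

theorem altClass_mem_of_mem_commutator {T H H' : Subgroup F} (hH : H ≤ T) (hH' : H' ≤ T)
    {I J : Submodule ℤ (Additive (Abelianization T))}
    (hI : ∀ a : T, (a : F) ∈ H → abOf a ∈ I) (hJ : ∀ a : T, (a : F) ∈ H' → abOf a ∈ J)
    {w : F} (hw : w ∈ ⁅H, H'⁆) : altClass T w ∈ altSpan I J := by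
  have hle : ⁅H, H'⁆ ≤ ⁅T, T⁆ := Subgroup.commutator_mono hH hH'
  have hw' := hw
  rw [Subgroup.commutator_def] at hw'
  induction hw' using Subgroup.closure_induction with
  | mem x hx =>
    obtain ⟨a, ha, b, hb, rfl⟩ := hx
    rw [altClass_commutator (⟨a, hH ha⟩ : T) ⟨b, hH' hb⟩]
    exact sub_mem_altSpan (hI _ ha) (hJ _ hb)
  | one => rw [altClass_one]; exact zero_mem _
  | mul x y hx hy hx' hy' =>
    rw [← Subgroup.commutator_def] at hx hy
    rw [altClass_mul (hle hx) (hle hy)]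
    exact add_mem (hx' hx) (hy' hy)
  | inv x hx hx' =>
    rw [← Subgroup.commutator_def] at hx
    rw [altClass_inv (hle hx)]
    exact neg_mem (hx' hx)

variable {R S : Subgroup F} [R.Normal] [S.Normal]

/-- Each of the three commutator subgroups realizes one of the three spans. If the class of `w` lies
in their sum, a product `w₁ w₂ w₃` has the same class, and the quotient lies in `[[T, T], T]` for `T
= R ∩ S`. This is contained in `[R' ∩ S', R ∩ S]`, because `[T, T] ⊆ R' ∩ S'`. -/
theorem mem_commSubgroup_iff {w : F} :
    w ∈ commSubgroup R S ↔ w ∈ ⁅R ⊓ S, R ⊓ S⁆ ∧ altClass (R ⊓ S) w ∈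
      altSpan (LinearMap.ker (infToLeft R S) ⊓ LinearMap.ker (infToRight R S)) ⊤ ⊔
        altSpan (LinearMap.ker (infToLeft R S)) (LinearMap.ker (infToLeft R S)) ⊔
          altSpan (LinearMap.ker (infToRight R S)) (LinearMap.ker (infToRight R S)) := by
  obtain ⟨l1, l2, l3⟩ := commutator_inf_le_inf (R := R) (S := S)
  have c1 := Subgroup.commutator_mono l1 (le_refl (R ⊓ S))
  have c2 := Subgroup.commutator_mono l2 l2
  have c3 := Subgroup.commutator_mono l3 l3
  have k1 : ∀ a : ↥(R ⊓ S),
      abOf a ∈ LinearMap.ker (infToLeft R S) ⊓ LinearMap.ker (infToRight R S) ↔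
        (a : F) ∈ ⁅R, R⁆ ⊓ ⁅S, S⁆ := fun a =>
    and_congr (abOf_mem_ker_infToLeft a) (abOf_mem_ker_infToRight a)
  have k2 : ∀ a : ↥(R ⊓ S), abOf a ∈ LinearMap.ker (infToLeft R S) ↔ (a : F) ∈ ⁅R, R⁆ ⊓ S :=
    fun a => (abOf_mem_ker_infToLeft a).trans ⟨fun h => ⟨h, a.2.2⟩, fun h => h.1⟩
  have k3 : ∀ a : ↥(R ⊓ S), abOf a ∈ LinearMap.ker (infToRight R S) ↔ (a : F) ∈ R ⊓ ⁅S, S⁆ :=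
    fun a => (abOf_mem_ker_infToRight a).trans ⟨fun h => ⟨a.2.1, h⟩, fun h => h.2⟩
  constructor
  · intro hw
    obtain ⟨x, hx, w₃, hw₃, rfl⟩ := Subgroup.mem_sup_of_normal_left.1 hw
    obtain ⟨w₁, hw₁, w₂, hw₂, rfl⟩ := Subgroup.mem_sup_of_normal_left.1 hx
    refine ⟨mul_mem (mul_mem (c1 hw₁) (c2 hw₂)) (c3 hw₃), ?_⟩
    rw [altClass_mul (mul_mem (c1 hw₁) (c2 hw₂)) (c3 hw₃), altClass_mul (c1 hw₁) (c2 hw₂)]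
    exact Submodule.add_mem_sup (Submodule.add_mem_sup
      (altClass_mem_of_mem_commutator l1 le_rfl (fun a => (k1 a).2)
        (fun _ _ => Submodule.mem_top) hw₁)
      (altClass_mem_of_mem_commutator l2 l2 (fun a => (k2 a).2) (fun a => (k2 a).2) hw₂))
      (altClass_mem_of_mem_commutator l3 l3 (fun a => (k3 a).2) (fun a => (k3 a).2) hw₃)
  · rintro ⟨hwT, hw⟩
    obtain ⟨x, hx, t₃, ht₃, e⟩ := Submodule.mem_sup.1 hw
    obtain ⟨t₁, ht₁, t₂, ht₂, rfl⟩ := Submodule.mem_sup.1 hx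
    obtain ⟨w₁, hw₁, rfl⟩ := exists_altClass_eq l1 le_rfl (fun a => (k1 a).1)
      (fun a _ => a.2) ht₁
    obtain ⟨w₂, hw₂, rfl⟩ := exists_altClass_eq l2 l2 (fun a => (k2 a).1) (fun a => (k2 a).1) ht₂
    obtain ⟨w₃, hw₃, rfl⟩ := exists_altClass_eq l3 l3 (fun a => (k3 a).1) (fun a => (k3 a).1) ht₃
    have h12 := mul_mem (c1 hw₁) (c2 hw₂)
    have h123 := mul_mem h12 (c3 hw₃)
    have hc : w₁ * w₂ * w₃ ∈ commSubgroup R S :=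
      mul_mem (Subgroup.mem_sup_left (mul_mem (Subgroup.mem_sup_left hw₁)
        (Subgroup.mem_sup_right hw₂))) (Subgroup.mem_sup_right hw₃)
    have h0 : altClass (R ⊓ S) (w * (w₁ * w₂ * w₃)⁻¹) = 0 := by
      rw [altClass_mul hwT (inv_mem h123), altClass_inv h123, altClass_mul h12 (c3 hw₃),
        altClass_mul (c1 hw₁) (c2 hw₂), e, add_neg_cancel]
    have h1 := mem_of_altClass_eq_zero (mul_mem hwT (inv_mem h123)) h0
    have hle : ⁅⁅R ⊓ S, R ⊓ S⁆, R ⊓ S⁆ ≤ commSubgroup R S := by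
      refine le_trans (Subgroup.commutator_mono (le_inf ?_ ?_) le_rfl)
        (le_sup_left.trans le_sup_left)
      · exact Subgroup.commutator_mono inf_le_left inf_le_left
      · exact Subgroup.commutator_mono inf_le_right inf_le_right
    have h2 := mul_mem (hle h1) hc
    rwa [inv_mul_cancel_right] at h2

theorem commSubgroup_le_dimSubgroup : commSubgroup R S ≤ dimSubgroup R S := by
  intro w hw
  rw [mem_commSubgroup_iff] at hw
  exact mem_dimSubgroup_iff.2 ⟨hw.1, (altSpan_sup_le_altKernel _ _ hw.2).2⟩

theorem altClass_mem_altKernel {w : F} (hw : w ∈ dimSubgroup R S) :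
    altClass (R ⊓ S) w ∈ altKernel (infToLeft R S) (infToRight R S) :=
  ⟨altClass_mem_symSquareRel (mem_dimSubgroup_iff.1 hw).1, (mem_dimSubgroup_iff.1 hw).2⟩

variable (R S)

/-- The homomorphism from `F ∩ (1 + 𝔯𝔣𝔰)` to the Koszul homology of the presentation
`(R ∩ S)_ab → (R ∩ S) / ((R' ∩ S)(R ∩ S'))`. -/
def dimHom : dimSubgroup R S →* Multiplicative (KoszulHomology (LinearMap.ker (midProj R S))) :=
  MonoidHom.mk' (fun w => Multiplicative.ofAdd (koszulMap LinearMap.id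
    (ker_sup_ker_le_ker_midProj R S) (altKernelMap (infToLeft R S) (infToRight R S)
      ⟨altClass (R ⊓ S) w, altClass_mem_altKernel w.2⟩))) (fun w w' => by
    rw [← ofAdd_add, ← map_add, ← map_add]
    refine congrArg (fun z => Multiplicative.ofAdd (koszulMap LinearMap.id
      (ker_sup_ker_le_ker_midProj R S) (altKernelMap (infToLeft R S) (infToRight R S) z))) ?_
    exact Subtype.ext (altClass_mul (mem_dimSubgroup_iff.1 w.2).1 (mem_dimSubgroup_iff.1 w'.2).1))

theorem dimHom_surjective : Function.Surjective (dimHom R S) := by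
  intro c
  obtain ⟨⟨t, ht⟩, h⟩ := altKernelMap_surjective (infToLeft R S) (infToRight R S)
    (koszulMap LinearMap.id (ker_midProj_le_ker_sup_ker R S) c.toAdd)
  have ht1 := ht.1
  rw [symSquareRel_eq_altSpan] at ht1
  obtain ⟨w, hw, rfl⟩ := exists_altClass_eq (T := R ⊓ S) le_rfl le_rfl (fun a _ => a.2)
    (fun a _ => a.2) ht1
  refine ⟨⟨w, mem_dimSubgroup_iff.2 ⟨hw, ht.2⟩⟩, ?_⟩
  change Multiplicative.ofAdd (koszulMap LinearMap.id _ (altKernelMap _ _ _)) = c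
  rw [h, koszulMap_comp]
  exact congrArg Multiplicative.ofAdd (koszulMap_id _ _)

/-- The transport along `ker_midProj` is invertible, so only the kernel of `altKernelMap` matters,
and its description agrees with `mem_commSubgroup_iff`. -/
theorem ker_dimHom : (commSubgroup R S).subgroupOf (dimSubgroup R S) = (dimHom R S).ker := by
  ext w
  rw [Subgroup.mem_subgroupOf, mem_commSubgroup_iff, MonoidHom.mem_ker]
  have h := altKernelMap_eq_zero_iff (infToLeft R S) (infToRight R S)
    ⟨altClass (R ⊓ S) w, altClass_mem_altKernel w.2⟩
  rw [and_iff_right (mem_dimSubgroup_iff.1 w.2).1, ← h]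
  constructor
  · intro h0
    exact congrArg (fun x => Multiplicative.ofAdd
      (koszulMap LinearMap.id (ker_sup_ker_le_ker_midProj R S) x)) h0
  · intro h0
    have h1 := congrArg (fun x => koszulMap LinearMap.id (ker_midProj_le_ker_sup_ker R S)
      (Multiplicative.toAdd x)) h0
    change koszulMap LinearMap.id _ (koszulMap LinearMap.id _ (altKernelMap _ _ _)) = _ at h1
    rw [koszulMap_comp] at h1
    exact (koszulMap_id _ _).symm.trans h1

/-- The dimension quotient as the Koszul homology of the presentation
`(R ∩ S)_ab → (R ∩ S) / ((R' ∩ S)(R ∩ S'))`. -/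
def dimQuotEquiv :
    DimQuot R S ≃* Multiplicative (KoszulHomology (LinearMap.ker (midProj R S))) :=
  QuotientGroup.liftEquiv _ (dimHom_surjective R S) (ker_dimHom R S)

end DimensionQuotient

/-! ### Naturality of the dimension quotient -/

section DimensionQuotientNaturality

variable {F F₁ : Type u} [Group F] [Group F₁] {R S : Subgroup F} {R₁ S₁ : Subgroup F₁}
  (φ : F →* F₁) (hR : R ≤ R₁.comap φ) (hS : S ≤ S₁.comap φ)

/-- The homomorphism `R ∩ S → R₁ ∩ S₁` induced by `φ`. -/
def infMap : ↥(R ⊓ S) →* ↥(R₁ ⊓ S₁) :=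
  (φ.comp (R ⊓ S).subtype).codRestrict (R₁ ⊓ S₁) (fun w => ⟨hR w.2.1, hS w.2.2⟩)

theorem midProj_abMap [R.Normal] [S.Normal] [R₁.Normal] [S₁.Normal]
    (x : Additive (Abelianization ↥(R ⊓ S))) :
    midProj R₁ S₁ (abMap (infMap φ hR hS) x) = (midObjMap φ hR hS).hom (midProj R S x) := by
  obtain ⟨t, rfl⟩ := abOf_surjective x
  rw [abMap_abOf, midProj_abOf, midProj_abOf]
  rfl

/-- The pairings chosen for `F` and `F₁` are unrelated, but the second one composed with `ℤ[F] →
ℤ[F₁]` has the required values on `(u - 1) g (v - 1)`, so `pairing_eq_altClass` applies. -/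
theorem altClass_map [IsFreeGroup F] [IsFreeGroup F₁] {w : F} (hw : w ∈ ⁅R ⊓ S, R ⊓ S⁆) :
    altClass (R₁ ⊓ S₁) (φ w) = TensorProduct.map (abMap (infMap φ hR hS))
      (abMap (infMap φ hR hS)) (altClass (R ⊓ S) w) := by
  have h := pairing_eq_altClass ((exists_pairing (R₁ ⊓ S₁) (R₁ ⊓ S₁)).choose.comp
    (MonoidAlgebra.mapDomainRingHom ℤ φ).toAddMonoidHom) (TensorProduct.map
      (abMap (infMap φ hR hS)) (abMap (infMap φ hR hS))).toAddMonoidHom (fun u v g => by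
    rw [AddMonoidHom.comp_apply, LinearMap.toAddMonoidHom_coe, TensorProduct.map_tmul, abMap_abOf,
      abMap_abOf]
    refine Eq.trans ?_ ((exists_pairing (R₁ ⊓ S₁) (R₁ ⊓ S₁)).choose_spec
      (infMap φ hR hS u) (infMap φ hR hS v) (φ g))
    change (exists_pairing (R₁ ⊓ S₁) (R₁ ⊓ S₁)).choose (MonoidAlgebra.mapDomainRingHom ℤ φ _) = _
    rw [map_mul (MonoidAlgebra.mapDomainRingHom ℤ φ), map_mul (MonoidAlgebra.mapDomainRingHom ℤ φ),
      map_sub (MonoidAlgebra.mapDomainRingHom ℤ φ), map_sub (MonoidAlgebra.mapDomainRingHom ℤ φ),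
      mapDomainRingHom_of, mapDomainRingHom_of, mapDomainRingHom_of, map_one]
    rfl) hw
  refine Eq.trans ?_ h
  change _ = (exists_pairing (R₁ ⊓ S₁) (R₁ ⊓ S₁)).choose (MonoidAlgebra.mapDomainRingHom ℤ φ _)
  rw [map_sub (MonoidAlgebra.mapDomainRingHom ℤ φ), mapDomainRingHom_of, map_one]
  rfl

theorem dimQuotEquiv_naturality [IsFreeGroup F] [IsFreeGroup F₁] [R.Normal] [S.Normal]
    [R₁.Normal] [S₁.Normal] (x : DimQuot R S) :
    (dimQuotEquiv R₁ S₁ (dimQuotMap φ hR hS x)).toAdd =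
      koszulMap (abMap (infMap φ hR hS)) (mem_ker_of_lift (midProj_abMap φ hR hS))
        (dimQuotEquiv R S x).toAdd := by
  obtain ⟨w, rfl⟩ := QuotientGroup.mk_surjective x
  have hf : ∀ x ∈ LinearMap.ker (infToLeft R S),
      abMap (infMap φ hR hS) x ∈ LinearMap.ker (infToLeft R₁ S₁) := by
    intro x hx
    obtain ⟨t, rfl⟩ := abOf_surjective x
    rw [abOf_mem_ker_infToLeft] at hx
    rw [abMap_abOf, abOf_mem_ker_infToLeft]
    have h : ⁅R, R⁆.map φ ≤ ⁅R₁, R₁⁆ := by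
      rw [Subgroup.map_commutator]
      exact Subgroup.commutator_mono (Subgroup.map_le_iff_le_comap.2 hR)
        (Subgroup.map_le_iff_le_comap.2 hR)
    exact h (Subgroup.mem_map_of_mem φ hx)
  have hg : ∀ x ∈ LinearMap.ker (infToRight R S),
      abMap (infMap φ hR hS) x ∈ LinearMap.ker (infToRight R₁ S₁) := by
    intro x hx
    obtain ⟨t, rfl⟩ := abOf_surjective x
    rw [abOf_mem_ker_infToRight] at hx
    rw [abMap_abOf, abOf_mem_ker_infToRight]
    have h : ⁅S, S⁆.map φ ≤ ⁅S₁, S₁⁆ := by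
      rw [Subgroup.map_commutator]
      exact Subgroup.commutator_mono (Subgroup.map_le_iff_le_comap.2 hS)
        (Subgroup.map_le_iff_le_comap.2 hS)
    exact h (Subgroup.mem_map_of_mem φ hx)
  have h := altKernelMap_naturality (abMap (infMap φ hR hS)) hf hg
    ⟨altClass (R ⊓ S) w, altClass_mem_altKernel w.2⟩
    ⟨altClass (R₁ ⊓ S₁) (φ w), altClass_mem_altKernel (dimSubgroup_map_le φ hR hS w.2)⟩
    (altClass_map φ hR hS (mem_dimSubgroup_iff.1 w.2).1)
  change koszulMap LinearMap.id _ (altKernelMap _ _ _) =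
    koszulMap _ _ (koszulMap LinearMap.id _ (altKernelMap _ _ _))
  rw [koszulMap_comp]
  refine (congrArg _ h).trans ?_
  rw [koszulMap_comp]
  rfl

end DimensionQuotientNaturality

/-! ### One-cycles and one-boundaries of `SP²` of a simplicial module -/

section SimplicialModule

open scoped Simplicial

variable {k : Type} [CommRing k] (X : SimplicialObject (ModuleCat.{u} k))

/-- The face operators of a simplicial module, as linear maps. -/
abbrev face {n : ℕ} (i : Fin (n + 2)) : X _⦋n + 1⦌ →ₗ[k] X _⦋n⦌ :=
  (X.δ i).hom

/-- The degeneracy operators of a simplicial module, as linear maps. -/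
abbrev degen {n : ℕ} (i : Fin (n + 1)) : X _⦋n⦌ →ₗ[k] X _⦋n + 1⦌ :=
  (X.σ i).hom

theorem face_degen_castSucc {n : ℕ} (i : Fin (n + 1)) (x : X _⦋n⦌) :
    face X i.castSucc (degen X i x) = x :=
  LinearMap.congr_fun (congrArg ModuleCat.Hom.hom (X.δ_comp_σ_self (i := i))) x

theorem face_degen_succ {n : ℕ} (i : Fin (n + 1)) (x : X _⦋n⦌) :
    face X i.succ (degen X i x) = x :=
  LinearMap.congr_fun (congrArg ModuleCat.Hom.hom (X.δ_comp_σ_succ (i := i))) x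

theorem face_zero_degen (x : X _⦋0⦌) : face X (0 : Fin 2) (degen X 0 x) = x :=
  face_degen_castSucc X 0 x

theorem face_one_degen (x : X _⦋0⦌) : face X (1 : Fin 2) (degen X 0 x) = x :=
  face_degen_succ X 0 x

theorem face_zero_degen_zero (x : X _⦋1⦌) : face X (0 : Fin 3) (degen X 0 x) = x :=
  face_degen_castSucc X 0 x

theorem face_one_degen_zero (x : X _⦋1⦌) : face X (1 : Fin 3) (degen X 0 x) = x :=
  face_degen_succ X 0 x

theorem face_two_degen_zero (x : X _⦋1⦌) :
    face X (2 : Fin 3) (degen X 0 x) = degen X 0 (face X (1 : Fin 2) x) :=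
  LinearMap.congr_fun (congrArg ModuleCat.Hom.hom
    (X.δ_comp_σ_of_gt (i := (1 : Fin 2)) (j := (0 : Fin 1)) (by decide))) x

theorem face_zero_degen_one (x : X _⦋1⦌) :
    face X (0 : Fin 3) (degen X 1 x) = degen X 0 (face X (0 : Fin 2) x) :=
  LinearMap.congr_fun (congrArg ModuleCat.Hom.hom
    (X.δ_comp_σ_of_le (i := (0 : Fin 2)) (j := (0 : Fin 1)) (by decide))) x

theorem face_one_degen_one (x : X _⦋1⦌) : face X (1 : Fin 3) (degen X 1 x) = x :=
  face_degen_castSucc X 1 x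

theorem face_two_degen_one (x : X _⦋1⦌) : face X (2 : Fin 3) (degen X 1 x) = x :=
  face_degen_succ X 1 x

theorem face_zero_face_one (x : X _⦋2⦌) :
    face X (0 : Fin 2) (face X (1 : Fin 3) x) = face X (0 : Fin 2) (face X (0 : Fin 3) x) :=
  LinearMap.congr_fun (congrArg ModuleCat.Hom.hom
    (X.δ_comp_δ (i := (0 : Fin 2)) (j := (0 : Fin 2)) le_rfl)) x

theorem face_zero_face_two (x : X _⦋2⦌) :
    face X (0 : Fin 2) (face X (2 : Fin 3) x) = face X (1 : Fin 2) (face X (0 : Fin 3) x) :=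
  LinearMap.congr_fun (congrArg ModuleCat.Hom.hom
    (X.δ_comp_δ (i := (0 : Fin 2)) (j := (1 : Fin 2)) (by decide))) x

theorem face_one_face_two (x : X _⦋2⦌) :
    face X (1 : Fin 2) (face X (2 : Fin 3) x) = face X (1 : Fin 2) (face X (1 : Fin 3) x) :=
  LinearMap.congr_fun (congrArg ModuleCat.Hom.hom
    (X.δ_comp_δ (i := (1 : Fin 2)) (j := (1 : Fin 2)) le_rfl)) x

/-- The elements of `X₀` that are boundaries in the normalized complex of `X`. -/
def zeroBoundaries : Submodule k (X _⦋0⦌) :=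
  (LinearMap.ker (face X (1 : Fin 2))).map (face X (0 : Fin 2))

/-- Subtracting the degenerate edge at `face 1 e` moves `e` into the normalized complex without
changing the difference of its faces. -/
theorem face_sub_mem_zeroBoundaries (e : X _⦋1⦌) :
    face X (0 : Fin 2) e - face X (1 : Fin 2) e ∈ zeroBoundaries X := by
  refine ⟨e - degen X 0 (face X (1 : Fin 2) e), ?_, ?_⟩
  · rw [SetLike.mem_coe, LinearMap.mem_ker, map_sub, face_one_degen, sub_self]
  · rw [map_sub, face_zero_degen]

/-- The difference of squares of face operators from `X₁ ⊗ X₁` to `X₀ ⊗ X₀`. -/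
def squareDifference : X _⦋1⦌ ⊗[k] X _⦋1⦌ →ₗ[k] X _⦋0⦌ ⊗[k] X _⦋0⦌ :=
  TensorProduct.map (face X (0 : Fin 2)) (face X 0) -
    TensorProduct.map (face X (1 : Fin 2)) (face X 1)

/-- The elements of `X₁ ⊗ X₁` representing a one-cycle of `SP² X`. -/
def squareCycles : Submodule k (X _⦋1⦌ ⊗[k] X _⦋1⦌) :=
  (symSquareRel k (X _⦋0⦌)).comap (squareDifference X)

/-- The difference of squares of face operators from `X₂ ⊗ X₂` to `X₁ ⊗ X₁`. -/
def squareBoundaryMap : X _⦋2⦌ ⊗[k] X _⦋2⦌ →ₗ[k] X _⦋1⦌ ⊗[k] X _⦋1⦌ :=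
  TensorProduct.map (face X (0 : Fin 3)) (face X 0) -
    TensorProduct.map (face X (1 : Fin 3)) (face X 1) +
    TensorProduct.map (face X (2 : Fin 3)) (face X 2)

/-- The elements of `X₁ ⊗ X₁` representing a one-boundary of `SP² X`. -/
def squareBoundaries : Submodule k (X _⦋1⦌ ⊗[k] X _⦋1⦌) :=
  symSquareRel k (X _⦋1⦌) ⊔ LinearMap.range (squareBoundaryMap X)

theorem squareBoundaryMap_tmul (x y : X _⦋2⦌) : squareBoundaryMap X (x ⊗ₜ y) =
    face X (0 : Fin 3) x ⊗ₜ face X 0 y - face X (1 : Fin 3) x ⊗ₜ face X 1 y +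
      face X (2 : Fin 3) x ⊗ₜ face X 2 y := by
  simp [squareBoundaryMap]

theorem squareBoundaryMap_mem (x y : X _⦋2⦌) :
    face X (0 : Fin 3) x ⊗ₜ face X 0 y - face X (1 : Fin 3) x ⊗ₜ face X 1 y +
      face X (2 : Fin 3) x ⊗ₜ face X 2 y ∈ squareBoundaries X := by
  rw [← squareBoundaryMap_tmul]
  exact Submodule.mem_sup_right (LinearMap.mem_range_self _ _)

theorem tmul_sub_tmul_mem (x y : X _⦋1⦌) : x ⊗ₜ y - y ⊗ₜ x ∈ squareBoundaries X :=
  Submodule.mem_sup_left (Submodule.subset_span ⟨x, y, rfl⟩)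

/-- For the doubly degenerate two-simplices all three faces agree, so the alternating sum leaves one
copy. -/
theorem degen_tmul_degen_mem (x y : X _⦋0⦌) :
    degen X (0 : Fin 1) x ⊗ₜ degen X (0 : Fin 1) y ∈ squareBoundaries X := by
  have h := squareBoundaryMap_mem X (degen X 0 (degen X 0 x)) (degen X 0 (degen X 0 y))
  simpa only [face_zero_degen_zero, face_one_degen_zero, face_two_degen_zero, face_one_degen,
    sub_self, zero_add] using h

/-- The Alexander-Whitney splitting of a product of two edges. -/
theorem tmul_sub_mem (x y : X _⦋1⦌) :
    x ⊗ₜ degen X 0 (face X (0 : Fin 2) y) - x ⊗ₜ y + degen X 0 (face X (1 : Fin 2) x) ⊗ₜ y ∈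
      squareBoundaries X := by
  have h := squareBoundaryMap_mem X (degen X 0 x) (degen X 1 y)
  simpa only [face_zero_degen_zero, face_one_degen_zero, face_two_degen_zero,
    face_zero_degen_one, face_one_degen_one, face_two_degen_one] using h

/-- The comparison map from the one-chains of `SP² X` to the Koszul complex, sending the product of
the edges `e`, `e'` from `y`, `y'` to `x`, `x'` to `(x - y) ⊗ x' + (x' - y') ⊗ y`. -/
def squareToKoszul : X _⦋1⦌ ⊗[k] X _⦋1⦌ →ₗ[k] X _⦋0⦌ ⊗[k] X _⦋0⦌ :=
  TensorProduct.map (face X (0 : Fin 2) - face X 1) (face X (0 : Fin 2)) +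
    (TensorProduct.comm k _ _).toLinearMap ∘ₗ
      TensorProduct.map (face X (1 : Fin 2)) (face X (0 : Fin 2) - face X 1)

theorem squareToKoszul_tmul (e e' : X _⦋1⦌) : squareToKoszul X (e ⊗ₜ e') =
    (face X (0 : Fin 2) e - face X (1 : Fin 2) e) ⊗ₜ face X (0 : Fin 2) e' +
      (face X (0 : Fin 2) e' - face X (1 : Fin 2) e') ⊗ₜ face X (1 : Fin 2) e := by
  simp [squareToKoszul]

theorem squareToKoszul_mem_tensorSpan (z : X _⦋1⦌ ⊗[k] X _⦋1⦌) :
    squareToKoszul X z ∈ tensorSpan (zeroBoundaries X) ⊤ := by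
  induction z using TensorProduct.induction_on with
  | zero => rw [map_zero]; exact zero_mem _
  | add a b ha hb => rw [map_add]; exact add_mem ha hb
  | tmul a b =>
    rw [squareToKoszul_tmul]
    exact add_mem (tmul_mem_tensorSpan (face_sub_mem_zeroBoundaries X a) Submodule.mem_top)
      (tmul_mem_tensorSpan (face_sub_mem_zeroBoundaries X b) Submodule.mem_top)

/-- For edges from `y`, `y'` to `x`, `x'` the difference is `(x' - y') ⊗ y - y ⊗ (x' - y')`. So in
`SP² X₀` the comparison map becomes the differential, and it detects cycles. -/
theorem squareToKoszul_sub_mem (z : X _⦋1⦌ ⊗[k] X _⦋1⦌) : 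
    squareToKoszul X z - squareDifference X z ∈ symSquareRel k (X _⦋0⦌) := by
  induction z using TensorProduct.induction_on with
  | zero => rw [map_zero, map_zero, sub_zero]; exact zero_mem _
  | add a b ha hb => rw [map_add, map_add, add_sub_add_comm]; exact add_mem ha hb
  | tmul a b =>
    rw [squareToKoszul_tmul, squareDifference, LinearMap.sub_apply, TensorProduct.map_tmul,
      TensorProduct.map_tmul]
    refine Submodule.subset_span
      ⟨face X (0 : Fin 2) b - face X (1 : Fin 2) b, face X (1 : Fin 2) a, ?_⟩
    simp only [TensorProduct.sub_tmul, TensorProduct.tmul_sub]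
    abel

theorem mem_squareCycles_iff (z : X _⦋1⦌ ⊗[k] X _⦋1⦌) :
    z ∈ squareCycles X ↔ squareToKoszul X z ∈ koszulCycles (zeroBoundaries X) := by
  rw [koszulCycles, Submodule.mem_inf, and_iff_right (squareToKoszul_mem_tensorSpan X z)]
  have h := squareToKoszul_sub_mem X z
  refine ⟨fun hz => ?_, fun hz => ?_⟩
  · simpa using add_mem h (Submodule.mem_comap.1 hz)
  · simpa [squareCycles] using sub_mem hz h

/-- Write `∂ = face 0 - face 1`. The relation `a ⊗ b - b ⊗ a` goes to `∂a ⊗ ∂b - ∂b ⊗ ∂a`. By the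
simplicial identities, the boundary of `a ⊗ b` goes to minus the same expression for the edges `face
2 a` and `face 0 b`. -/
theorem squareToKoszul_mem_altSpan {z : X _⦋1⦌ ⊗[k] X _⦋1⦌} (hz : z ∈ squareBoundaries X) :
    squareToKoszul X z ∈ altSpan (zeroBoundaries X) (zeroBoundaries X) := by
  suffices h : squareBoundaries X ≤
      (altSpan (zeroBoundaries X) (zeroBoundaries X)).comap (squareToKoszul X) from h hz
  refine sup_le ?_ ?_
  · rw [symSquareRel_eq_altSpan, altSpan_le]
    intro a _ b _
    rw [Submodule.mem_comap, map_sub, squareToKoszul_tmul, squareToKoszul_tmul]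
    convert sub_mem_altSpan (face_sub_mem_zeroBoundaries X a) (face_sub_mem_zeroBoundaries X b)
      using 1
    simp only [TensorProduct.sub_tmul, TensorProduct.tmul_sub]
    abel
  · rintro _ ⟨t, rfl⟩
    rw [Submodule.mem_comap]
    induction t using TensorProduct.induction_on with
    | zero => rw [map_zero, map_zero]; exact zero_mem _
    | add a b ha hb => rw [map_add, map_add]; exact add_mem ha hb
    | tmul a b =>
      rw [squareBoundaryMap_tmul, map_add, map_sub, squareToKoszul_tmul, squareToKoszul_tmul,
        squareToKoszul_tmul]
      have h1 := face_sub_mem_zeroBoundaries X (face X (2 : Fin 3) a)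
      have h2 := face_sub_mem_zeroBoundaries X (face X (0 : Fin 3) b)
      have h := neg_mem (sub_mem_altSpan h1 h2)
      convert h using 1
      simp only [face_zero_face_one, face_zero_face_two, face_one_face_two,
        TensorProduct.sub_tmul, TensorProduct.tmul_sub]
      abel

variable {X}

/-- The linear section of `face 0` on boundaries with values in the kernel of `face 1`. -/
theorem exists_section (hX : ∀ e : X _⦋1⦌, face X (0 : Fin 2) e = 0 → face X (1 : Fin 2) e = 0 →
    e = 0) : ∃ σ : zeroBoundaries X →ₗ[k] X _⦋1⦌,
      (∀ i, face X (0 : Fin 2) (σ i) = i) ∧ (∀ i, face X (1 : Fin 2) (σ i) = 0) ∧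
      ∀ e h, σ ⟨face X (0 : Fin 2) e - face X (1 : Fin 2) e, h⟩ =
        e - degen X 0 (face X (1 : Fin 2) e) := by
  let f : LinearMap.ker (face X (1 : Fin 2)) →ₗ[k] zeroBoundaries X :=
    (face X (0 : Fin 2)).restrict (fun e he => ⟨e, he, rfl⟩)
  -- Injectivity is the absence of normalized one-cycles; surjectivity is the definition of
  -- `zeroBoundaries`.
  have hf : Function.Bijective f := by
    constructor
    · rw [← LinearMap.ker_eq_bot, LinearMap.ker_eq_bot']
      intro e he
      exact Subtype.ext (hX e (congrArg Subtype.val he) e.2)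
    · rintro ⟨_, e, he, rfl⟩
      exact ⟨⟨e, he⟩, rfl⟩
  have h0 : ∀ i, f ((LinearEquiv.ofBijective f hf).symm i) = i :=
    (LinearEquiv.ofBijective f hf).apply_symm_apply
  refine ⟨Submodule.subtype _ ∘ₗ (LinearEquiv.ofBijective f hf).symm.toLinearMap,
    fun i => congrArg Subtype.val (h0 i),
    fun i => ((LinearEquiv.ofBijective f hf).symm i).2, fun e h => ?_⟩
  have he : e - degen X 0 (face X (1 : Fin 2) e) ∈ LinearMap.ker (face X (1 : Fin 2)) := by
    rw [LinearMap.mem_ker, map_sub, face_one_degen, sub_self]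
  have h1 : f ⟨_, he⟩ = ⟨face X (0 : Fin 2) e - face X (1 : Fin 2) e, h⟩ := by
    apply Subtype.ext
    change face X (0 : Fin 2) (e - degen X 0 (face X (1 : Fin 2) e)) = _
    rw [map_sub, face_zero_degen]
  have h2 := (LinearEquiv.ofBijective f hf).symm_apply_apply ⟨_, he⟩
  exact congrArg Subtype.val ((congrArg _ h1.symm).trans h2)

/-- Let `I` be the submodule `zeroBoundaries X`. Flatness embeds `I ⊗ X₀` in `X₀ ⊗ X₀`, and `l = σ ⊗
degen` leads back to one-chains. Every chain agrees modulo boundaries with `l` of its Koszul image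
(`h1`), and `l` takes the alternating elements over `I` to boundaries (`h2`). -/
theorem mem_squareBoundaries [Module.Flat k (X _⦋0⦌)]
    (hX : ∀ e : X _⦋1⦌, face X (0 : Fin 2) e = 0 → face X (1 : Fin 2) e = 0 → e = 0)
    {z : X _⦋1⦌ ⊗[k] X _⦋1⦌}
    (hz : squareToKoszul X z ∈ altSpan (zeroBoundaries X) (zeroBoundaries X)) :
    z ∈ squareBoundaries X := by
  obtain ⟨σ, hσ0, hσ1, hσ⟩ := exists_section hX
  let j : zeroBoundaries X ⊗[k] X _⦋0⦌ →ₗ[k] X _⦋0⦌ ⊗[k] X _⦋0⦌ :=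
    (zeroBoundaries X).subtype.rTensor (X _⦋0⦌)
  have hj : Function.Injective j :=
    Module.Flat.rTensor_preserves_injective_linearMap _ (zeroBoundaries X).injective_subtype
  let l : zeroBoundaries X ⊗[k] X _⦋0⦌ →ₗ[k] X _⦋1⦌ ⊗[k] X _⦋1⦌ :=
    TensorProduct.map σ (degen X (0 : Fin 1))
  have h1 : ∀ z, ∃ w, j w = squareToKoszul X z ∧ z - l w ∈ squareBoundaries X := by
    intro z
    induction z using TensorProduct.induction_on with
    | zero => exact ⟨0, by simp, by simp⟩
    | add a b ha hb =>
      obtain ⟨v, hv, hv'⟩ := ha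
      obtain ⟨w, hw, hw'⟩ := hb
      refine ⟨v + w, by rw [map_add, map_add, hv, hw], ?_⟩
      rw [map_add, add_sub_add_comm]
      exact add_mem hv' hw'
    | tmul a b =>
      refine ⟨⟨_, face_sub_mem_zeroBoundaries X a⟩ ⊗ₜ face X (0 : Fin 2) b +
        ⟨_, face_sub_mem_zeroBoundaries X b⟩ ⊗ₜ face X (1 : Fin 2) a, ?_, ?_⟩
      · rw [squareToKoszul_tmul, map_add]
        rfl
      · rw [map_add]
        change _ - (σ _ ⊗ₜ _ + σ _ ⊗ₜ _) ∈ _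
        rw [hσ, hσ]
        -- The terms are an interchange of factors, the splitting of `a ⊗ b`, and two products of
        -- degenerate edges that complete `a` and `b` to their normalized parts.
        have h := add_mem (add_mem
          (sub_mem (tmul_sub_tmul_mem X (degen X 0 (face X (1 : Fin 2) a)) b)
            (tmul_sub_mem X a b))
          (degen_tmul_degen_mem X (face X (1 : Fin 2) a) (face X (0 : Fin 2) b)))
          (degen_tmul_degen_mem X (face X (1 : Fin 2) b) (face X (1 : Fin 2) a))
        convert h using 1
        simp only [TensorProduct.sub_tmul]
        abel
  have h2 : altSpan (zeroBoundaries X) (zeroBoundaries X) ≤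
      ((squareBoundaries X).comap l).map j :=
    altSpan_le.2 fun a ha b hb => by
      refine ⟨⟨a, ha⟩ ⊗ₜ b - ⟨b, hb⟩ ⊗ₜ a, ?_, by rw [map_sub]; rfl⟩
      rw [SetLike.mem_coe, Submodule.mem_comap, map_sub]
      -- Since `face 1 ∘ σ = 0`, the splitting identifies `σ a ⊗ degen b` with `σ a ⊗ σ b` modulo
      -- boundaries, and the latter is symmetric in `a` and `b`.
      have ha' := tmul_sub_mem X (σ ⟨a, ha⟩) (σ ⟨b, hb⟩)
      have hb' := tmul_sub_mem X (σ ⟨b, hb⟩) (σ ⟨a, ha⟩)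
      rw [hσ0, hσ1, map_zero, TensorProduct.zero_tmul, add_zero] at ha' hb'
      have h := add_mem (sub_mem ha' hb') (tmul_sub_tmul_mem X (σ ⟨a, ha⟩) (σ ⟨b, hb⟩))
      convert h using 1
      change σ ⟨a, ha⟩ ⊗ₜ _ - σ ⟨b, hb⟩ ⊗ₜ _ = _
      abel
  obtain ⟨w, hw, hw'⟩ := h1 z
  obtain ⟨v, hv, hv'⟩ := h2 hz
  obtain rfl : v = w := hj (hv'.trans hw.symm)
  simpa using add_mem hw' hv

theorem exists_squareToKoszul_eq {t : X _⦋0⦌ ⊗[k] X _⦋0⦌}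
    (ht : t ∈ tensorSpan (zeroBoundaries X) ⊤) : ∃ z, squareToKoszul X z = t := by
  have h : tensorSpan (zeroBoundaries X) ⊤ ≤ LinearMap.range (squareToKoszul X) := by
    rw [tensorSpan_le]
    rintro _ ⟨e, he, rfl⟩ b _
    refine ⟨e ⊗ₜ degen X 0 b, ?_⟩
    rw [squareToKoszul_tmul, face_zero_degen, face_one_degen, LinearMap.mem_ker.1 he, sub_zero,
      TensorProduct.tmul_zero, add_zero]
  exact h ht

variable (X)

/-- The comparison map from one-cycles of `SP² X` to Koszul homology. -/
def squareCyclesToKoszul : squareCycles X →ₗ[k] KoszulHomology (zeroBoundaries X) :=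
  Submodule.mkQ _ ∘ₗ (squareToKoszul X).restrict (fun z hz => (mem_squareCycles_iff X z).1 hz)

theorem squareCyclesToKoszul_apply (z : squareCycles X) : squareCyclesToKoszul X z =
    koszulClass (squareToKoszul X z) ((mem_squareCycles_iff X z).1 z.2) :=
  rfl

theorem squareCyclesToKoszul_surjective : Function.Surjective (squareCyclesToKoszul X) := by
  intro x
  obtain ⟨t, ht, rfl⟩ := koszulClass_surjective x
  obtain ⟨z, rfl⟩ := exists_squareToKoszul_eq ht.1
  exact ⟨⟨z, (mem_squareCycles_iff X z).2 ht⟩, rfl⟩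

theorem ker_squareCyclesToKoszul [Module.Flat k (X _⦋0⦌)]
    (hX : ∀ e : X _⦋1⦌, face X (0 : Fin 2) e = 0 → face X (1 : Fin 2) e = 0 → e = 0) :
    LinearMap.ker (squareCyclesToKoszul X) =
      (squareBoundaries X).comap (squareCycles X).subtype := by
  ext z
  rw [LinearMap.mem_ker, squareCyclesToKoszul_apply, koszulClass_eq_zero_iff]
  exact ⟨fun h => mem_squareBoundaries hX h, fun h => squareToKoszul_mem_altSpan X h⟩

end SimplicialModule

/-! ### Homology of short complexes of modules by elements -/

section ModuleHomology

variable {k : Type} [CommRing k]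

/-- The isomorphism from the kernel to the abstract cycles, for a short complex of modules. -/
def kerIsoCycles (S : ShortComplex (ModuleCat.{u} k)) :
    ModuleCat.of k (LinearMap.ker S.g.hom) ≅ S.cycles :=
  S.moduleCatCyclesIso.symm

theorem kerIsoCycles_hom_iCycles (S : ShortComplex (ModuleCat.{u} k)) :
    (kerIsoCycles S).hom ≫ S.iCycles = ModuleCat.ofHom (LinearMap.ker S.g.hom).subtype :=
  S.moduleCatCyclesIso_inv_iCycles

/-- The projection from the kernel to homology, for a short complex of modules. -/
def homologyProj (S : ShortComplex (ModuleCat.{u} k)) : LinearMap.ker S.g.hom →ₗ[k] S.homology :=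
  ((kerIsoCycles S).hom ≫ S.homologyπ).hom

theorem homologyProj_surjective (S : ShortComplex (ModuleCat.{u} k)) :
    Function.Surjective (homologyProj S) :=
  (ModuleCat.epi_iff_surjective ((kerIsoCycles S).hom ≫ S.homologyπ)).1 inferInstance

theorem homologyProj_eq_zero_iff (S : ShortComplex (ModuleCat.{u} k)) (z : LinearMap.ker S.g.hom) :
    homologyProj S z = 0 ↔ z.1 ∈ LinearMap.range S.f.hom := by
  have h : homologyProj S z = S.moduleCatHomologyIso.inv.hom (Submodule.Quotient.mk z) :=
    LinearMap.congr_fun (congrArg ModuleCat.Hom.hom S.moduleCatCyclesIso_inv_π) z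
  have h1 : Function.Injective S.moduleCatHomologyIso.inv.hom :=
    (ModuleCat.mono_iff_injective _).1 inferInstance
  rw [h]
  refine ((map_eq_zero_iff _ h1).trans (Submodule.Quotient.mk_eq_zero _)).trans ?_
  exact ⟨fun ⟨x, hx⟩ => ⟨x, congrArg Subtype.val hx⟩, fun ⟨x, hx⟩ => ⟨x, Subtype.ext hx⟩⟩

theorem map_mem_ker {S T : ShortComplex (ModuleCat.{u} k)} (φ : S ⟶ T) {z : S.X₂}
    (hz : z ∈ LinearMap.ker S.g.hom) : φ.τ₂.hom z ∈ LinearMap.ker T.g.hom := by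
  have h := LinearMap.congr_fun (congrArg ModuleCat.Hom.hom φ.comm₂₃) z
  rw [LinearMap.mem_ker] at hz ⊢
  refine h.trans ?_
  change φ.τ₃.hom (S.g.hom z) = 0
  rw [hz, map_zero]

theorem homologyMap_homologyProj {S T : ShortComplex (ModuleCat.{u} k)} (φ : S ⟶ T)
    (z : LinearMap.ker S.g.hom) :
    (ShortComplex.homologyMap φ).hom (homologyProj S z) =
      homologyProj T ⟨φ.τ₂.hom z, map_mem_ker φ z.2⟩ := by
  have h : ModuleCat.ofHom (φ.τ₂.hom.restrict (fun _ hz => map_mem_ker φ hz)) ≫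
      (kerIsoCycles T).hom = (kerIsoCycles S).hom ≫ ShortComplex.cyclesMap φ := by
    rw [← cancel_mono T.iCycles, Category.assoc, Category.assoc, ShortComplex.cyclesMap_i,
      kerIsoCycles_hom_iCycles, reassoc_of% kerIsoCycles_hom_iCycles]
    rfl
  have h2 : ((kerIsoCycles S).hom ≫ S.homologyπ) ≫ ShortComplex.homologyMap φ =
      ModuleCat.ofHom (φ.τ₂.hom.restrict (fun _ hz => map_mem_ker φ hz)) ≫
        (kerIsoCycles T).hom ≫ T.homologyπ := by
    rw [reassoc_of% h, Category.assoc, ShortComplex.homologyπ_naturality]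
  exact LinearMap.congr_fun (congrArg ModuleCat.Hom.hom h2) z

end ModuleHomology

/-! ### The first homology of `SP² X` as Koszul homology -/

section SymmetricSquareHomology

open scoped Simplicial

variable {k : Type} [CommRing k]

/-- The homology in degree one of the chain complex of `SP² X`, as a functor of the simplicial
module `X`. -/
abbrev squareHomology : SimplicialObject (ModuleCat.{u} k) ⥤ ModuleCat.{u} k :=
  (SimplicialObject.whiskering _ _).obj (symSquare k) ⋙
    AlgebraicTopology.alternatingFaceMapComplex (ModuleCat.{u} k) ⋙
    HomologicalComplex.homologyFunctor (ModuleCat.{u} k) (ComplexShape.down ℕ) 1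

/-- The part of the chain complex of `SP² X` around degree one. -/
abbrev squareShortComplex : SimplicialObject (ModuleCat.{u} k) ⥤ ShortComplex (ModuleCat.{u} k) :=
  (SimplicialObject.whiskering _ _).obj (symSquare k) ⋙
    AlgebraicTopology.alternatingFaceMapComplex (ModuleCat.{u} k) ⋙
    HomologicalComplex.shortComplexFunctor' _ _ 2 1 0

variable (k) in
/-- `squareHomology` is the homology of `squareShortComplex`. -/
def squareHomologyIso : squareHomology.{u} (k := k) ≅
    squareShortComplex ⋙ ShortComplex.homologyFunctor (ModuleCat.{u} k) :=
  Functor.isoWhiskerLeft ((SimplicialObject.whiskering _ _).obj (symSquare k))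
    (Functor.isoWhiskerLeft (AlgebraicTopology.alternatingFaceMapComplex (ModuleCat.{u} k))
      (HomologicalComplex.homologyFunctorIso' _ _ 2 1 0 (by simp) (by simp)))

theorem alternatingSum_two {A : Type*} [AddCommGroup A] (f : Fin 2 → A) :
    ∑ i : Fin 2, (-1 : ℤ) ^ (i : ℕ) • f i = f 0 - f 1 := by
  simp [Fin.sum_univ_two, sub_eq_add_neg]

theorem alternatingSum_three {A : Type*} [AddCommGroup A] (f : Fin 3 → A) :
    ∑ i : Fin 3, (-1 : ℤ) ^ (i : ℕ) • f i = f 0 - f 1 + f 2 := by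
  simp [Fin.sum_univ_three, sub_eq_add_neg]

variable (X : SimplicialObject (ModuleCat.{u} k))

theorem squareShortComplex_g (z : X _⦋1⦌ ⊗[k] X _⦋1⦌) :
    (squareShortComplex.obj X).g.hom (Submodule.Quotient.mk z) =
      Submodule.Quotient.mk (squareDifference X z) := by
  have h : (squareShortComplex.obj X).g =
      (symSquare k).map (X.δ (0 : Fin 2)) - (symSquare k).map (X.δ (1 : Fin 2)) := by
    change (((AlgebraicTopology.alternatingFaceMapComplex (ModuleCat.{u} k)).obj
      (((SimplicialObject.whiskering _ _).obj (symSquare k)).obj X))).d (0 + 1) 0 = _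
    rw [AlgebraicTopology.alternatingFaceMapComplex_obj_d]
    exact alternatingSum_two (fun i => (symSquare k).map (X.δ i))
  rw [h]
  rfl

theorem squareShortComplex_f (z : X _⦋2⦌ ⊗[k] X _⦋2⦌) :
    (squareShortComplex.obj X).f.hom (Submodule.Quotient.mk z) =
      Submodule.Quotient.mk (squareBoundaryMap X z) := by
  have h : (squareShortComplex.obj X).f =
      (symSquare k).map (X.δ (0 : Fin 3)) - (symSquare k).map (X.δ (1 : Fin 3)) +
        (symSquare k).map (X.δ (2 : Fin 3)) := by
    change (((AlgebraicTopology.alternatingFaceMapComplex (ModuleCat.{u} k)).obj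
      (((SimplicialObject.whiskering _ _).obj (symSquare k)).obj X))).d (1 + 1) 1 = _
    rw [AlgebraicTopology.alternatingFaceMapComplex_obj_d]
    exact alternatingSum_three (fun i => (symSquare k).map (X.δ i))
  rw [h]
  rfl

/-- The class in `SP² X₁` of a one-cycle. -/
def squareCyclesMk : squareCycles X →ₗ[k] LinearMap.ker (squareShortComplex.obj X).g.hom :=
  (Submodule.mkQ (symSquareRel k (X _⦋1⦌))).restrict (fun z hz => by
    change (squareShortComplex.obj X).g.hom (Submodule.Quotient.mk z) = 0
    refine (squareShortComplex_g X z).trans ?_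
    exact (Submodule.Quotient.mk_eq_zero _).2 hz)

theorem squareCyclesMk_surjective : Function.Surjective (squareCyclesMk X) := by
  rintro ⟨y, hy⟩
  obtain ⟨z, rfl⟩ := Submodule.Quotient.mk_surjective _ y
  refine ⟨⟨z, ?_⟩, rfl⟩
  exact (Submodule.Quotient.mk_eq_zero (symSquareRel k (X _⦋0⦌))).1
    ((squareShortComplex_g X z).symm.trans (LinearMap.mem_ker.1 hy))

/-- The homology class of a one-cycle of `SP² X`. -/
def squareHomologyProj : squareCycles X →ₗ[k] squareHomology.obj X :=
  ((squareHomologyIso k).app X).toLinearEquiv.symm.toLinearMap ∘ₗ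
    homologyProj (squareShortComplex.obj X) ∘ₗ squareCyclesMk X

theorem squareHomologyProj_surjective : Function.Surjective (squareHomologyProj X) :=
  ((squareHomologyIso k).app X).toLinearEquiv.symm.surjective.comp
    ((homologyProj_surjective _).comp (squareCyclesMk_surjective X))

theorem ker_squareHomologyProj : LinearMap.ker (squareHomologyProj X) =
    (squareBoundaries X).comap (squareCycles X).subtype := by
  ext z
  rw [LinearMap.mem_ker, Submodule.mem_comap]
  refine ((squareHomologyIso k).app X).toLinearEquiv.symm.map_eq_zero_iff.trans ?_
  refine (homologyProj_eq_zero_iff _ _).trans ?_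
  rw [squareBoundaries]
  constructor
  · rintro ⟨y, hy⟩
    obtain ⟨t, rfl⟩ := Submodule.Quotient.mk_surjective _ y
    have h := (squareShortComplex_f X t).symm.trans hy
    have h2 := (Submodule.Quotient.eq _).1 h.symm
    have h3 := add_mem (Submodule.mem_sup_left h2)
      (Submodule.mem_sup_right (S := symSquareRel k (X _⦋1⦌))
        (LinearMap.mem_range_self (squareBoundaryMap X) t))
    rwa [sub_add_cancel] at h3
  · intro h
    obtain ⟨y, hy, _, ⟨t, rfl⟩, h2⟩ := Submodule.mem_sup.1 h
    refine ⟨Submodule.Quotient.mk t, (squareShortComplex_f X t).trans ?_⟩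
    refine ((Submodule.Quotient.eq _).2 ?_).symm
    change z.1 - _ ∈ _
    change _ = z.1 at h2
    rwa [← h2, add_sub_cancel_right]

/-- The first homology of `SP² X`, for a simplicial module `X` with flat `X₀` whose normalized
complex vanishes above degree one in the weak sense that it has no one-cycles. -/
def squareHomologyEquiv [Module.Flat k (X _⦋0⦌)]
    (hX : ∀ e : X _⦋1⦌, face X (0 : Fin 2) e = 0 → face X (1 : Fin 2) e = 0 → e = 0) :
    squareHomology.obj X ≃ₗ[k] KoszulHomology (zeroBoundaries X) :=
  (LinearMap.quotKerEquivOfSurjective _ (squareHomologyProj_surjective X)).symm ≪≫ₗ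
    Submodule.quotEquivOfEq _ _
      ((ker_squareHomologyProj X).trans (ker_squareCyclesToKoszul X hX).symm) ≪≫ₗ
    LinearMap.quotKerEquivOfSurjective _ (squareCyclesToKoszul_surjective X)

/-- This describes the equivalence on representing cycles, which reduces its naturality to that of
`squareToKoszul`. -/
theorem squareHomologyEquiv_proj [Module.Flat k (X _⦋0⦌)]
    (hX : ∀ e : X _⦋1⦌, face X (0 : Fin 2) e = 0 → face X (1 : Fin 2) e = 0 → e = 0)
    (z : squareCycles X) :
    squareHomologyEquiv X hX (squareHomologyProj X z) = squareCyclesToKoszul X z := by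
  have h : (LinearMap.quotKerEquivOfSurjective _ (squareHomologyProj_surjective X)).symm
      (squareHomologyProj X z) = Submodule.Quotient.mk z := by
    rw [LinearEquiv.symm_apply_eq]
    rfl
  exact congrArg (fun y => LinearMap.quotKerEquivOfSurjective _
    (squareCyclesToKoszul_surjective X) (Submodule.quotEquivOfEq _ _
      ((ker_squareHomologyProj X).trans (ker_squareCyclesToKoszul X hX).symm) y)) h

end SymmetricSquareHomology

/-! ### Naturality in the simplicial module -/

section SymmetricSquareHomologyNaturality

open scoped Simplicial

variable {k : Type} [CommRing k] {X Y : SimplicialObject (ModuleCat.{u} k)} (φ : X ⟶ Y)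

/-- The components of a map of simplicial modules, as linear maps. -/
abbrev levelMap (n : ℕ) : X _⦋n⦌ →ₗ[k] Y _⦋n⦌ :=
  (φ.app (Opposite.op ⦋n⦌)).hom

theorem face_levelMap {n : ℕ} (i : Fin (n + 2)) (x : X _⦋n + 1⦌) :
    face Y i (levelMap φ (n + 1) x) = levelMap φ n (face X i x) :=
  (LinearMap.congr_fun (congrArg ModuleCat.Hom.hom (φ.naturality (SimplexCategory.δ i).op)) x).symm

theorem levelMap_mem_zeroBoundaries {x : X _⦋0⦌} (hx : x ∈ zeroBoundaries X) :
    levelMap φ 0 x ∈ zeroBoundaries Y := by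
  obtain ⟨e, he, rfl⟩ := hx
  refine ⟨levelMap φ 1 e, ?_, face_levelMap φ 0 e⟩
  rw [SetLike.mem_coe, LinearMap.mem_ker, face_levelMap, LinearMap.mem_ker.1 he, map_zero]

theorem squareToKoszul_map (z : X _⦋1⦌ ⊗[k] X _⦋1⦌) :
    squareToKoszul Y (TensorProduct.map (levelMap φ 1) (levelMap φ 1) z) =
      TensorProduct.map (levelMap φ 0) (levelMap φ 0) (squareToKoszul X z) := by
  induction z using TensorProduct.induction_on with
  | zero => simp only [map_zero]
  | add a b ha hb => simp only [map_add, ha, hb]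
  | tmul a b =>
    simp only [TensorProduct.map_tmul, squareToKoszul_tmul, face_levelMap, map_add, map_sub]

theorem map_mem_squareCycles {z : X _⦋1⦌ ⊗[k] X _⦋1⦌} (hz : z ∈ squareCycles X) :
    TensorProduct.map (levelMap φ 1) (levelMap φ 1) z ∈ squareCycles Y := by
  rw [mem_squareCycles_iff] at hz ⊢
  rw [squareToKoszul_map]
  exact map_mem_koszulCycles (fun _ hx => levelMap_mem_zeroBoundaries φ hx) hz

theorem squareHomology_map_proj (z : squareCycles X) :
    (squareHomology.map φ).hom (squareHomologyProj X z) =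
      squareHomologyProj Y ⟨_, map_mem_squareCycles φ z.2⟩ := by
  have h := LinearMap.congr_fun
    (congrArg ModuleCat.Hom.hom ((squareHomologyIso k).inv.naturality φ))
    (homologyProj _ (squareCyclesMk X z))
  refine h.symm.trans ?_
  exact congrArg ((squareHomologyIso k).inv.app Y).hom
    (homologyMap_homologyProj (squareShortComplex.map φ) (squareCyclesMk X z))

theorem squareHomologyEquiv_naturality [Module.Flat k (X _⦋0⦌)] [Module.Flat k (Y _⦋0⦌)]
    (hX : ∀ e : X _⦋1⦌, face X (0 : Fin 2) e = 0 → face X (1 : Fin 2) e = 0 → e = 0)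
    (hY : ∀ e : Y _⦋1⦌, face Y (0 : Fin 2) e = 0 → face Y (1 : Fin 2) e = 0 → e = 0)
    (x : squareHomology.obj X) :
    squareHomologyEquiv Y hY ((squareHomology.map φ).hom x) =
      koszulMap (levelMap φ 0) (fun _ hx => levelMap_mem_zeroBoundaries φ hx)
        (squareHomologyEquiv X hX x) := by
  obtain ⟨z, rfl⟩ := squareHomologyProj_surjective X x
  rw [squareHomology_map_proj, squareHomologyEquiv_proj, squareHomologyEquiv_proj,
    squareCyclesToKoszul_apply, squareCyclesToKoszul_apply, koszulMap_class, koszulClass_eq_iff,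
    squareToKoszul_map, sub_self]
  exact zero_mem _

end SymmetricSquareHomologyNaturality

/-! ### The normalized Moore complex in degrees zero and one -/

section MooreComplex

open scoped Simplicial
open AlgebraicTopology

variable {k : Type} [CommRing k]

/-- The normalized Moore complex of a simplicial module agrees with it in degree zero. -/
def mooreZeroIso (X : SimplicialObject (ModuleCat.{u} k)) :
    ((normalizedMooreComplex _).obj X).X 0 ≅ X _⦋0⦌ :=
  (asIso (⊤ : Subobject (X _⦋0⦌)).arrow :)

/-- The inclusion of the normalized Moore complex in degree one. -/
def mooreOneArrow (X : SimplicialObject (ModuleCat.{u} k)) :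
    ((normalizedMooreComplex _).obj X).X 1 ⟶ X _⦋1⦌ :=
  (NormalizedMooreComplex.objX X 1).arrow

theorem mooreOneArrow_face (X : SimplicialObject (ModuleCat.{u} k)) :
    mooreOneArrow X ≫ X.δ (1 : Fin 2) = 0 := by
  have h : (Limits.kernelSubobject (X.δ (0 : Fin 1).succ)).Factors (mooreOneArrow X) :=
    Subobject.finset_inf_arrow_factors Finset.univ
      (fun i : Fin 1 => Limits.kernelSubobject (X.δ i.succ)) 0 (Finset.mem_univ _)
  exact (Limits.kernelSubobject_factors_iff _ _).1 h

/-- In degree one the intersection defining the Moore complex has the single member `ker (face 1)`.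
-/
theorem exists_mooreOneArrow_eq (X : SimplicialObject (ModuleCat.{u} k)) {e : X _⦋1⦌}
    (he : face X (1 : Fin 2) e = 0) : ∃ n, (mooreOneArrow X).hom n = e := by
  let f : ModuleCat.of k (LinearMap.ker (face X (1 : Fin 2))) ⟶ X _⦋1⦌ :=
    ModuleCat.ofHom (Submodule.subtype _)
  have hf : (NormalizedMooreComplex.objX X 1).Factors f := by
    refine (Subobject.finset_inf_factors _).2 fun (i : Fin 1) _ => ?_
    obtain rfl : i = 0 := Subsingleton.elim _ _
    refine Limits.kernelSubobject_factors _ _ ?_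
    ext x
    exact x.2
  exact ⟨(Subobject.factorThru _ f hf).hom ⟨e, he⟩,
    LinearMap.congr_fun (congrArg ModuleCat.Hom.hom (Subobject.factorThru_arrow _ f hf)) ⟨e, he⟩⟩

theorem moore_d_comp (X : SimplicialObject (ModuleCat.{u} k)) :
    ((normalizedMooreComplex _).obj X).d 1 0 ≫ (mooreZeroIso X).hom =
      mooreOneArrow X ≫ X.δ (0 : Fin 2) := by
  rw [normalizedMooreComplex_objD X 0]
  have h : ((NormalizedMooreComplex.objX X 1).arrow ≫ X.δ (0 : Fin 2) ≫
      inv (⊤ : Subobject (X _⦋0⦌)).arrow) ≫ (⊤ : Subobject (X _⦋0⦌)).arrow =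
        (NormalizedMooreComplex.objX X 1).arrow ≫ X.δ (0 : Fin 2) := by
    rw [Category.assoc, Category.assoc, IsIso.inv_hom_id, Category.comp_id]
  exact h

theorem mooreZeroIso_naturality {X Y : SimplicialObject (ModuleCat.{u} k)} (φ : X ⟶ Y) :
    ((normalizedMooreComplex _).map φ).f 0 ≫ (mooreZeroIso Y).hom =
      (mooreZeroIso X).hom ≫ φ.app (Opposite.op ⦋0⦌) :=
  Subobject.factorThru_arrow _ _ (Subobject.top_factors _)

end MooreComplex

section KoszulEquivOfEq

variable {k : Type} [CommRing k] {M : Type*} [AddCommGroup M] [Module k M]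

/-- Equal submodules have the same Koszul homology. -/
def koszulEquivOfEq {I J : Submodule k M} (h : I = J) : KoszulHomology I ≃ₗ[k] KoszulHomology J :=
  LinearEquiv.ofLinearMap (koszulMap LinearMap.id (fun _ hx => h.le hx))
    (koszulMap LinearMap.id (fun _ hx => h.ge hx))
    (LinearMap.ext fun x => (koszulMap_comp _ _ _ _ x).trans (koszulMap_id _ x))
    (LinearMap.ext fun x => (koszulMap_comp _ _ _ _ x).trans (koszulMap_id _ x))

theorem koszulEquivOfEq_apply {I J : Submodule k M} (h : I = J) (x : KoszulHomology I) :
    koszulEquivOfEq h x = koszulMap LinearMap.id (fun _ hx => h.le hx) x :=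
  rfl

end KoszulEquivOfEq

/-! ### The Dold-Kan simplicial resolution and the derived functor -/

section SimplicialResolution

open scoped Simplicial
open AlgebraicTopology

variable (k : Type) [CommRing k]

theorem freeCover_surjective (C : ModuleCat.{u} k) : Function.Surjective (freeCover k C) :=
  fun c => ⟨Finsupp.single c 1, by simp [freeCover]⟩

variable [IsDomain k] [IsPrincipalIdealRing k]

/-- The simplicial module belonging to the canonical free resolution. -/
abbrev simplicialRes : ModuleCat.{u} k ⥤ SimplicialObject (ModuleCat.{u} k) :=
  freeRes k ⋙ Abelian.DoldKan.equivalence.inverse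

/-- The normalized complex of the simplicial resolution is the canonical free resolution. -/
def mooreSimplicialRes (C : ModuleCat.{u} k) :
    (normalizedMooreComplex _).obj ((simplicialRes k).obj C) ≅ (freeRes k).obj C :=
  Abelian.DoldKan.equivalence.counitIso.app ((freeRes k).obj C)

theorem mooreSimplicialRes_naturality {C D : ModuleCat.{u} k} (f : C ⟶ D) :
    (normalizedMooreComplex _).map ((simplicialRes k).map f) ≫ (mooreSimplicialRes k D).hom =
      (mooreSimplicialRes k C).hom ≫ (freeRes k).map f :=
  Abelian.DoldKan.equivalence.counitIso.hom.naturality ((freeRes k).map f)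

/-- The degree zero part of the simplicial resolution is the free module `k[C]`. -/
def simplicialResZero (C : ModuleCat.{u} k) :
    ((simplicialRes k).obj C) _⦋0⦌ ≅ ModuleCat.of k (C →₀ k) :=
  (mooreZeroIso _).symm ≪≫ (HomologicalComplex.eval _ _ 0).mapIso (mooreSimplicialRes k C)

theorem mooreZeroIso_hom_simplicialResZero_hom (C : ModuleCat.{u} k) :
    (mooreZeroIso ((simplicialRes k).obj C)).hom ≫ (simplicialResZero k C).hom =
      (mooreSimplicialRes k C).hom.f 0 :=
  Iso.hom_inv_id_assoc _ _

instance (C : ModuleCat.{u} k) : Module.Free k (((simplicialRes k).obj C) _⦋0⦌) :=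
  Module.Free.of_equiv (simplicialResZero k C).toLinearEquiv.symm

/-- The augmentation of the simplicial resolution. -/
def simplicialResAug (C : ModuleCat.{u} k) : ((simplicialRes k).obj C) _⦋0⦌ →ₗ[k] C :=
  freeCover k C ∘ₗ (simplicialResZero k C).toLinearEquiv.toLinearMap

theorem simplicialResAug_surjective (C : ModuleCat.{u} k) :
    Function.Surjective (simplicialResAug k C) :=
  (freeCover_surjective k C).comp (simplicialResZero k C).toLinearEquiv.surjective

theorem simplicialResAug_naturality {C D : ModuleCat.{u} k} (f : C ⟶ D)
    (x : ((simplicialRes k).obj C) _⦋0⦌) :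
    simplicialResAug k D (levelMap ((simplicialRes k).map f) 0 x) =
      f.hom (simplicialResAug k C x) := by
  have h : ((simplicialRes k).map f).app (Opposite.op ⦋0⦌) ≫ (simplicialResZero k D).hom =
      (simplicialResZero k C).hom ≫ ModuleCat.ofHom (Finsupp.lmapDomain k k f.hom) := by
    have h1 := congrArg (fun g => g.f 0) (mooreSimplicialRes_naturality k f)
    have h2 := mooreZeroIso_naturality ((simplicialRes k).map f)
    rw [← cancel_epi (mooreZeroIso ((simplicialRes k).obj C)).hom, ← Category.assoc, ← h2,
      Category.assoc, mooreZeroIso_hom_simplicialResZero_hom, ← Category.assoc,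
      mooreZeroIso_hom_simplicialResZero_hom]
    exact h1
  have h1 := LinearMap.congr_fun (congrArg ModuleCat.Hom.hom h) x
  exact (congrArg (freeCover k D) h1).trans (freeCover_natural f.hom _)

/-- An edge of the simplicial resolution over the basepoint, as a relation. -/
theorem exists_relation (C : ModuleCat.{u} k) :
    ∃ r : ((normalizedMooreComplex _).obj ((simplicialRes k).obj C)).X 1 ≃ₗ[k]
      LinearMap.ker (freeCover k C), ∀ n, (simplicialResZero k C).hom.hom
        (face ((simplicialRes k).obj C) (0 : Fin 2) ((mooreOneArrow _).hom n)) = r n := by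
  refine ⟨((HomologicalComplex.eval _ _ 1).mapIso (mooreSimplicialRes k C)).toLinearEquiv,
    fun n => ?_⟩
  have h : mooreOneArrow ((simplicialRes k).obj C) ≫ SimplicialObject.δ _ (0 : Fin 2) ≫
      (simplicialResZero k C).hom = (mooreSimplicialRes k C).hom.f 1 ≫ freeResD k C 0 := by
    have h1 := (mooreSimplicialRes k C).hom.comm 1 0
    have h2 : ((freeRes k).obj C).d 1 0 = freeResD k C 0 :=
      ChainComplex.of_d (freeResX k C) (freeResD k C) 0
    rw [h2] at h1
    refine Eq.trans ?_ h1.symm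
    rw [← reassoc_of% moore_d_comp, mooreZeroIso_hom_simplicialResZero_hom]
    rfl
  exact LinearMap.congr_fun (congrArg ModuleCat.Hom.hom h) n

/-- An edge with vanishing `face 1` comes from the normalized complex. There `face 0` corresponds to
the inclusion of `ker (freeCover k C)`, which is injective. -/
theorem simplicialRes_eq_zero (C : ModuleCat.{u} k) (e : ((simplicialRes k).obj C) _⦋1⦌)
    (h0 : face _ (0 : Fin 2) e = 0) (h1 : face _ (1 : Fin 2) e = 0) : e = 0 := by
  obtain ⟨n, rfl⟩ := exists_mooreOneArrow_eq _ h1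
  obtain ⟨r, hr⟩ := exists_relation k C
  have h : r n = 0 := by
    apply Subtype.ext
    rw [← hr, h0, map_zero]
    rfl
  rw [r.map_eq_zero_iff.1 h, map_zero]

/-- The normalized edges correspond to all the relations in `ker (freeCover k C)`, so their
boundaries fill the kernel of the augmentation. -/
theorem zeroBoundaries_simplicialRes (C : ModuleCat.{u} k) :
    zeroBoundaries ((simplicialRes k).obj C) = LinearMap.ker (simplicialResAug k C) := by
  obtain ⟨r, hr⟩ := exists_relation k C
  ext x
  constructor
  · rintro ⟨e, he, rfl⟩
    obtain ⟨n, rfl⟩ := exists_mooreOneArrow_eq _ (LinearMap.mem_ker.1 he)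
    exact (congrArg (freeCover k C) (hr n)).trans (r n).2
  · intro hx
    refine ⟨(mooreOneArrow _).hom (r.symm ⟨(simplicialResZero k C).hom.hom x, hx⟩),
      LinearMap.congr_fun (congrArg ModuleCat.Hom.hom (mooreOneArrow_face _)) _, ?_⟩
    refine (simplicialResZero k C).toLinearEquiv.injective ((hr _).trans ?_)
    rw [LinearEquiv.apply_symm_apply]
    rfl

/-- The first derived functor of the symmetric square, computed by the Koszul complex of the
simplicial resolution. -/
def doldPuppeEquiv (C : ModuleCat.{u} k) :
    (doldPuppe k (symSquare k) 1).obj C ≃ₗ[k]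
      KoszulHomology (LinearMap.ker (simplicialResAug k C)) :=
  (squareHomologyEquiv ((simplicialRes k).obj C) (simplicialRes_eq_zero k C)).trans
    (koszulEquivOfEq (zeroBoundaries_simplicialRes k C))

theorem doldPuppeEquiv_naturality {C D : ModuleCat.{u} k} (f : C ⟶ D)
    (x : (doldPuppe k (symSquare k) 1).obj C) :
    doldPuppeEquiv k D (((doldPuppe k (symSquare k) 1).map f).hom x) =
      koszulMap (levelMap ((simplicialRes k).map f) 0)
        (mem_ker_of_lift (simplicialResAug_naturality k f)) (doldPuppeEquiv k C x) := by
  have h := squareHomologyEquiv_naturality ((simplicialRes k).map f) (simplicialRes_eq_zero k C)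
    (simplicialRes_eq_zero k D) x
  refine (congrArg (koszulEquivOfEq (zeroBoundaries_simplicialRes k D)) h).trans ?_
  rw [koszulEquivOfEq_apply, koszulMap_comp]
  refine Eq.trans ?_ (koszulMap_comp _ _ _ _ _).symm
  rfl

end SimplicialResolution

/-! ### The isomorphism and its naturality -/

section DimensionQuotientIso

/-- The isomorphism from the dimension quotient to the derived functor of the symmetric square. -/
def dimQuotIso (F : Type u) [Group F] [IsFreeGroup F] (R S : Subgroup F) [R.Normal] [S.Normal] :
    DimQuot R S ≃* Multiplicative (L1SP2.{u}.obj (midObj R S)) :=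
  (dimQuotEquiv R S).trans (AddEquiv.toMultiplicative
    ((presentationEquiv (midProj R S) (simplicialResAug ℤ (midObj R S)) (midProj_surjective R S)
      (simplicialResAug_surjective ℤ _)).trans (doldPuppeEquiv ℤ (midObj R S)).symm).toAddEquiv)

theorem doldPuppeEquiv_dimQuotIso (F : Type u) [Group F] [IsFreeGroup F] (R S : Subgroup F)
    [R.Normal] [S.Normal] (x : DimQuot R S) :
    doldPuppeEquiv ℤ (midObj R S) (dimQuotIso F R S x).toAdd =
      presentationEquiv (midProj R S) (simplicialResAug ℤ (midObj R S)) (midProj_surjective R S)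
        (simplicialResAug_surjective ℤ _) (dimQuotEquiv R S x).toAdd :=
  (doldPuppeEquiv ℤ (midObj R S)).apply_symm_apply _

end DimensionQuotientIso

end

theorem theorem1 :
    (∀ (F : Type u) [Group F] [IsFreeGroup F] (R S : Subgroup F) [R.Normal] [S.Normal],
      commSubgroup R S ≤ dimSubgroup R S) ∧
    ∃ e : ∀ (F : Type u) [Group F] [IsFreeGroup F] (R S : Subgroup F) [R.Normal] [S.Normal],
        DimQuot R S ≃* Multiplicative (L1SP2.{u}.obj (midObj R S)),
      ∀ (F F₁ : Type u) [Group F] [IsFreeGroup F] [Group F₁] [IsFreeGroup F₁]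
        (R S : Subgroup F) [R.Normal] [S.Normal] (R₁ S₁ : Subgroup F₁) [R₁.Normal] [S₁.Normal]
        (φ : F →* F₁) (hR : R ≤ R₁.comap φ) (hS : S ≤ S₁.comap φ) (x : DimQuot R S),
        (e F₁ R₁ S₁ (dimQuotMap φ hR hS x)).toAdd =
          (L1SP2.{u}.map (midObjMap φ hR hS)).hom (e F R S x).toAdd := by
  refine ⟨fun F _ _ R S _ _ => commSubgroup_le_dimSubgroup, dimQuotIso, ?_⟩
  intro F F₁ _ _ _ _ R S _ _ R₁ S₁ _ _ φ hR hS x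
  -- After this identification both sides are maps on Koszul homology induced by lifts of the same
  -- map of the quotients `(R ∩ S) / ((R' ∩ S)(R ∩ S'))`.
  apply (doldPuppeEquiv ℤ (midObj R₁ S₁)).injective
  rw [doldPuppeEquiv_dimQuotIso, dimQuotEquiv_naturality, doldPuppeEquiv_naturality,
    doldPuppeEquiv_dimQuotIso]
  exact presentationEquiv_naturality (midProj R S) (midProj R₁ S₁) _ _ _ _ _ _
    (midObjMap φ hR hS).hom _ (midProj_abMap φ hR hS) _ (simplicialResAug_naturality ℤ _) _
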